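/- **Setting.** Let $X,X_1,X_2,\dots$ be i.i.d. real random variables with a density $f$ and finite mean $\mu=EX<0$. Put $S_0=0$, $S_n=X_1+\dots+X_n$, $\tau_b=\inf\{n\ge1:S_n>b\}$ and $u(b)=P(\tau_b<\infty)$ for $b>0$. Write $\bar F(x)=P(X>x)$, $\Lambda=-\log\bar F$ (cumulative hazard function), $\lambda=f/\bar F$ (hazard function), $G(x)=\int_x^\infty\bar F(y)\,dy$, and $\Lambda^{-1}(y)=\inf\{x:\Lambda(x)\ge y\}$. Two alternative assumptions are considered. *Assumption A.* $\bar F(x)=L(x)x^{-\iota}$ for $x>0$, where $\iota>1$ and $L$ is slowly varying: $L(xt)/L(x)\to1$ as $x\to\infty$ for every $t\in(0,1]$. *Assumptions B1–B3.* There are $b_0>0$ and $\beta_0\in(0,1)$ such that (B1) $x\lambda(x)\to\infty$ as $x\to\infty$; (B2) $\lambda(x)/\Lambda(x)\le\beta_0/x$ for $x\ge b_0$; (B3) $\Lambda$ is concave on $[b_0,\infty)$. **The mixture sampler.** Its parameters are an integer $k\ge0$, a number $\eta_*>0$ and, as functions of the distance $t=b-s$ of the current position $s$ to the level, cut-off points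 $c_0<\dots<c_k$ and weights $p_*,p_{**},p_1,\dots,p_k\in[0,1)$ with $p_*+p_{**}+\sum_j p_j=1$ (for $t>\eta_*$). When the walk is at $s$, its next increment has density $q_s=f$ if $b-s\le\eta_*$, and if $b-s>\eta_*$ it has density $$q_s(x)=p_*\frac{f(x)I(x\le c_0)}{P(X\le c_0)}+p_{**}\frac{f(x)I(x>c_k)}{P(X>c_k)}+\sum_{j=1}^{k-1}p_j\frac{f(x)I(c_{j-1}<x\le c_j)}{P(c_{j-1}<X\le c_j)}+p_k\frac{f(t-x)I(c_{k-1}<x\le c_k)}{P(t-c_k<X\le t-c_{k-1})},$$ where the last two terms are absent for $k=0$. Let $Q$ (which depends on $b$) be the law of the walk with $S_0=0$ generated in this way. With $r_s(x)=f(x)/q_s(x)$ and $L_b=\prod_{i=1}^{\tau_b}r_{S_{i-1}}(S_i-S_{i-1})$, the estimator is $Z_b=I(\tau_b<\infty)L_b$. Call the sampler *strongly efficient* if, for all $b$ with the same parameters, the parameters satisfy the constraints above, each $q_s$ is a probability density, and, for all $b>0$, $u(b)>0$, $E^QZ_b=u(b)$, and for some $K\in(0,\infty)$ that does not depend on $b$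 $$\frac{E^QZ_b^2}{(E^QZ_b)^2}=\frac{E[L_b;\tau_b<\infty]}{u(b)^2}<K\qquad\text{for all }b>0 .$$ **Selection of the weights.** For $\delta\in(0,1/4)$ and $k\ge 0$ put $\theta=-\mu(1-\delta)/(1+\delta)^5$ and $$p_{**}(t)=\min\{2\theta\bar F(t)/G(t),\ \delta^2\},\qquad p_j(t)=\tfrac{\delta}{k+1}\,p_{**}(t)\ (1\le j\le k),\qquad p_*(t)=1-p_{**}(t)-\tfrac{k\delta}{k+1}\,p_{**}(t).$$ **Theorem.** 1. Under Assumption A, let $\delta\in(0,1/4)$ and $a_{**}>0$ be arbitrary, $k=0$ and $c_0(t)=\Lambda^{-1}(\Lambda(t)-a_{**})$. Then there is $\eta_0>0$ such that for every $\eta_*\ge\eta_0$ the sampler with these cut-offs and the above weights is strongly efficient. Moreover, for $t>\eta_*$ there is $a_*(t)>0$ with $\Lambda(t-c_0(t))=\Lambda(t)-a_*(t)$. 2. Under Assumptions B1–B3, call $(\sigma_1,k,a_1,\dots,a_{k-1})$ with $\sigma_1>0$, $k\ge2$, $0<a_1<\dots<a_{k-1}<1$ a *grid* if $2-2(1-x)^{\beta_0}-x^{\beta_0}\le0$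 for $x\in[0,\sigma_1]$, $a_1\le\sigma_1$, $a_{k-1}\ge1-\sigma_1$, and for some $\sigma_2>0$ we have $a_{j+1}-a_j\le\sigma_1/2$ and $a_j^{\beta_0}+(1-a_{j+1})^{\beta_0}\ge1+\sigma_2$ for $1\le j\le k-2$. Grids exist. For every grid and all $\delta\in(0,1/4)$, $a_*>0$, $a_{**}>0$ there is $\eta_0>0$ such that for every $\eta_*\ge\eta_0$ the sampler with $$c_0(t)=t-\Lambda^{-1}(\Lambda(t)-a_*),\qquad c_j(t)=a_jt\ (1\le j\le k-1),\qquad c_k(t)=\Lambda^{-1}(\Lambda(t)-a_{**})$$ and the above weights is strongly efficient. -/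

import Mathlib

open MeasureTheory ProbabilityTheory Filter Topology Set
open scoped ENNReal

noncomputable section

/-! ### The increment distribution -/

/-- The law on `ℝ` with Lebesgue density `f`. -/
def incrementLaw (f : ℝ → ℝ) : Measure ℝ :=
  (volume : Measure ℝ).withDensity (fun x => ENNReal.ofReal (f x))

/-- The mean `μ = E X`. -/
def meanOf (f : ℝ → ℝ) : ℝ := ∫ x, x ∂(incrementLaw f)

/-- The right tail `P(X > x)`. -/
def tailProb (f : ℝ → ℝ) (x : ℝ) : ℝ := (incrementLaw f).real (Ioi x)

/-- The cumulative hazard function `Λ`, so that `P(X > x) = exp (-Λ x)`. -/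
def cumHazard (f : ℝ → ℝ) (x : ℝ) : ℝ := -Real.log (tailProb f x)

/-- The hazard function `f(x) / P(X > x)`, so that `f(x) = hazardRate(x) * exp (-Λ x)`. -/
def hazardRate (f : ℝ → ℝ) (x : ℝ) : ℝ := f x / tailProb f x

/-- The (generalized) inverse `Λ⁻¹` of the cumulative hazard function. -/
def cumHazardInv (f : ℝ → ℝ) (y : ℝ) : ℝ := sInf {x : ℝ | y ≤ cumHazard f x}

/-- The integrated tail `G(x) = ∫_x^∞ P(X > u) du`. -/
def integratedTail (f : ℝ → ℝ) (x : ℝ) : ℝ := ∫ u in Ioi x, tailProb f u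

/-- `L` is slowly varying at infinity. -/
def SlowlyVarying (L : ℝ → ℝ) : Prop :=
  ∀ t ∈ Ioc (0 : ℝ) 1, Tendsto (fun x => L (x * t) / L x) atTop (𝓝 1)

/-- Assumption A with index `ι`: the right tail is regularly varying, with `ι > 1`. -/
structure AssumptionA (f : ℝ → ℝ) (ι : ℝ) : Prop where
  one_lt : 1 < ι
  regular : ∃ L : ℝ → ℝ, SlowlyVarying L ∧ ∀ x, 0 < x → tailProb f x = L x * x ^ (-ι)

/-- Assumptions B1, B2, B3 with constants `b₀` and `β₀`. -/
structure AssumptionB (f : ℝ → ℝ) (b₀ β₀ : ℝ) : Prop where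
  b₀_pos : 0 < b₀
  β₀_mem : β₀ ∈ Ioo (0 : ℝ) 1
  B1 : Tendsto (fun x => x * hazardRate f x) atTop atTop
  B2 : ∀ x, b₀ ≤ x → hazardRate f x / cumHazard f x ≤ β₀ / x
  B3 : ConcaveOn ℝ (Ici b₀) (cumHazard f)

/-! ### The mixture family -/

/-- The tuning parameters of the mixture sampler. Everything that depends on the current position
`s` of the walk is a function of the distance `t = b - s` to the level `b`: `c j t` are the cut-off
points, `0 ≤ j ≤ k`, and `pReg t`, `pBig t`, `pMid j t`, `1 ≤ j ≤ k`, are the mixture weights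
of the regular component, of the large jump component, and of the interpolating components. -/
structure Tuning where
  k : ℕ
  η : ℝ
  c : ℕ → ℝ → ℝ
  pReg : ℝ → ℝ
  pBig : ℝ → ℝ
  pMid : ℕ → ℝ → ℝ

/-- The component `f_*`: `X` conditioned on `X ≤ c_0`. -/
def regComponent (f : ℝ → ℝ) (T : Tuning) (t x : ℝ) : ℝ :=
  (Iic (T.c 0 t)).indicator f x / (incrementLaw f).real (Iic (T.c 0 t))

/-- The component `f_**`: `X` conditioned on `X > c_k`. -/
def bigComponent (f : ℝ → ℝ) (T : Tuning) (t x : ℝ) : ℝ :=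
  (Ioi (T.c T.k t)).indicator f x / (incrementLaw f).real (Ioi (T.c T.k t))

/-- The interpolating component `f_j`, `1 ≤ j ≤ k`: for `j < k` it is `X` conditioned on
`X ∈ (c_{j-1}, c_j]`; for `j = k` it is the reflected density `f (t - x)` on `(c_{k-1}, c_k]`. -/
def midComponent (f : ℝ → ℝ) (T : Tuning) (j : ℕ) (t x : ℝ) : ℝ :=
  if j < T.k then
    (Ioc (T.c (j - 1) t) (T.c j t)).indicator f x /
      (incrementLaw f).real (Ioc (T.c (j - 1) t) (T.c j t))
  else
    (Ioc (T.c (j - 1) t) (T.c j t)).indicator (fun y => f (t - y)) x /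
      (incrementLaw f).real (Ioc (t - T.c j t) (t - T.c (j - 1) t))

/-- The density `q_s(x)` of the next increment under the sampler for the level `b`, when the
current position is `s`. -/
def sampDensity (f : ℝ → ℝ) (T : Tuning) (b s x : ℝ) : ℝ :=
  if T.η < b - s then
    T.pReg (b - s) * regComponent f T (b - s) x + T.pBig (b - s) * bigComponent f T (b - s) x +
      ∑ j ∈ Finset.Icc 1 T.k, T.pMid j (b - s) * midComponent f T j (b - s) x
  else f x

/-- At every state where importance sampling is applied, the weights lie in `[0, 1)` and sum to
one, and the cut-off points increase (so the supports of the components are disjoint). -/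
structure Tuning.Admissible (T : Tuning) : Prop where
  η_pos : 0 < T.η
  pReg_mem : ∀ t, T.η < t → T.pReg t ∈ Ico (0 : ℝ) 1
  pBig_mem : ∀ t, T.η < t → T.pBig t ∈ Ico (0 : ℝ) 1
  pMid_mem : ∀ t, T.η < t → ∀ j ∈ Finset.Icc 1 T.k, T.pMid j t ∈ Ico (0 : ℝ) 1
  sum_eq_one : ∀ t, T.η < t →
    T.pReg t + T.pBig t + ∑ j ∈ Finset.Icc 1 T.k, T.pMid j t = 1
  cut_lt : ∀ t, T.η < t → ∀ j < T.k, T.c j t < T.c (j + 1) t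

/-! ### The law of the walk under the sampler -/

/-- `q s` is, for each `s`, a probability density on `ℝ`, jointly measurable in `(s, x)`. -/
structure IsTransitionDensity (q : ℝ → ℝ → ℝ) : Prop where
  measurable : Measurable (Function.uncurry q)
  nonneg : ∀ s x, 0 ≤ q s x
  lintegral_eq_one : ∀ s, ∫⁻ x, ENNReal.ofReal (q s x) = 1

/-- The law of the next increment as a function of the current position. -/
def incrementKernel (q : ℝ → ℝ → ℝ) : Kernel ℝ ℝ :=
  Kernel.withDensity (Kernel.const ℝ (volume : Measure ℝ)) (fun s x => ENNReal.ofReal (q s x))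

theorem incrementKernel_isMarkov {q : ℝ → ℝ → ℝ} (hq : IsTransitionDensity q) :
    IsMarkovKernel (incrementKernel q) := by
  refine ⟨fun s => ⟨?_⟩⟩
  have hm : Measurable (Function.uncurry fun s x => ENNReal.ofReal (q s x)) :=
    ENNReal.measurable_ofReal.comp hq.measurable
  rw [incrementKernel, Kernel.withDensity_apply _ hm, Kernel.const_apply,
    withDensity_apply _ MeasurableSet.univ, Measure.restrict_univ]
  exact hq.lintegral_eq_one s

/-- The law of the next position: from `s` the walk moves to `s + X`, where `X` has law
`incrementKernel q s`. -/
def stepKernel (q : ℝ → ℝ → ℝ) : Kernel ℝ ℝ :=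
  (Kernel.id ×ₖ incrementKernel q).map (fun z : ℝ × ℝ => z.1 + z.2)

theorem stepKernel_isMarkov {q : ℝ → ℝ → ℝ} (hq : IsTransitionDensity q) :
    IsMarkovKernel (stepKernel q) := by
  have := incrementKernel_isMarkov hq
  exact Kernel.IsMarkovKernel.map _ (measurable_fst.add measurable_snd)

/-- The law of the position at time `n + 1` given the positions at times `0, …, n`. -/
def historyKernel (q : ℝ → ℝ → ℝ) (n : ℕ) : Kernel (Finset.Iic n → ℝ) ℝ :=
  (stepKernel q).comap (fun h => h ⟨n, Finset.mem_Iic.2 le_rfl⟩) (measurable_pi_apply _)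

/-- The law `Q` on path space of `(S_0, S_1, …)` with `S_0 = 0` and with increments generated
successively from the densities `q_{S_n}`. -/
def walkLaw (q : ℝ → ℝ → ℝ) (hq : IsTransitionDensity q) : Measure (ℕ → ℝ) :=
  haveI : ∀ n, IsMarkovKernel (historyKernel q n) := fun n => by
    have := stepKernel_isMarkov hq
    unfold historyKernel
    infer_instance
  Kernel.traj (X := fun _ => ℝ) (historyKernel q) 0 (fun _ => 0)

/-! ### The estimator -/

/-- The event `τ_b < ∞` for the path `S`. -/
def Crosses (b : ℝ) (S : ℕ → ℝ) : Prop := ∃ n, 1 ≤ n ∧ b < S n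

/-- The first passage time `τ_b` (used on `τ_b < ∞` only). -/
def passageTime (b : ℝ) (S : ℕ → ℝ) : ℕ := sInf {n | 1 ≤ n ∧ b < S n}

/-- The local likelihood ratio `r_s(x) = f(x) / q_s(x)`. -/
def localRatio (f : ℝ → ℝ) (q : ℝ → ℝ → ℝ) (s x : ℝ) : ℝ≥0∞ :=
  ENNReal.ofReal (f x) / ENNReal.ofReal (q s x)

open Classical in
/-- The importance sampling estimator
`Z_b = I(τ_b < ∞) ∏_{i = 1}^{τ_b} r_{S_{i-1}}(S_i - S_{i-1})`. -/
def estimator (f : ℝ → ℝ) (q : ℝ → ℝ → ℝ) (b : ℝ) (S : ℕ → ℝ) : ℝ≥0∞ :=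
  if Crosses b S then
    ∏ i ∈ Finset.range (passageTime b S), localRatio f q (S i) (S (i + 1) - S i)
  else 0

/-- The random walk with increments `X 0, X 1, …` started at `0`. -/
def randomWalk {Ω : Type*} (X : ℕ → Ω → ℝ) (ω : Ω) (n : ℕ) : ℝ := ∑ i ∈ Finset.range n, X i ω

/-- `u(b) = P(τ_b < ∞)`. -/
def ruinProb {Ω : Type*} [MeasurableSpace Ω] (P : Measure Ω) (X : ℕ → Ω → ℝ) (b : ℝ) : ℝ≥0∞ :=
  P {ω | Crosses b (randomWalk X ω)}

/-- Strong efficiency of the sampler with tuning parameters `T` (the same for all levels `b`):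
the sampler is well defined, the estimator is unbiased, its second moment under `Q` equals
`E[L_b; τ_b < ∞]`, and `E^Q Z_b² / (E^Q Z_b)²` is bounded uniformly over `b > 0`. -/
def StronglyEfficient {Ω : Type*} [MeasurableSpace Ω] (P : Measure Ω) (X : ℕ → Ω → ℝ)
    (f : ℝ → ℝ) (T : Tuning) : Prop :=
  T.Admissible ∧
  ∃ hq : ∀ b, IsTransitionDensity (sampDensity f T b),
    (∀ b, 0 < b →
      ∫⁻ S, estimator f (sampDensity f T b) b S ∂(walkLaw _ (hq b)) = ruinProb P X b ∧
      ∫⁻ S, estimator f (sampDensity f T b) b S ^ 2 ∂(walkLaw _ (hq b)) =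
        ∫⁻ ω, estimator f (sampDensity f T b) b (randomWalk X ω) ∂P) ∧
    ∃ K : ℝ, 0 < K ∧ ∀ b, 0 < b → 0 < ruinProb P X b ∧
      (∫⁻ S, estimator f (sampDensity f T b) b S ^ 2 ∂(walkLaw _ (hq b))) /
        (∫⁻ S, estimator f (sampDensity f T b) b S ∂(walkLaw _ (hq b))) ^ 2 < ENNReal.ofReal K

/-! ### The explicit selection of the tuning parameters -/

/-- `θ = -μ (1 - δ) / (1 + δ)^5`. -/
def thetaOf (f : ℝ → ℝ) (δ : ℝ) : ℝ := -meanOf f * (1 - δ) / (1 + δ) ^ 5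

/-- `p_** = min (2 θ P(X > t) / G(t), δ²)`. -/
def bigWeight (f : ℝ → ℝ) (δ t : ℝ) : ℝ :=
  min (2 * thetaOf f δ * tailProb f t / integratedTail f t) (δ ^ 2)

/-- The weights `p_**`, `p_j = δ / (k + 1) * p_**` and `p_* = 1 - p_** - k δ / (k + 1) * p_**`,
with given `k`, `η` and cut-off points. -/
def withSelectedWeights (f : ℝ → ℝ) (δ : ℝ) (k : ℕ) (η : ℝ) (c : ℕ → ℝ → ℝ) : Tuning where
  k := k
  η := η
  c := c
  pReg t := 1 - bigWeight f δ t - k * (δ / (k + 1) * bigWeight f δ t)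
  pBig t := bigWeight f δ t
  pMid _ t := δ / (k + 1) * bigWeight f δ t

/-- The single cut-off point `Λ⁻¹(Λ(t) - a_**)` of the two-component mixture. -/
def cutA (f : ℝ → ℝ) (aBig : ℝ) (t : ℝ) : ℝ := cumHazardInv f (cumHazard f t - aBig)

/-- The selection under Assumption A: no interpolating component, `c_0 = Λ⁻¹(Λ(t) - a_**)`. -/
def selectA (f : ℝ → ℝ) (δ aBig η : ℝ) : Tuning :=
  withSelectedWeights f δ 0 η (fun _ t => cutA f aBig t)

/-- The cut-off points under Assumption B: `c_0 = t - Λ⁻¹(Λ(t) - a_*)`, `c_j = a_j t` for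
`1 ≤ j ≤ k - 1`, and `c_k = Λ⁻¹(Λ(t) - a_**)`. -/
def cutB (f : ℝ → ℝ) (aReg aBig : ℝ) (k : ℕ) (a : ℕ → ℝ) (j : ℕ) (t : ℝ) : ℝ :=
  if j = 0 then t - cumHazardInv f (cumHazard f t - aReg)
  else if j < k then a j * t
  else cumHazardInv f (cumHazard f t - aBig)

/-- The selection under Assumption B. -/
def selectB (f : ℝ → ℝ) (δ aReg aBig : ℝ) (k : ℕ) (a : ℕ → ℝ) (η : ℝ) : Tuning :=
  withSelectedWeights f δ k η (cutB f aReg aBig k a)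

/-- The conditions on the precomputed grid `0 < a_1 < ⋯ < a_{k-1} < 1` (it depends on `β₀` and
on the mesh parameter `σ` only). -/
structure IsGrid (β₀ σ : ℝ) (k : ℕ) (a : ℕ → ℝ) : Prop where
  σ_pos : 0 < σ
  σ_small : ∀ x ∈ Icc (0 : ℝ) σ, 2 - 2 * (1 - x) ^ β₀ - x ^ β₀ ≤ 0
  two_le : 2 ≤ k
  first_pos : 0 < a 1
  first_le : a 1 ≤ σ
  le_last : 1 - σ ≤ a (k - 1)
  last_lt : a (k - 1) < 1
  increasing : ∀ j, 1 ≤ j → j + 2 ≤ k → a j < a (j + 1)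
  mesh_le : ∀ j, 1 ≤ j → j + 2 ≤ k → a (j + 1) - a j ≤ σ / 2
  gap : ∃ σ₂ : ℝ, 0 < σ₂ ∧
    ∀ j, 1 ≤ j → j + 2 ≤ k → 1 + σ₂ ≤ a j ^ β₀ + (1 - a (j + 1)) ^ β₀

end

/-! Write `F` for the right tail, `G` for the integrated tail, `g = G(η)`, `μ < 0` for the mean and
`t = b - s` for the distance to the level. The second moment of the estimator under `Q` is the
expectation of `L_b` on passage under the original law, and a Lyapunov function controls it. Suppose
`E[r_s(X) W(b - s - X)] ≤ W(b - s)` for `s ≤ b`. The likelihood ratio times `W(b - S_n)` is then a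
supermartingale up to passage, and `W ≥ 1` on the negative half-line bounds the second moment by
`W(b)` (`IsWalk.lintegral_estimator_le`). The choice `W(t) = min(1, G(t)/g)²` is the square of the
order of magnitude of `u(b)`. The matching bound `u(b) ≥ κ min(1, G(b)/g)` comes from the strong law
and a single big jump (`exists_le_ruinProb`, `exists_mul_le_min_integratedTail`), so the relative
second moment is at most `1/κ²`.

The drift inequality is trivial for `t ≤ η`, where `q_s = f` and `W = 1`. For `t > η` the increment
is split by the supports of the components (`lintegral_localRatio_mul_lyapunov_le`). Regular
increments contribute about `(G² + 2μ G F) / (p_* g²)`, by dominated convergence with long tails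
(`tendsto_integral_regular`). Dividing by `p_*` costs about `2(1+δ)θ G F / g²`, and the definition
of `θ` makes `(1+δ)θ < -μ`, so a negative multiple of `G F / g²` is left over. Big jumps contribute
`F(c_k)² / p_**`, of order `F G`, which is negligible against `G F / g²` because `g → 0` as `η`
grows. The interpolating components contribute `e(t) F² / (p_j g²)` with `e(t) → 0`. The bookkeeping
is `lyapunov_budget`; what the tail has to provide is collected in `CutConditions`.

Under Assumption A the single cut-off lies between two proportions of `t`, and regular variation
gives every condition. Under Assumption B the hazard `Λ` is absolutely continuous with derivative
`λ` almost everywhere. Integrating B1 makes the tail lighter than every power; integrating B2 gives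
`Λ(s) ≥ (s/t)^β₀ Λ(t)`. The grid inequalities turn this scaling into `2Λ(t-x) + Λ(x) ≥ 2Λ(t)` near
the ends of `[0, t]` (with `x` and `t-x` exchanged at the upper end), and into a sum of hazards at
least `(1+σ₂)Λ(t)` in between. The polynomial factors lost on the way are absorbed by the tails at
the outer cut-offs and by the surplus `σ₂`. Concavity B3 keeps `G(t - c_0)` comparable with `G(t)`.
-/

open MeasureTheory ProbabilityTheory Filter Topology Set
open scoped ENNReal

noncomputable section

section

/-! ### Laws of walks with state-dependent increments -/

/-- `μ` is the law of a walk started at `0` whose next increment, at the position `s`, has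
density `q s`. -/
structure IsWalk (q : ℝ → ℝ → ℝ) (μ : Measure (ℕ → ℝ)) : Prop where
  isProb : IsProbabilityMeasure μ
  start : ∀ᵐ S ∂μ, S 0 = 0
  step : ∀ (n : ℕ) (Φ : (ℕ → ℝ) → ℝ≥0∞), Measurable Φ → DependsOn Φ (Iic (n + 1)) →
    ∫⁻ S, Φ S ∂μ =
      ∫⁻ S, (∫⁻ x, Φ (Function.update S (n + 1) (S n + x)) * ENNReal.ofReal (q (S n) x)) ∂μ

theorem measurable_ofReal_uncurry {q : ℝ → ℝ → ℝ} (hq : IsTransitionDensity q) :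
    Measurable (Function.uncurry fun s x => ENNReal.ofReal (q s x)) :=
  ENNReal.measurable_ofReal.comp hq.measurable

theorem lintegral_stepKernel {q : ℝ → ℝ → ℝ} (hq : IsTransitionDensity q) (s : ℝ)
    {φ : ℝ → ℝ≥0∞} (hφ : Measurable φ) :
    ∫⁻ y, φ y ∂(stepKernel q s) = ∫⁻ x, φ (s + x) * ENNReal.ofReal (q s x) := by
  have := incrementKernel_isMarkov hq
  have hm := measurable_ofReal_uncurry hq
  rw [stepKernel, Kernel.lintegral_map _ (by fun_prop) _ hφ, Kernel.lintegral_id_prod (by fun_prop),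
    incrementKernel, Kernel.withDensity_apply _ hm, Kernel.const_apply,
    lintegral_withDensity_eq_lintegral_mul _ hm.of_uncurry_left (by fun_prop)]
  simp [mul_comm]

theorem historyKernel_isMarkov {q : ℝ → ℝ → ℝ} (hq : IsTransitionDensity q) (n : ℕ) :
    IsMarkovKernel (historyKernel q n) := by
  have := stepKernel_isMarkov hq
  unfold historyKernel
  infer_instance

-- A function of the coordinates up to `n + 1` sees the trajectory only through its finite history,
-- whose law is the composition of the history up to `n` with one more kernel. Padding the history
-- with zeros makes `Φ` a function of it.
open Preorder in
theorem Kernel.lintegral_traj_eq_lmarginalPartialTraj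
    (κ : (n : ℕ) → Kernel (Finset.Iic n → ℝ) ℝ) [∀ n, IsMarkovKernel (κ n)]
    (x₀ : Finset.Iic 0 → ℝ) (n : ℕ) {Φ : (ℕ → ℝ) → ℝ≥0∞} (hΦ : Measurable Φ)
    (hdep : DependsOn Φ (Iic (n + 1))) :
    ∫⁻ S, Φ S ∂(Kernel.traj (X := fun _ => ℝ) κ 0 x₀) =
      ∫⁻ S, ∫⁻ y, Φ (Function.update S (n + 1) y) ∂(κ n (frestrictLe n S))
        ∂(Kernel.traj (X := fun _ => ℝ) κ 0 x₀) := by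
  let e : (Finset.Iic (n + 1) → ℝ) → ℕ → ℝ := fun h =>
    Function.updateFinset (π := fun _ : ℕ => ℝ) (fun _ => 0) (Finset.Iic (n + 1)) h
  have he : Measurable e := measurable_updateFinset
  have hΦe : ∀ S : ℕ → ℝ, Φ S = Φ (e (frestrictLe (n + 1) S)) := by
    intro S
    refine hdep fun i hi => ?_
    have : i ≤ n + 1 := hi
    simp [e, Function.updateFinset, this]
  have h1 : ∫⁻ S, Φ S ∂(Kernel.traj (X := fun _ => ℝ) κ 0 x₀) =
      ∫⁻ h, Φ (e h) ∂(Kernel.partialTraj (X := fun _ => ℝ) κ 0 (n + 1) x₀) := by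
    rw [← Kernel.traj_map_frestrictLe_apply (X := fun _ => ℝ), lintegral_map (by fun_prop)
      (by fun_prop)]
    exact lintegral_congr fun S => hΦe S
  have h2 : ∀ S : ℕ → ℝ, ∫⁻ y, Φ (Function.update S (n + 1) y) ∂(κ n (frestrictLe n S)) =
      ∫⁻ z, Φ (e z) ∂(Kernel.partialTraj (X := fun _ => ℝ) κ n (n + 1) (frestrictLe n S)) := by
    intro S
    rw [← Kernel.lmarginalPartialTraj_succ (X := fun _ => ℝ) n hΦ S, Kernel.lmarginalPartialTraj]
    refine lintegral_congr fun z => hdep fun i hi => ?_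
    have : i ≤ n + 1 := hi
    simp [e, Function.updateFinset, this]
  simp_rw [h2]
  rw [h1, Kernel.partialTraj_succ_eq_comp (Nat.zero_le n), Kernel.lintegral_comp _ _ _
    (by fun_prop), ← Kernel.traj_map_frestrictLe_apply (X := fun _ => ℝ),
    lintegral_map (by exact Measurable.lintegral_kernel (by fun_prop)) (by fun_prop)]

theorem isWalk_walkLaw {q : ℝ → ℝ → ℝ} (hq : IsTransitionDensity q) : IsWalk q (walkLaw q hq) := by
  have := historyKernel_isMarkov hq
  refine ⟨by unfold walkLaw; infer_instance, ?_, ?_⟩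
  · have h := Kernel.traj_map_frestrictLe_apply (X := fun _ => ℝ) (κ := historyKernel q) 0 0
      (fun _ => 0)
    rw [Kernel.partialTraj_self, Kernel.id_apply] at h
    have h2 : ∀ᵐ z ∂((walkLaw q hq).map (Preorder.frestrictLe (π := fun _ => ℝ) 0)),
        z ⟨0, by simp⟩ = 0 := by
      unfold walkLaw
      rw [h]
      refine (ae_dirac_iff ?_).2 rfl
      exact measurableSet_eq_fun (by fun_prop) (by fun_prop)
    exact ae_of_ae_map (by fun_prop) h2
  · intro n Φ hΦ hdep
    unfold walkLaw
    rw [Kernel.lintegral_traj_eq_lmarginalPartialTraj _ _ n hΦ hdep]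
    refine lintegral_congr fun S => ?_
    rw [historyKernel, Kernel.comap_apply, lintegral_stepKernel hq]
    · rfl
    · fun_prop

end

/-! ### The i.i.d. walk -/

section

theorem measurable_randomWalk {Ω : Type*} [MeasurableSpace Ω] {X : ℕ → Ω → ℝ}
    (hX : ∀ n, Measurable (X n)) : Measurable (randomWalk X) := by
  refine measurable_pi_lambda _ fun n => ?_
  unfold randomWalk
  fun_prop

theorem lintegral_incrementLaw {f : ℝ → ℝ} (hf : Measurable f) {φ : ℝ → ℝ≥0∞}
    (hφ : Measurable φ) :
    ∫⁻ x, φ x ∂(incrementLaw f) = ∫⁻ x, φ x * ENNReal.ofReal (f x) := by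
  rw [incrementLaw, lintegral_withDensity_eq_lintegral_mul _ (by fun_prop) hφ]
  simp [mul_comm]

/-- The positions up to time `n` are functions of the first `n` increments, which are independent of
the next one, so Fubini gives the one-step formula. The original walk and the sampled walk thereby
share one interface, and changes of measure can be done step by step. -/
theorem isWalk_map_randomWalk {Ω : Type*} [MeasurableSpace Ω] (P : Measure Ω)
    [IsProbabilityMeasure P] {X : ℕ → Ω → ℝ} (hX : ∀ n, Measurable (X n)) (hindep : iIndepFun X P)
    {f : ℝ → ℝ} (hf : Measurable f) (hlaw : ∀ n, Measure.map (X n) P = incrementLaw f) :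
    IsWalk (fun _ => f) (P.map (randomWalk X)) := by
  have hW := measurable_randomWalk hX
  refine ⟨Measure.isProbabilityMeasure_map hW.aemeasurable, ?_, ?_⟩
  · rw [ae_map_iff hW.aemeasurable (measurableSet_eq_fun (by fun_prop) (by fun_prop))]
    exact ae_of_all _ fun ω => by simp [randomWalk]
  · intro n Φ hΦ hdep
    let Z : Ω → (Finset.range n → ℝ) := fun ω i => X i ω
    have hZ : Measurable Z := by fun_prop
    -- The positions rebuilt from the first `n` increments. They are frozen after time `n`, which is
    -- harmless: coordinate `n + 1` is overwritten and `Φ` ignores the later ones.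
    let g : (Finset.range n → ℝ) → ℕ → ℝ := fun z m =>
      ∑ i : Finset.range n, if (i : ℕ) < m then z i else 0
    have hg : Measurable g := by
      refine measurable_pi_lambda _ fun m => Finset.measurable_sum _ fun i _ => ?_
      split_ifs <;> fun_prop
    have hgZ : ∀ ω, ∀ m ≤ n, g (Z ω) m = randomWalk X ω m := by
      intro ω m hm
      simp only [g, Z, randomWalk]
      rw [Finset.sum_coe_sort (Finset.range n) (fun i => if i < m then X i ω else 0),
        ← Finset.sum_filter]
      congr 1
      ext i
      simp only [Finset.mem_filter, Finset.mem_range]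
      omega
    have hΨ : Measurable fun p : (Finset.range n → ℝ) × ℝ =>
        Φ (Function.update (g p.1) (n + 1) (g p.1 n + p.2)) := by
      refine hΦ.comp (measurable_pi_lambda _ fun m => ?_)
      by_cases hm : m = n + 1
      · subst hm; simp only [Function.update_self]; fun_prop
      · simp only [Function.update_of_ne hm]; fun_prop
    have hupd : ∀ ω y, Φ (Function.update (randomWalk X ω) (n + 1) y) =
        Φ (Function.update (g (Z ω)) (n + 1) y) := by
      intro ω y
      refine hdep fun i hi => ?_
      rcases eq_or_ne i (n + 1) with rfl | hne
      · simp
      · have : i ≤ n + 1 := hi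
        rw [Function.update_of_ne hne, Function.update_of_ne hne, hgZ ω i (by omega)]
    have hind : IndepFun Z (X n) P := by
      have h := hindep.indepFun_finset (Finset.range n) {n} (by simp) hX
      exact h.comp (φ := id) (ψ := fun z : (({n} : Finset ℕ) → ℝ) => z ⟨n, by simp⟩)
        measurable_id (by fun_prop)
    have hprod := (indepFun_iff_map_prod_eq_prod_map_map hZ.aemeasurable (hX n).aemeasurable).1 hind
    have hL : ∀ ω, Φ (randomWalk X ω) =
        Φ (Function.update (g (Z ω)) (n + 1) (g (Z ω) n + X n ω)) := by
      intro ω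
      rw [← hupd, hgZ ω n le_rfl]
      congr 1
      ext i
      rcases eq_or_ne i (n + 1) with rfl | hne
      · simp [randomWalk, Finset.sum_range_succ]
      · rw [Function.update_of_ne hne]
    rw [lintegral_map hΦ hW]
    have hprob : IsProbabilityMeasure (incrementLaw f) :=
      hlaw 0 ▸ Measure.isProbabilityMeasure_map (hX 0).aemeasurable
    have hZprob : IsProbabilityMeasure (P.map Z) := Measure.isProbabilityMeasure_map hZ.aemeasurable
    calc ∫⁻ ω, Φ (randomWalk X ω) ∂P
        = ∫⁻ p, Φ (Function.update (g p.1) (n + 1) (g p.1 n + p.2))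
            ∂(P.map fun ω => (Z ω, X n ω)) := by
          rw [lintegral_map hΨ (hZ.prodMk (hX n))]
          exact lintegral_congr hL
      _ = ∫⁻ z, ∫⁻ x, Φ (Function.update (g z) (n + 1) (g z n + x)) ∂(incrementLaw f)
            ∂(P.map Z) := by
          rw [hprod, hlaw, lintegral_prod _ hΨ.aemeasurable]
      _ = ∫⁻ ω, ∫⁻ x, Φ (Function.update (g (Z ω)) (n + 1) (g (Z ω) n + x)) ∂(incrementLaw f)
            ∂P := by
          rw [lintegral_map hΨ.lintegral_prod_right' hZ]
      _ = _ := by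
          rw [lintegral_map _ hW]
          · refine lintegral_congr fun ω => ?_
            rw [lintegral_incrementLaw hf (by exact hΨ.of_uncurry_left (f := fun z x =>
              Φ (Function.update (g z) (n + 1) (g z n + x))) (x := Z ω))]
            simp_rw [hupd, hgZ ω n le_rfl]
          · refine Measurable.lintegral_prod_right' (f := fun p : (ℕ → ℝ) × ℝ =>
              Φ (Function.update p.1 (n + 1) (p.1 n + p.2)) * ENNReal.ofReal (f p.2)) ?_
            refine Measurable.mul (hΦ.comp (measurable_pi_lambda _ fun m => ?_)) (by fun_prop)
            by_cases hm : m = n + 1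
            · subst hm; simp only [Function.update_self]; fun_prop
            · simp only [Function.update_of_ne hm]; fun_prop

/-! ### The likelihood ratio along a path -/

/-- The likelihood ratio of the first `n` steps. -/
def pathRatio (f : ℝ → ℝ) (q : ℝ → ℝ → ℝ) (n : ℕ) (S : ℕ → ℝ) : ℝ≥0∞ :=
  ∏ i ∈ Finset.range n, localRatio f q (S i) (S (i + 1) - S i)

theorem dependsOn_pathRatio (f : ℝ → ℝ) (q : ℝ → ℝ → ℝ) (n : ℕ) :
    DependsOn (pathRatio f q n) (Iic n) := by
  intro S S' h
  refine Finset.prod_congr rfl fun i hi => ?_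
  have hi := Finset.mem_range.1 hi
  rw [h i (by simp; omega), h (i + 1) (by simp; omega)]

theorem measurable_localRatio {f : ℝ → ℝ} {q : ℝ → ℝ → ℝ} (hf : Measurable f)
    (hq : Measurable (Function.uncurry q)) :
    Measurable fun p : ℝ × ℝ => localRatio f q p.1 p.2 := by
  unfold localRatio
  have : Measurable fun p : ℝ × ℝ => q p.1 p.2 := hq
  fun_prop

theorem measurable_pathRatio {f : ℝ → ℝ} {q : ℝ → ℝ → ℝ} (hf : Measurable f)
    (hq : Measurable (Function.uncurry q)) (n : ℕ) : Measurable (pathRatio f q n) := by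
  unfold pathRatio
  refine Finset.measurable_prod _ fun i _ => ?_
  exact (measurable_localRatio hf hq).comp (f := fun S : ℕ → ℝ => (S i, S (i + 1) - S i))
    (by fun_prop)

theorem measurable_update_add (n : ℕ) :
    Measurable fun p : (ℕ → ℝ) × ℝ => Function.update p.1 (n + 1) (p.1 n + p.2) := by
  refine measurable_pi_lambda _ fun m => ?_
  by_cases hm : m = n + 1
  · subst hm; simp only [Function.update_self]; fun_prop
  · simp only [Function.update_of_ne hm]; fun_prop

theorem pathRatio_update_succ (f : ℝ → ℝ) (q : ℝ → ℝ → ℝ) (n : ℕ) (S : ℕ → ℝ) (x : ℝ) :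
    pathRatio f q (n + 1) (Function.update S (n + 1) (S n + x)) =
      pathRatio f q n S * localRatio f q (S n) x := by
  have h : pathRatio f q n (Function.update S (n + 1) (S n + x)) = pathRatio f q n S := by
    refine dependsOn_pathRatio f q n fun i hi => ?_
    have : i ≤ n := hi
    rw [Function.update_of_ne (by omega)]
  rw [pathRatio, Finset.prod_range_succ, ← pathRatio, h]
  simp

/-- `E^Q[Φ(S_0, …, S_n) ∏ r_{S_{i-1}}(S_i - S_{i-1})]` is the expectation of `Φ` under the original
law. -/
theorem IsWalk.lintegral_mul_pathRatio {f : ℝ → ℝ} {q : ℝ → ℝ → ℝ} {Q ν : Measure (ℕ → ℝ)}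
    (hf : Measurable f) (hq : Measurable (Function.uncurry q)) (hQ : IsWalk q Q)
    (hR : IsWalk (fun _ => f) ν)
    (hratio : ∀ s x, localRatio f q s x * ENNReal.ofReal (q s x) = ENNReal.ofReal (f x))
    (n : ℕ) {Φ : (ℕ → ℝ) → ℝ≥0∞} (hΦ : Measurable Φ) (hdep : DependsOn Φ (Iic n)) :
    ∫⁻ S, Φ S * pathRatio f q n S ∂Q = ∫⁻ S, Φ S ∂ν := by
  induction n generalizing Φ with
  | zero =>
    have key : ∀ {q' : ℝ → ℝ → ℝ} {μ : Measure (ℕ → ℝ)}, IsWalk q' μ →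
        ∫⁻ S, Φ S ∂μ = Φ 0 := by
      intro q' μ hμ
      have := hμ.isProb
      have : ∀ᵐ S ∂μ, Φ S = Φ 0 := by
        filter_upwards [hμ.start] with S hS
        refine hdep fun i hi => ?_
        have : i = 0 := Nat.le_zero.1 hi
        simpa [this] using hS
      rw [lintegral_congr_ae this]
      simp
    simp [pathRatio, key hQ, key hR]
  | succ n ih =>
    have hdep' : DependsOn (fun S => Φ S * pathRatio f q (n + 1) S) (Iic (n + 1)) := by
      intro S S' h
      simp only [hdep h, dependsOn_pathRatio f q (n + 1) h]
    have hm2 : Measurable fun p : (ℕ → ℝ) × ℝ => Φ (Function.update p.1 (n + 1) (p.1 n + p.2)) :=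
      hΦ.comp (measurable_update_add n)
    have hm : Measurable fun S : ℕ → ℝ =>
        ∫⁻ x, Φ (Function.update S (n + 1) (S n + x)) * ENNReal.ofReal (f x) :=
      Measurable.lintegral_prod_right' (f := fun p : (ℕ → ℝ) × ℝ =>
        Φ (Function.update p.1 (n + 1) (p.1 n + p.2)) * ENNReal.ofReal (f p.2))
        (hm2.mul (by fun_prop))
    -- The last increment is integrated out under both laws. Since `r q = f`, what remains under `Q`
    -- is the same function of the first `n` steps times their likelihood ratio, and the induction
    -- hypothesis applies.
    rw [hQ.step n (fun S => Φ S * pathRatio f q (n + 1) S) (hΦ.mul (measurable_pathRatio hf hq _)) hdep', hR.step n Φ hΦ hdep,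
      ← ih hm]
    · refine lintegral_congr fun S => ?_
      have hm3 : Measurable fun x =>
          Φ (Function.update S (n + 1) (S n + x)) * ENNReal.ofReal (f x) :=
        (hm2.of_uncurry_left (f := fun S x => Φ (Function.update S (n + 1) (S n + x)))).mul
          (by fun_prop)
      rw [← lintegral_mul_const _ hm3]
      refine lintegral_congr fun x => ?_
      rw [pathRatio_update_succ, ← hratio (S n) x]
      ring
    · intro S S' h
      refine lintegral_congr fun x => ?_
      rw [h n (by simp)]
      congr 1
      refine hdep fun i hi => ?_
      have : i ≤ n + 1 := hi
      rcases eq_or_ne i (n + 1) with rfl | hne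
      · simp
      · rw [Function.update_of_ne hne, Function.update_of_ne hne]
        exact h i (by simp; omega)

end

section

/-! ### First passage and the estimator -/

/-- The path crosses the level `b` for the first time at time `n + 1`. -/
def firstPassage (b : ℝ) (n : ℕ) : Set (ℕ → ℝ) := {S | b < S (n + 1) ∧ ∀ m < n, S (m + 1) ≤ b}

/-- The path stays below the level `b` at the times `1, …, n`. -/
def staysBelow (b : ℝ) (n : ℕ) : Set (ℕ → ℝ) := {S | ∀ m < n, S (m + 1) ≤ b}

theorem measurableSet_staysBelow (b : ℝ) (n : ℕ) : MeasurableSet (staysBelow b n) := by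
  simp only [staysBelow, Set.ofPred_forall]
  exact MeasurableSet.iInter fun m => MeasurableSet.iInter fun _ =>
    measurableSet_le (by fun_prop) (by fun_prop)

theorem firstPassage_eq (b : ℝ) (n : ℕ) :
    firstPassage b n = {S | b < S (n + 1)} ∩ staysBelow b n := rfl

theorem measurableSet_firstPassage (b : ℝ) (n : ℕ) : MeasurableSet (firstPassage b n) := by
  rw [firstPassage_eq]
  exact (measurableSet_lt (by fun_prop) (by fun_prop)).inter (measurableSet_staysBelow b n)

theorem pairwise_disjoint_firstPassage (b : ℝ) : Pairwise (Function.onFun Disjoint (firstPassage b)) := by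
  have key : ∀ {m n : ℕ}, m < n →
      Disjoint (firstPassage b m) (firstPassage b n) := fun {m n} hmn =>
    Set.disjoint_left.2 fun S hm hn => absurd (hn.2 _ hmn) (not_le.2 hm.1)
  intro m n hmn
  rcases lt_or_gt_of_ne hmn with h | h
  · exact key h
  · exact (key h).symm

theorem setOf_crosses_eq_iUnion (b : ℝ) : {S | Crosses b S} = ⋃ n, firstPassage b n := by
  ext S
  simp only [Set.mem_ofPred_eq, mem_iUnion]
  constructor
  · intro h
    classical
    obtain ⟨h1, h2⟩ := Nat.find_spec h
    refine ⟨Nat.find h - 1, ?_, fun m hm => ?_⟩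
    · rwa [Nat.sub_add_cancel h1]
    · have := Nat.find_min h (m := m + 1) (by omega)
      push Not at this
      exact this (by omega)
  · rintro ⟨n, h, -⟩
    exact ⟨n + 1, by omega, h⟩

theorem passageTime_eq {b : ℝ} {n : ℕ} {S : ℕ → ℝ} (h : S ∈ firstPassage b n) :
    passageTime b S = n + 1 := by
  refine le_antisymm (Nat.sInf_le ⟨by omega, h.1⟩) ?_
  refine le_csInf ⟨n + 1, by simp, h.1⟩ fun m hm => ?_
  by_contra hlt
  obtain ⟨k, rfl⟩ := Nat.exists_eq_add_of_le' hm.1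
  exact absurd (h.2 k (by omega)) (not_le.2 hm.2)

/-- The first-passage events are disjoint, so at most one term is nonzero; `φ 0 = 0` covers paths
that never cross. It serves for the identity and for the square. -/
theorem comp_estimator_eq_tsum {φ : ℝ≥0∞ → ℝ≥0∞} (hφ : φ 0 = 0) (f : ℝ → ℝ) (q : ℝ → ℝ → ℝ) (b : ℝ)
    (S : ℕ → ℝ) : φ (estimator f q b S) =
      ∑' n, (firstPassage b n).indicator (fun S => φ (pathRatio f q (n + 1) S)) S := by
  by_cases h : Crosses b S
  · have h' : S ∈ ⋃ n, firstPassage b n := by rw [← setOf_crosses_eq_iUnion]; exact h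
    obtain ⟨n, hn⟩ := mem_iUnion.1 h'
    rw [tsum_eq_single n, indicator_of_mem hn, estimator, if_pos h, passageTime_eq hn, pathRatio]
    intro m hm
    exact indicator_of_notMem (fun hm' => Set.disjoint_left.1
      (pairwise_disjoint_firstPassage b hm) hm' hn) _
  · rw [estimator, if_neg h, hφ, eq_comm, ENNReal.tsum_eq_zero]
    intro n
    refine indicator_of_notMem (fun hn => h ?_) _
    exact ⟨n + 1, by omega, hn.1⟩

theorem estimator_eq_tsum (f : ℝ → ℝ) (q : ℝ → ℝ → ℝ) (b : ℝ) (S : ℕ → ℝ) : estimator f q b S =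
      ∑' n, (firstPassage b n).indicator (pathRatio f q (n + 1)) S :=
  comp_estimator_eq_tsum (φ := id) rfl f q b S

theorem measurable_estimator {f : ℝ → ℝ} {q : ℝ → ℝ → ℝ} (hf : Measurable f)
    (hq : Measurable (Function.uncurry q)) (b : ℝ) : Measurable (estimator f q b) := by
  have : estimator f q b = fun S => ∑' n, (firstPassage b n).indicator (pathRatio f q (n + 1)) S :=
    funext fun S => estimator_eq_tsum f q b S
  rw [this]
  exact Measurable.tsum fun n =>
    (measurable_pathRatio hf hq _).indicator (measurableSet_firstPassage b n)

theorem dependsOn_indicator_firstPassage (b : ℝ) (n : ℕ) {Φ : (ℕ → ℝ) → ℝ≥0∞}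
    (hΦ : DependsOn Φ (Iic (n + 1))) :
    DependsOn ((firstPassage b n).indicator Φ) (Iic (n + 1)) := by
  classical
  intro S S' h
  have hmem : S ∈ firstPassage b n ↔ S' ∈ firstPassage b n := by
    refine and_congr (by rw [h (n + 1) (by simp)]) (forall₂_congr fun m hm => ?_)
    rw [h (m + 1) (by simp; omega)]
  simp only [indicator_apply, hmem, hΦ h]

variable {f : ℝ → ℝ} {q : ℝ → ℝ → ℝ} {Q ν : Measure (ℕ → ℝ)}

theorem IsWalk.lintegral_estimator (hf : Measurable f) (hq : Measurable (Function.uncurry q))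
    (hQ : IsWalk q Q) (hν : IsWalk (fun _ => f) ν)
    (hratio : ∀ s x, localRatio f q s x * ENNReal.ofReal (q s x) = ENNReal.ofReal (f x)) (b : ℝ) :
    ∫⁻ S, estimator f q b S ∂Q = ν {S | Crosses b S} := by
  simp_rw [estimator_eq_tsum]
  rw [lintegral_tsum fun n => ((measurable_pathRatio hf hq _).indicator
    (measurableSet_firstPassage b n)).aemeasurable, setOf_crosses_eq_iUnion,
    measure_iUnion (pairwise_disjoint_firstPassage b) (measurableSet_firstPassage b)]
  refine tsum_congr fun n => ?_
  rw [← lintegral_indicator_one (measurableSet_firstPassage b n), ← hQ.lintegral_mul_pathRatio hf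
    hq hν hratio (n + 1) (measurable_one.indicator (measurableSet_firstPassage b n))
    (dependsOn_indicator_firstPassage b n fun _ _ _ => rfl)]
  refine lintegral_congr fun S => ?_
  by_cases h : S ∈ firstPassage b n <;> simp [h]

/-- One factor of the squared likelihood ratio pays for the change of measure; the other stays in
the integrand. -/
theorem IsWalk.lintegral_estimator_sq (hf : Measurable f) (hq : Measurable (Function.uncurry q))
    (hQ : IsWalk q Q) (hν : IsWalk (fun _ => f) ν)
    (hratio : ∀ s x, localRatio f q s x * ENNReal.ofReal (q s x) = ENNReal.ofReal (f x)) (b : ℝ) :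
    ∫⁻ S, estimator f q b S ^ 2 ∂Q = ∫⁻ S, estimator f q b S ∂ν := by
  have hsq : ∀ S, estimator f q b S ^ 2 =
      ∑' n, (firstPassage b n).indicator (fun S => pathRatio f q (n + 1) S ^ 2) S := fun S =>
    comp_estimator_eq_tsum (φ := fun z => z ^ 2) (by simp) f q b S
  simp_rw [hsq, estimator_eq_tsum f q b]
  have hm := fun n => measurable_pathRatio hf hq n
  rw [lintegral_tsum fun n => (((hm _).pow_const 2).indicator
    (measurableSet_firstPassage b n)).aemeasurable,
    lintegral_tsum fun n => ((hm _).indicator (measurableSet_firstPassage b n)).aemeasurable]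
  refine tsum_congr fun n => ?_
  rw [← hQ.lintegral_mul_pathRatio hf hq hν hratio (n + 1)
    ((hm (n + 1)).indicator (measurableSet_firstPassage b n))
    (dependsOn_indicator_firstPassage b n (dependsOn_pathRatio f q (n + 1)))]
  refine lintegral_congr fun S => ?_
  by_cases h : S ∈ firstPassage b n <;> simp [h, sq]

/-- The Lyapunov bound for the second moment of the estimator. -/
theorem IsWalk.lintegral_estimator_le (hf : Measurable f) (hq : Measurable (Function.uncurry q))
    (hν : IsWalk (fun _ => f) ν) {b : ℝ} (hb : 0 < b) {W : ℝ → ℝ≥0∞} (hW : Measurable W)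
    (hneg : ∀ t < 0, 1 ≤ W t)
    (hlyap : ∀ s ≤ b, ∫⁻ x, localRatio f q s x * W (b - s - x) * ENNReal.ofReal (f x) ≤ W (b - s)) :
    ∫⁻ S, estimator f q b S ∂ν ≤ W b := by
  have hm := fun n => measurable_pathRatio hf hq n
  have hbelow : ∀ n, Measurable fun S : ℕ → ℝ =>
      (staysBelow b n).indicator (fun S => pathRatio f q n S * W (b - S n)) S := fun n =>
    ((hm n).mul (by fun_prop)).indicator (measurableSet_staysBelow b n)
  -- The supermartingale in telescoped form: what has been collected at passages up to time `N`,
  -- plus the `W`-weighted mass of the paths still below the level, never exceeds `W b`.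
  have key : ∀ N, ∑ n ∈ Finset.range N,
      ∫⁻ S, (firstPassage b n).indicator (pathRatio f q (n + 1)) S ∂ν +
      ∫⁻ S, (staysBelow b N).indicator (fun S => pathRatio f q N S * W (b - S N)) S ∂ν ≤ W b := by
    intro N
    induction N with
    | zero =>
      have := hν.isProb
      have h0 : ∀ᵐ S ∂ν,
          (staysBelow b 0).indicator (fun S => pathRatio f q 0 S * W (b - S 0)) S = W b := by
        filter_upwards [hν.start] with S hS
        rw [indicator_of_mem (by simp [staysBelow])]
        simp [pathRatio, hS]
      rw [lintegral_congr_ae h0]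
      simp
    | succ N ih =>
      refine le_trans ?_ ih
      rw [Finset.sum_range_succ, add_assoc]
      refine add_le_add le_rfl ?_
      rw [← lintegral_add_right _ (hbelow _)]
      -- A path that crosses now has `b - S (N + 1) < 0`, where `W ≥ 1`; so the `W`-weight pays for
      -- the collected term.
      have hstep : ∀ S : ℕ → ℝ, (firstPassage b N).indicator (pathRatio f q (N + 1)) S +
          (staysBelow b (N + 1)).indicator
            (fun S => pathRatio f q (N + 1) S * W (b - S (N + 1))) S ≤
          (staysBelow b N).indicator
            (fun S => pathRatio f q (N + 1) S * W (b - S (N + 1))) S := by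
        intro S
        by_cases h : S ∈ staysBelow b N
        · rw [indicator_of_mem h]
          rcases lt_or_ge b (S (N + 1)) with hlt | hge
          · have h1 : S ∈ firstPassage b N := ⟨hlt, h⟩
            have h2 : S ∉ staysBelow b (N + 1) := fun h' =>
              absurd (h' N (by omega)) (not_le.2 hlt)
            rw [indicator_of_mem h1, indicator_of_notMem h2, add_zero]
            exact le_mul_of_one_le_right' (hneg _ (by linarith))
          · have h1 : S ∉ firstPassage b N := fun h' => absurd hge (not_le.2 h'.1)
            rw [indicator_of_notMem h1, zero_add]
            exact indicator_le_self _ _ S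
        · have h1 : S ∉ firstPassage b N := fun h' => h h'.2
          have h2 : S ∉ staysBelow b (N + 1) := fun h' => h fun m hm => h' m (by omega)
          simp [h, h1, h2]
      refine (lintegral_mono hstep).trans ?_
      have hdep : DependsOn (fun S : ℕ → ℝ => (staysBelow b N).indicator
          (fun S => pathRatio f q (N + 1) S * W (b - S (N + 1))) S) (Iic (N + 1)) := by
        classical
        intro S S' h
        have hmem : S ∈ staysBelow b N ↔ S' ∈ staysBelow b N := by
          refine forall₂_congr fun m hm => ?_
          rw [h (m + 1) (by simp; omega)]
        simp only [indicator_apply, hmem, dependsOn_pathRatio f q (N + 1) h, h (N + 1) (by simp)]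
      rw [hν.step N (fun S => (staysBelow b N).indicator
        (fun S => pathRatio f q (N + 1) S * W (b - S (N + 1))) S) (((hm _).mul (by fun_prop)).indicator (measurableSet_staysBelow b N)) hdep]
      refine lintegral_mono_ae ?_
      filter_upwards [hν.start] with S hS
      have hmem : ∀ x, Function.update S (N + 1) (S N + x) ∈ staysBelow b N ↔
          S ∈ staysBelow b N := by
        intro x
        refine forall₂_congr fun m hm => ?_
        rw [Function.update_of_ne (by omega)]
      by_cases h : S ∈ staysBelow b N
      · have hSb : S N ≤ b := by
          rcases N with _ | N
          · rw [hS]; exact hb.le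
          · exact h N (by omega)
        rw [indicator_of_mem h]
        have hmr : Measurable fun x => localRatio f q (S N) x :=
          (measurable_localRatio hf hq).of_uncurry_left (f := fun s x => localRatio f q s x)
        calc _ = ∫⁻ x, pathRatio f q N S *
              (localRatio f q (S N) x * W (b - S N - x) * ENNReal.ofReal (f x)) := by
              refine lintegral_congr fun x => ?_
              rw [indicator_of_mem ((hmem x).2 h), pathRatio_update_succ, Function.update_self,
                sub_add_eq_sub_sub]
              ring
          _ = pathRatio f q N S *
              ∫⁻ x, localRatio f q (S N) x * W (b - S N - x) * ENNReal.ofReal (f x) :=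
            lintegral_const_mul _ (by fun_prop)
          _ ≤ _ := by gcongr; exact hlyap _ hSb
      · simp [h, hmem]
  simp_rw [estimator_eq_tsum f q b]
  rw [lintegral_tsum fun n => ((hm _).indicator (measurableSet_firstPassage b n)).aemeasurable]
  exact ENNReal.tsum_le_of_sum_range_le fun N => le_self_add.trans (key N)

end

section

/-! ### The tail, the integrated tail and the cumulative hazard -/

/-- `f` is a probability density on `ℝ` with finite negative mean and everywhere positive tail. -/
structure IsNegDriftDensity (f : ℝ → ℝ) : Prop where
  measurable : Measurable f
  nonneg : ∀ x, 0 ≤ f x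
  isProb : IsProbabilityMeasure (incrementLaw f)
  integrable : Integrable (fun x : ℝ => x) (incrementLaw f)
  mean_neg : meanOf f < 0
  tail_pos : ∀ x, 0 < tailProb f x

instance nullSingletonClass_incrementLaw (f : ℝ → ℝ) : NullSingletonClass (incrementLaw f) := by
  unfold incrementLaw
  infer_instance

namespace IsNegDriftDensity

variable {f : ℝ → ℝ} (h : IsNegDriftDensity f)
include h

theorem tailProb_antitone : Antitone (tailProb f) := fun x y hxy => by
  have := h.isProb
  exact measureReal_mono (Ioi_subset_Ioi hxy)

theorem tailProb_le_one (x : ℝ) : tailProb f x ≤ 1 := by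
  have := h.isProb
  exact measureReal_le_one

theorem real_Iic (x : ℝ) : (incrementLaw f).real (Iic x) = 1 - tailProb f x := by
  have := h.isProb
  rw [tailProb, ← compl_Iic, probReal_compl_eq_one_sub measurableSet_Iic]
  ring

theorem real_Ioc {x y : ℝ} (hxy : x ≤ y) :
    (incrementLaw f).real (Ioc x y) = tailProb f x - tailProb f y := by
  have := h.isProb
  rw [tailProb, tailProb, ← Ioc_union_Ioi_eq_Ioi hxy,
    measureReal_union Ioc_disjoint_Ioi_same measurableSet_Ioi]
  ring

theorem integrable_density : Integrable f := by
  have := h.isProb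
  refine ⟨h.measurable.aestronglyMeasurable, ?_⟩
  rw [hasFiniteIntegral_iff_ofReal (ae_of_all _ h.nonneg)]
  have : incrementLaw f univ < ⊤ := measure_lt_top _ _
  simpa [incrementLaw, withDensity_apply _ MeasurableSet.univ] using this

theorem lintegral_density : ∫⁻ x, ENNReal.ofReal (f x) = 1 := by
  have := h.isProb
  have : incrementLaw f univ = 1 := measure_univ
  simpa [incrementLaw, withDensity_apply _ MeasurableSet.univ] using this

theorem setLIntegral_density {s : Set ℝ} (hs : MeasurableSet s) :
    ∫⁻ x in s, ENNReal.ofReal (f x) = ENNReal.ofReal ((incrementLaw f).real s) := by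
  have := h.isProb
  rw [ofReal_measureReal, incrementLaw, withDensity_apply _ hs]

theorem real_eq_setIntegral {s : Set ℝ} (hs : MeasurableSet s) :
    (incrementLaw f).real s = ∫ x in s, f x := by
  rw [integral_eq_lintegral_of_nonneg_ae (ae_of_all _ h.nonneg)
    h.measurable.aestronglyMeasurable, Measure.real, incrementLaw, withDensity_apply _ hs]

theorem tailProb_sub_eq_intervalIntegral {x y : ℝ} (hxy : x ≤ y) :
    tailProb f x - tailProb f y = ∫ u in x..y, f u := by
  rw [← h.real_Ioc hxy, h.real_eq_setIntegral measurableSet_Ioc,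
    intervalIntegral.integral_of_le hxy]

theorem tailProb_eq (x : ℝ) : tailProb f x = tailProb f 0 - ∫ u in (0 : ℝ)..x, f u := by
  rcases le_total 0 x with hx | hx
  · linarith [h.tailProb_sub_eq_intervalIntegral hx]
  · rw [intervalIntegral.integral_symm]
    linarith [h.tailProb_sub_eq_intervalIntegral hx]

theorem continuous_tailProb : Continuous (tailProb f) := by
  have : tailProb f = fun x => tailProb f 0 - ∫ u in (0 : ℝ)..x, f u := funext h.tailProb_eq
  rw [this]
  exact continuous_const.sub (intervalIntegral.continuous_primitive
    (fun a b => h.integrable_density.intervalIntegrable) 0)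

theorem tailProb_eq_one_sub_cdf : tailProb f = fun x => 1 - cdf (incrementLaw f) x := by
  have := h.isProb
  funext x
  rw [cdf_eq_real, h.real_Iic]
  ring

theorem tendsto_tailProb_atTop : Tendsto (tailProb f) atTop (𝓝 0) := by
  rw [h.tailProb_eq_one_sub_cdf]
  simpa using (tendsto_cdf_atTop (incrementLaw f)).const_sub 1

theorem tendsto_tailProb_atBot : Tendsto (tailProb f) atBot (𝓝 1) := by
  rw [h.tailProb_eq_one_sub_cdf]
  simpa using (tendsto_cdf_atBot (incrementLaw f)).const_sub 1

/-- On the positive half-line this is the layer-cake formula for the positive part of the increment,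
which has finite mean; the rest is a bounded interval. -/
theorem integrableOn_tailProb (x : ℝ) : IntegrableOn (tailProb f) (Ioi x) := by
  have hP := h.isProb
  have hm : Measurable (tailProb f) := h.continuous_tailProb.measurable
  have h0 : IntegrableOn (tailProb f) (Ioi 0) := by
    refine ⟨hm.aestronglyMeasurable, ?_⟩
    rw [hasFiniteIntegral_iff_ofReal (ae_of_all _ fun x => (h.tail_pos x).le)]
    have hcake := lintegral_eq_lintegral_meas_lt (incrementLaw f) (f := fun y : ℝ => max y 0)
      (ae_of_all _ fun y => le_max_right _ _) (by fun_prop)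
    have heq : ∫⁻ u in Ioi (0 : ℝ), ENNReal.ofReal (tailProb f u) =
        ∫⁻ u in Ioi (0 : ℝ), incrementLaw f {y | u < max y 0} := by
      refine setLIntegral_congr_fun measurableSet_Ioi fun u hu => ?_
      have hu : 0 < u := hu
      have hset : {y : ℝ | u < max y 0} = Ioi u := by
        ext y
        simp [not_lt.2 hu.le]
      rw [hset, tailProb, ofReal_measureReal]
    rw [heq, ← hcake]
    exact h.integrable.pos_part.lintegral_lt_top
  have h1 : IntegrableOn (tailProb f) (Ioc x 0) :=
    (h.continuous_tailProb.integrableOn_Icc).mono_set Ioc_subset_Icc_self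
  refine (h1.union h0).mono_set fun u hu => ?_
  rcases le_or_gt u 0 with h' | h'
  · exact Or.inl ⟨hu, h'⟩
  · exact Or.inr h'

theorem integratedTail_sub {x y : ℝ} (hxy : x ≤ y) :
    integratedTail f x - integratedTail f y = ∫ u in Ioc x y, tailProb f u := by
  rw [integratedTail, integratedTail, ← Ioc_union_Ioi_eq_Ioi hxy,
    setIntegral_union Ioc_disjoint_Ioi_same measurableSet_Ioi
      ((h.integrableOn_tailProb x).mono_set Ioc_subset_Ioi_self) (h.integrableOn_tailProb y)]
  ring

theorem mul_tailProb_le_integratedTail_sub {x y : ℝ} (hxy : x ≤ y) :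
    (y - x) * tailProb f y ≤ integratedTail f x - integratedTail f y := by
  rw [h.integratedTail_sub hxy]
  have h1 : ∫ u in Ioc x y, tailProb f y = (y - x) * tailProb f y := by
    simp [max_eq_left (sub_nonneg.2 hxy)]
  rw [← h1]
  exact setIntegral_mono_on (by simp)
    ((h.integrableOn_tailProb x).mono_set Ioc_subset_Ioi_self) measurableSet_Ioc
    fun u hu => h.tailProb_antitone hu.2

theorem integratedTail_sub_le_mul_tailProb {x y : ℝ} (hxy : x ≤ y) :
    integratedTail f x - integratedTail f y ≤ (y - x) * tailProb f x := by
  rw [h.integratedTail_sub hxy]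
  have h1 : ∫ u in Ioc x y, tailProb f x = (y - x) * tailProb f x := by
    simp [max_eq_left (sub_nonneg.2 hxy)]
  rw [← h1]
  exact setIntegral_mono_on ((h.integrableOn_tailProb x).mono_set Ioc_subset_Ioi_self) (by simp)
    measurableSet_Ioc fun u hu => h.tailProb_antitone hu.1.le

theorem integratedTail_antitone : Antitone (integratedTail f) := fun x y hxy => by
  have := h.mul_tailProb_le_integratedTail_sub hxy
  nlinarith [h.tail_pos y]

theorem integratedTail_pos (x : ℝ) : 0 < integratedTail f x := by
  have h1 := h.mul_tailProb_le_integratedTail_sub (x := x) (y := x + 1) (by linarith)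
  have h2 : 0 ≤ integratedTail f (x + 1) := integral_nonneg fun u => (h.tail_pos u).le
  have := h.tail_pos (x + 1)
  nlinarith

theorem tendsto_integratedTail : Tendsto (integratedTail f) atTop (𝓝 0) := by
  have h1 := intervalIntegral_tendsto_integral_Ioi 0 (h.integrableOn_tailProb 0) tendsto_id
  have h2 : ∀ᶠ x in atTop, integratedTail f 0 - ∫ u in (0 : ℝ)..x, tailProb f u =
      integratedTail f x := by
    filter_upwards [eventually_ge_atTop 0] with x hx
    rw [intervalIntegral.integral_of_le hx, ← h.integratedTail_sub hx]
    ring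
  refine Tendsto.congr' h2 ?_
  have := h1.const_sub (integratedTail f 0)
  rwa [← integratedTail, sub_self] at this

theorem exp_neg_cumHazard (x : ℝ) : Real.exp (-cumHazard f x) = tailProb f x := by
  rw [cumHazard, neg_neg, Real.exp_log (h.tail_pos x)]

theorem cumHazard_mono : Monotone (cumHazard f) := fun _ y hxy =>
  neg_le_neg (Real.log_le_log (h.tail_pos y) (h.tailProb_antitone hxy))

theorem cumHazard_nonneg (x : ℝ) : 0 ≤ cumHazard f x := by
  have := Real.log_nonpos (h.tail_pos x).le (h.tailProb_le_one x)
  unfold cumHazard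
  linarith

theorem continuous_cumHazard : Continuous (cumHazard f) :=
  (h.continuous_tailProb.log fun x => (h.tail_pos x).ne').neg

theorem tendsto_cumHazard_atTop : Tendsto (cumHazard f) atTop atTop := by
  have h1 : Tendsto (tailProb f) atTop (𝓝[>] 0) :=
    tendsto_nhdsWithin_iff.2 ⟨h.tendsto_tailProb_atTop, Eventually.of_forall h.tail_pos⟩
  exact tendsto_neg_atBot_atTop.comp (Real.tendsto_log_nhdsGT_zero.comp h1)

theorem tendsto_cumHazard_atBot : Tendsto (cumHazard f) atBot (𝓝 0) := by
  have h1 := (h.tendsto_tailProb_atBot.log one_ne_zero).neg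
  rw [Real.log_one, neg_zero] at h1
  exact h1

theorem nonempty_le_cumHazard (y : ℝ) : {x | y ≤ cumHazard f x}.Nonempty :=
  (h.tendsto_cumHazard_atTop.eventually_ge_atTop y).exists

theorem bddBelow_le_cumHazard {y : ℝ} (hy : 0 < y) : BddBelow {x | y ≤ cumHazard f x} := by
  obtain ⟨x, hx⟩ := (h.tendsto_cumHazard_atBot.eventually_lt_const hy).exists
  exact ⟨x, fun z hz => le_of_not_gt fun hzx =>
    absurd (hz.trans (h.cumHazard_mono hzx.le)) (not_le.2 hx)⟩

/-- By continuity of `Λ` the infimum is attained, and a strict inequality there would persist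
slightly to the left, contradicting minimality. For `y ≤ 0` the defining set is all of `ℝ`, hence
the restriction. -/
theorem cumHazard_cumHazardInv {y : ℝ} (hy : 0 < y) : cumHazard f (cumHazardInv f y) = y := by
  have hc := h.continuous_cumHazard
  have hmem : y ≤ cumHazard f (cumHazardInv f y) :=
    (isClosed_le continuous_const hc).csInf_mem (h.nonempty_le_cumHazard y)
      (h.bddBelow_le_cumHazard hy)
  refine le_antisymm (le_of_not_gt fun hlt => ?_) hmem
  obtain ⟨z, hz, hz'⟩ := (((hc.tendsto (cumHazardInv f y)).eventually
    (lt_mem_nhds hlt)).filter_mono nhdsWithin_le_nhds |>.and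
    (self_mem_nhdsWithin (s := Iio (cumHazardInv f y)))).exists
  exact absurd (csInf_le (h.bddBelow_le_cumHazard hy) (show z ∈ {x | y ≤ cumHazard f x} from hz.le))
    (not_le.2 hz')

theorem lt_cumHazardInv_iff {x y : ℝ} (hy : 0 < y) : x < cumHazardInv f y ↔ cumHazard f x < y := by
  constructor
  · intro hx
    by_contra hle
    exact absurd (csInf_le (h.bddBelow_le_cumHazard hy)
      (show x ∈ {x | y ≤ cumHazard f x} from not_lt.1 hle)) (not_le.2 hx)
  · intro hx
    by_contra hle
    have := h.cumHazard_mono (not_lt.1 hle)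
    rw [h.cumHazard_cumHazardInv hy] at this
    linarith

theorem tailProb_cumHazardInv_sub {t a : ℝ} (hy : 0 < cumHazard f t - a) :
    tailProb f (cumHazardInv f (cumHazard f t - a)) = Real.exp a * tailProb f t := by
  rw [← h.exp_neg_cumHazard, h.cumHazard_cumHazardInv hy, ← h.exp_neg_cumHazard, ← Real.exp_add]
  ring_nf

theorem measurable_cumHazardInv : Measurable (cumHazardInv f) := by
  -- The inverse is monotone on `y > 0` only: at `y ≤ 0` it takes the default value `0` of an
  -- infimum without lower bound. The substitution `y = exp z` removes the constraint.
  have hg : Monotone fun z => cumHazardInv f (Real.exp z) := fun z z' hzz' => by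
    refine csInf_le_csInf (h.bddBelow_le_cumHazard (Real.exp_pos _)) (h.nonempty_le_cumHazard _) ?_
    intro x hx
    exact (Real.exp_le_exp.2 hzz').trans hx
  have heq : cumHazardInv f =
      fun y => if y ≤ 0 then 0 else cumHazardInv f (Real.exp (Real.log y)) := by
    funext y
    split_ifs with hy
    · have : {x | y ≤ cumHazard f x} = univ :=
        eq_univ_of_forall fun x => hy.trans (h.cumHazard_nonneg x)
      rw [cumHazardInv, this, Real.sInf_univ]
    · rw [Real.exp_log (not_le.1 hy)]
  rw [heq]
  exact Measurable.ite measurableSet_Iic measurable_const (hg.measurable.comp Real.measurable_log)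

end IsNegDriftDensity

end

section

/-! ### A lower bound for the ruin probability -/

/-- If crossing has probability at most `1/4`, then with probability at least `3/4 - 1/4` the walk
at time `n` has not crossed and lies above `-M - nA`. From there one jump larger than `b + M + nA`
crosses. -/
theorem IsWalk.half_mul_tailProb_le {f : ℝ → ℝ} (h : IsNegDriftDensity f) {ν : Measure (ℕ → ℝ)}
    (hν : IsWalk (fun _ => f) ν) {b A M : ℝ} {B : Set (ℕ → ℝ)}
    (hB : ∀ S ∈ B, ∀ n : ℕ, -M - n * A ≤ S n) (hνB : 3 / 4 ≤ ν.real B)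
    (hu : ν.real {S | Crosses b S} ≤ 1 / 4) (n : ℕ) :
    1 / 2 * tailProb f (b + M + n * A) ≤ ν.real (firstPassage b n) := by
  have := hν.isProb
  have hP := h.isProb
  have hf := h.measurable
  let E : Set (ℕ → ℝ) := staysBelow b n ∩ {S | -M - n * A ≤ S n}
  have hE : MeasurableSet E :=
    (measurableSet_staysBelow b n).inter (measurableSet_le measurable_const (by fun_prop))
  have hEB : B \ {S | Crosses b S} ⊆ E := by
    rintro S ⟨hS, hc⟩
    refine ⟨fun m _ => ?_, hB S hS n⟩
    by_contra hlt
    exact hc ⟨m + 1, by omega, not_le.1 hlt⟩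
  have hhalf : 1 / 2 ≤ ν.real E := by
    have h1 : ν.real B ≤ ν.real (B \ {S | Crosses b S}) + ν.real {S | Crosses b S} :=
      (measureReal_mono (by simp)).trans (measureReal_union_le _ _)
    have h2 := measureReal_mono (μ := ν) hEB
    linarith
  have hstep : ENNReal.ofReal (tailProb f (b + M + n * A)) * ν E ≤ ν (firstPassage b n) := by
    have hmeas : MeasurableSet ({S : ℕ → ℝ | b < S (n + 1)} ∩ E) :=
      (measurableSet_lt measurable_const (by fun_prop)).inter hE
    have hdep : DependsOn (({S : ℕ → ℝ | b < S (n + 1)} ∩ E).indicator (1 : (ℕ → ℝ) → ℝ≥0∞))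
        (Iic (n + 1)) := by
      classical
      intro S S' hSS
      have hmem : S ∈ ({S : ℕ → ℝ | b < S (n + 1)} ∩ E) ↔
          S' ∈ ({S : ℕ → ℝ | b < S (n + 1)} ∩ E) := by
        refine and_congr (by simp [hSS (n + 1) (by simp)])
          (and_congr (forall₂_congr fun m hm => ?_) ?_)
        · rw [hSS (m + 1) (by simp; omega)]
        · simp [hSS n (by simp)]
      simp only [indicator_apply, hmem, Pi.one_apply]
    calc ENNReal.ofReal (tailProb f (b + M + n * A)) * ν E
        = ∫⁻ S, E.indicator (fun _ => ENNReal.ofReal (tailProb f (b + M + n * A))) S ∂ν := by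
          rw [lintegral_indicator_const hE]
      _ ≤ ∫⁻ S, (∫⁻ x, ({S : ℕ → ℝ | b < S (n + 1)} ∩ E).indicator 1
            (Function.update S (n + 1) (S n + x)) * ENNReal.ofReal (f x)) ∂ν := by
          refine lintegral_mono fun S => ?_
          by_cases hS : S ∈ E
          · rw [indicator_of_mem hS, tailProb, ofReal_measureReal, incrementLaw,
              withDensity_apply _ measurableSet_Ioi, ← lintegral_indicator measurableSet_Ioi]
            refine lintegral_mono fun x => ?_
            by_cases hx : x ∈ Ioi (b + M + n * A)
            · have hx' : b + M + n * A < x := hx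
              have hmem : Function.update S (n + 1) (S n + x) ∈
                  {S : ℕ → ℝ | b < S (n + 1)} ∩ E := by
                have h2 : -M - n * A ≤ S n := hS.2
                refine ⟨?_, fun m hm => ?_, ?_⟩
                · simp only [Set.mem_ofPred_eq, Function.update_self]
                  linarith
                · rw [Function.update_of_ne (by omega)]
                  exact hS.1 m hm
                · simp only [Set.mem_ofPred_eq]
                  rw [Function.update_of_ne (by omega)]
                  exact h2
              simp [hx, hmem]
            · simp [hx]
          · simp [hS]
      _ = ν ({S : ℕ → ℝ | b < S (n + 1)} ∩ E) := by
          rw [← hν.step n _ (measurable_one.indicator hmeas) hdep, lintegral_indicator_one hmeas]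
      _ ≤ ν (firstPassage b n) := measure_mono fun S hS => ⟨hS.1, hS.2.1⟩
  have hreal := ENNReal.toReal_mono (measure_ne_top _ _) hstep
  rw [ENNReal.toReal_mul, ENNReal.toReal_ofReal (h.tail_pos _).le] at hreal
  have h3 : 1 / 2 * tailProb f (b + M + n * A) ≤ tailProb f (b + M + n * A) * ν.real E := by
    have := h.tail_pos (b + M + n * A)
    nlinarith
  exact h3.trans hreal

theorem IsNegDriftDensity.integratedTail_sub_le_sum {f : ℝ → ℝ} (h : IsNegDriftDensity f) {A : ℝ}
    (hA : 0 < A) (c : ℝ) (N : ℕ) : integratedTail f c - integratedTail f (c + N * A) ≤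
      A * ∑ n ∈ Finset.range N, tailProb f (c + n * A) := by
  induction N with
  | zero => simp
  | succ N ih =>
    rw [Finset.sum_range_succ, mul_add]
    have := h.integratedTail_sub_le_mul_tailProb (x := c + N * A) (y := c + (N + 1 : ℕ) * A)
      (by push_cast; nlinarith)
    have h2 : c + ((N + 1 : ℕ) : ℝ) * A - (c + N * A) = A := by push_cast; ring
    rw [h2] at this
    linarith

/-- The one-jump bounds for distinct `n` concern disjoint events, and their sum is half of a Riemann
sum of mesh `A` for `G(b + M) / A`. The value `1/4` covers the levels where crossing is not rare. -/
theorem IsWalk.le_real_crosses {f : ℝ → ℝ} (h : IsNegDriftDensity f) {ν : Measure (ℕ → ℝ)}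
    (hν : IsWalk (fun _ => f) ν) {b A M : ℝ} (hA : 0 < A) {B : Set (ℕ → ℝ)}
    (hB : ∀ S ∈ B, ∀ n : ℕ, -M - n * A ≤ S n) (hνB : 3 / 4 ≤ ν.real B) :
    min (1 / 4) (integratedTail f (b + M) / (2 * A)) ≤ ν.real {S | Crosses b S} := by
  have := hν.isProb
  rcases le_total (1 / 4) (ν.real {S | Crosses b S}) with hu | hu
  · exact (min_le_left _ _).trans hu
  refine (min_le_right _ _).trans ?_
  have hsum : ∀ N : ℕ, (integratedTail f (b + M) - integratedTail f (b + M + N * A)) / (2 * A) ≤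
      ν.real {S | Crosses b S} := by
    intro N
    have h1 := h.integratedTail_sub_le_sum hA (b + M) N
    have h2 : ∑ n ∈ Finset.range N, ν.real (firstPassage b n) ≤ ν.real {S | Crosses b S} := by
      rw [← measureReal_biUnion_finset (fun i _ j _ hij => pairwise_disjoint_firstPassage b hij)
        (fun n _ => measurableSet_firstPassage b n), setOf_crosses_eq_iUnion]
      exact measureReal_mono (iUnion₂_subset fun n _ => subset_iUnion _ n)
    have h3 := Finset.sum_le_sum fun n (_ : n ∈ Finset.range N) =>
      hν.half_mul_tailProb_le h hB hνB hu n
    rw [← Finset.mul_sum] at h3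
    rw [div_le_iff₀ (by positivity)]
    nlinarith
  have hlim : Tendsto (fun N : ℕ =>
      (integratedTail f (b + M) - integratedTail f (b + M + N * A)) / (2 * A)) atTop
      (𝓝 ((integratedTail f (b + M) - 0) / (2 * A))) := by
    refine ((h.tendsto_integratedTail.comp ?_).const_sub _).div_const _
    exact tendsto_atTop_add_const_left _ _
      (tendsto_natCast_atTop_atTop.atTop_mul_const hA)
  rw [sub_zero] at hlim
  exact le_of_tendsto' hlim hsum

theorem exists_le_ruinProb {Ω : Type*} [MeasurableSpace Ω] (P : Measure Ω)
    [IsProbabilityMeasure P] {X : ℕ → Ω → ℝ} (hX : ∀ n, Measurable (X n)) (hindep : iIndepFun X P)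
    {f : ℝ → ℝ} (h : IsNegDriftDensity f) (hlaw : ∀ n, Measure.map (X n) P = incrementLaw f) :
    ∃ M A : ℝ, 0 < A ∧ ∀ b, 0 < b →
      min (1 / 4) (integratedTail f (b + M) / (2 * A)) ≤ (ruinProb P X b).toReal := by
  -- The slope `-A = μ - 1` is below `μ`. By the strong law almost every path stays above some line
  -- `-M - nA`, and a large deterministic `M` serves with probability above `3/4`.
  set A : ℝ := 1 - meanOf f with hA
  have hApos : 0 < A := by have := h.mean_neg; linarith
  have hRW := measurable_randomWalk hX
  have hident : ∀ i, IdentDistrib (X i) (X 0) P P := fun i =>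
    ⟨(hX i).aemeasurable, (hX 0).aemeasurable, by rw [hlaw, hlaw]⟩
  have hint : Integrable (X 0) P := by
    have := h.integrable
    rw [← hlaw 0, integrable_map_measure (by fun_prop) (hX 0).aemeasurable] at this
    exact this
  have hmean : P[X 0] = meanOf f := by
    rw [meanOf, ← hlaw 0, integral_map (hX 0).aemeasurable (by fun_prop)]
  have hslln := strong_law_ae_real X hint (fun i j hij => hindep.indepFun hij) hident
  rw [hmean] at hslln
  let B : ℕ → Set Ω := fun M => {ω | ∀ n : ℕ, -(M : ℝ) - n * A ≤ randomWalk X ω n}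
  have hBmono : Monotone B := by
    intro M M' hMM ω hω n
    have : (M : ℝ) ≤ M' := by exact_mod_cast hMM
    linarith [hω n]
  have hBun : ∀ᵐ ω ∂P, ω ∈ ⋃ M, B M := by
    filter_upwards [hslln] with ω hω
    have hev := hω.eventually (lt_mem_nhds (show -A < meanOf f by linarith))
    obtain ⟨N, hN⟩ := eventually_atTop.1 hev
    let C : ℝ := ∑ n ∈ Finset.range (N + 1), |randomWalk X ω n|
    obtain ⟨M, hM⟩ := exists_nat_ge C
    refine mem_iUnion.2 ⟨M, fun n => ?_⟩
    rcases le_or_gt n N with hn | hn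
    · have h1 : |randomWalk X ω n| ≤ C := Finset.single_le_sum
        (f := fun n => |randomWalk X ω n|) (fun i _ => abs_nonneg _)
        (Finset.mem_range.2 (by omega))
      have := neg_abs_le (randomWalk X ω n)
      have : 0 ≤ n * A := by positivity
      linarith
    · have h1 := hN n hn.le
      have hn0 : (0 : ℝ) < n := by exact_mod_cast (by omega : 0 < n)
      rw [lt_div_iff₀ hn0] at h1
      have : (0 : ℝ) ≤ M := by positivity
      have h3 : randomWalk X ω n = ∑ i ∈ Finset.range n, X i ω := rfl
      rw [h3]
      nlinarith
  have hlim := tendsto_measure_iUnion_atTop (μ := P) hBmono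
  have hone : P (⋃ M, B M) = 1 := by
    have huniv : (⋃ M, B M) =ᵐ[P] univ := eventuallyEq_univ.2 hBun
    rw [measure_congr huniv, measure_univ]
  rw [hone] at hlim
  obtain ⟨M, hM⟩ := (hlim.eventually (lt_mem_nhds (show ENNReal.ofReal (3 / 4) < 1 by
    rw [← ENNReal.ofReal_one]; exact (ENNReal.ofReal_lt_ofReal_iff one_pos).2 (by norm_num)))).exists
  refine ⟨M, A, hApos, fun b _ => ?_⟩
  have hν := isWalk_map_randomWalk P hX hindep h.measurable hlaw
  have hprob := hν.isProb
  let B' : Set (ℕ → ℝ) := {S | ∀ n : ℕ, -(M : ℝ) - n * A ≤ S n}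
  have hB' : MeasurableSet B' := by
    simp only [B', Set.ofPred_forall]
    exact MeasurableSet.iInter fun n => measurableSet_le measurable_const (by fun_prop)
  have key := hν.le_real_crosses h (b := b) hApos (B := B') (fun S hS n => hS n) (by
    rw [Measure.real, Measure.map_apply hRW hB']
    exact (ENNReal.ofReal_le_iff_le_toReal (measure_ne_top _ _)).1 hM.le)
  refine key.trans (le_of_eq ?_)
  rw [Measure.real, Measure.map_apply hRW]
  · rfl
  · rw [setOf_crosses_eq_iUnion]
    exact MeasurableSet.iUnion (measurableSet_firstPassage b)

end

section

/-! ### Long tails and the regular component -/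

/-- The tail of `f` is long: `P(X > t - x) ∼ P(X > t)` for every `x`. -/
def LongTailed (f : ℝ → ℝ) : Prop :=
  ∀ x, Tendsto (fun t => tailProb f (t - x) / tailProb f t) atTop (𝓝 1)

namespace IsNegDriftDensity

variable {f : ℝ → ℝ} (h : IsNegDriftDensity f)
include h

theorem mul_tailProb_le_integratedTail_shift (t x : ℝ) :
    x * tailProb f t ≤ integratedTail f (t - x) - integratedTail f t := by
  rcases le_total 0 x with hx | hx
  · have := h.mul_tailProb_le_integratedTail_sub (x := t - x) (y := t) (by linarith)
    simpa using this
  · have := h.integratedTail_sub_le_mul_tailProb (x := t) (y := t - x) (by linarith)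
    linarith

theorem integratedTail_shift_le_mul_tailProb (t x : ℝ) :
    integratedTail f (t - x) - integratedTail f t ≤ x * tailProb f (t - x) := by
  rcases le_total 0 x with hx | hx
  · have := h.integratedTail_sub_le_mul_tailProb (x := t - x) (y := t) (by linarith)
    simpa using this
  · have := h.mul_tailProb_le_integratedTail_sub (x := t) (y := t - x) (by linarith)
    linarith

theorem tendsto_integratedTail_shift_sub (hL : LongTailed f) (x : ℝ) :
    Tendsto (fun t => (integratedTail f (t - x) - integratedTail f t) / tailProb f t) atTop
      (𝓝 x) := by
  have hlim : Tendsto (fun t => x * (tailProb f (t - x) / tailProb f t)) atTop (𝓝 x) := by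
    simpa using (hL x).const_mul x
  refine tendsto_of_tendsto_of_tendsto_of_le_of_le tendsto_const_nhds hlim (fun t => ?_)
    fun t => ?_
  · rw [le_div_iff₀ (h.tail_pos t)]
    exact h.mul_tailProb_le_integratedTail_shift t x
  · have := h.tail_pos t
    simp only [← mul_div_assoc]
    gcongr
    exact h.integratedTail_shift_le_mul_tailProb t x

/-- For a long tail `G(t) - G(t + M + 1)` is asymptotic to `(M + 1) F(t)`, so `G/F` eventually
exceeds every `M`. -/
theorem tendsto_tailProb_div_integratedTail (hL : LongTailed f) :
    Tendsto (fun t => tailProb f t / integratedTail f t) atTop (𝓝 0) := by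
  have hinv : Tendsto (fun t => integratedTail f t / tailProb f t) atTop atTop := by
    refine tendsto_atTop.2 fun M => ?_
    filter_upwards [(h.tendsto_integratedTail_shift_sub hL (-(M + 1))).eventually
      (gt_mem_nhds (show -(M + 1) < -M by linarith))] with t ht
    have h1 := h.tail_pos t
    have h2 := h.integratedTail_pos (t - -(M + 1))
    rw [div_lt_iff₀ h1] at ht
    rw [le_div_iff₀ h1]
    linarith
  refine hinv.inv_tendsto_atTop.congr fun t => ?_
  simp

theorem tendsto_integratedTail_shift (hL : LongTailed f) (x : ℝ) :
    Tendsto (fun t => integratedTail f (t - x) / integratedTail f t) atTop (𝓝 1) := by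
  have h1 := ((h.tendsto_integratedTail_shift_sub hL x).mul
    (h.tendsto_tailProb_div_integratedTail hL)).const_add 1
  simp only [mul_zero, add_zero] at h1
  refine h1.congr fun t => ?_
  have := h.tail_pos t
  have := h.integratedTail_pos t
  field_simp
  ring

/-- Factor the difference of squares: `G(t-x) - G(t)` is asymptotic to `x F(t)` and `G(t-x) + G(t)`
to `2 G(t)`, so the integrand tends to `2x`. The bounds at the cut-off dominate it by a multiple of
`|x|`, which is integrable. -/
theorem tendsto_integral_regular (hL : LongTailed f) {c : ℝ → ℝ} (hc : Tendsto c atTop atTop)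
    {C : ℝ} (hF : ∀ᶠ t in atTop, tailProb f (t - c t) ≤ C * tailProb f t)
    (hG : ∀ᶠ t in atTop, integratedTail f (t - c t) ≤ C * integratedTail f t) :
    Tendsto (fun t => ∫ x, (Iic (c t)).indicator (fun x =>
      (integratedTail f (t - x) ^ 2 - integratedTail f t ^ 2) /
        (integratedTail f t * tailProb f t)) x ∂(incrementLaw f)) atTop (𝓝 (2 * meanOf f)) := by
  have hGm : Measurable (integratedTail f) := h.integratedTail_antitone.measurable
  have hlim : 2 * meanOf f = ∫ x, 2 * x ∂(incrementLaw f) := by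
    rw [integral_const_mul, meanOf]
  rw [hlim]
  -- The factor `|x| (|C| + 1)` bounds the difference of the `G`-values over `F(t)`, and `|C| + 2`
  -- bounds their sum over `G(t)`.
  refine tendsto_integral_filter_of_dominated_convergence
    (fun x => |x| * ((|C| + 1) * (|C| + 2))) ?_ ?_ ?_ ?_
  · refine Eventually.of_forall fun t => ?_
    refine Measurable.aestronglyMeasurable ?_
    refine Measurable.indicator ?_ measurableSet_Iic
    exact (((hGm.comp (measurable_const.sub measurable_id)).pow_const 2).sub
      measurable_const).div_const _
  · filter_upwards [hF, hG] with t hFt hGt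
    refine ae_of_all _ fun x => ?_
    have hf0 := h.tail_pos t
    have hg0 := h.integratedTail_pos t
    have hgx := h.integratedTail_pos (t - x)
    by_cases hx : x ∈ Iic (c t)
    · have hx' : x ≤ c t := hx
      rw [indicator_of_mem hx, Real.norm_eq_abs]
      have hsplit : (integratedTail f (t - x) ^ 2 - integratedTail f t ^ 2) /
          (integratedTail f t * tailProb f t) =
          (integratedTail f (t - x) - integratedTail f t) / tailProb f t *
          ((integratedTail f (t - x) + integratedTail f t) / integratedTail f t) := by
        field_simp
        ring
      have hCl : C ≤ |C| := le_abs_self C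
      have hFx : tailProb f (t - x) ≤ (|C| + 1) * tailProb f t := by
        have := h.tailProb_antitone (show t - c t ≤ t - x by linarith)
        nlinarith
      have hGx : integratedTail f (t - x) ≤ (|C| + 1) * integratedTail f t := by
        have := h.integratedTail_antitone (show t - c t ≤ t - x by linarith)
        nlinarith
      rw [hsplit, abs_mul, ← mul_assoc]
      refine mul_le_mul ?_ ?_ (abs_nonneg _) (by positivity)
      · rw [abs_div, abs_of_pos hf0, div_le_iff₀ hf0, abs_le]
        have hlo := h.mul_tailProb_le_integratedTail_shift t x
        have hhi := h.integratedTail_shift_le_mul_tailProb t x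
        have hC0 := abs_nonneg C
        constructor
        · have h1 : -|x| ≤ x := neg_abs_le x
          have h2 : 0 ≤ |x| * |C| * tailProb f t := by positivity
          nlinarith
        · have h1 : x * tailProb f (t - x) ≤ |x| * tailProb f (t - x) :=
            mul_le_mul_of_nonneg_right (le_abs_self x) (h.tail_pos _).le
          have h2 : |x| * tailProb f (t - x) ≤ |x| * ((|C| + 1) * tailProb f t) :=
            mul_le_mul_of_nonneg_left hFx (abs_nonneg x)
          linarith
      · rw [abs_of_pos (by positivity), div_le_iff₀ hg0]
        linarith
    · rw [indicator_of_notMem hx]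
      simp only [norm_zero]
      positivity
  · exact h.integrable.abs.mul_const _
  · refine ae_of_all _ fun x => ?_
    have h1 := (h.tendsto_integratedTail_shift_sub hL x).mul
      ((h.tendsto_integratedTail_shift hL x).add_const 1)
    rw [show x * (1 + 1) = 2 * x by ring] at h1
    refine h1.congr' ?_
    filter_upwards [hc.eventually_ge_atTop x] with t ht
    rw [indicator_of_mem (by exact ht)]
    have := h.tail_pos t
    have := h.integratedTail_pos t
    field_simp
    ring

theorem setLIntegral_regular_le (hL : LongTailed f) {c : ℝ → ℝ} (hc : Tendsto c atTop atTop)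
    {C : ℝ} (hF : ∀ᶠ t in atTop, tailProb f (t - c t) ≤ C * tailProb f t)
    (hG : ∀ᶠ t in atTop, integratedTail f (t - c t) ≤ C * integratedTail f t)
    {m : ℝ} (hm : 2 * meanOf f < m) :
    ∀ᶠ t in atTop, ∫⁻ x in Iic (c t), ENNReal.ofReal (integratedTail f (t - x) ^ 2 * f x) ≤
      ENNReal.ofReal (integratedTail f t ^ 2 + m * (integratedTail f t * tailProb f t)) := by
  have hP := h.isProb
  have hfm := h.measurable
  have hGm : Measurable (integratedTail f) := h.integratedTail_antitone.measurable
  filter_upwards [(h.tendsto_integral_regular hL hc hF hG).eventually (gt_mem_nhds hm)] with t ht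
  have hf0 := h.tail_pos t
  have hg0 := h.integratedTail_pos t
  have hsq : IntegrableOn (fun x => integratedTail f (t - x) ^ 2) (Iic (c t)) (incrementLaw f) := by
    refine Measure.integrableOn_of_bounded (M := integratedTail f (t - c t) ^ 2)
      (measure_ne_top _ _) (Measurable.aestronglyMeasurable (by fun_prop)) ?_
    refine (ae_restrict_iff' measurableSet_Iic).2 (ae_of_all _ fun x hx => ?_)
    have hx' : x ≤ c t := hx
    rw [Real.norm_eq_abs, abs_of_nonneg (sq_nonneg _)]
    exact pow_le_pow_left₀ (h.integratedTail_pos _).le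
      (h.integratedTail_antitone (by linarith)) 2
  rw [integral_indicator measurableSet_Iic, integral_div, integral_sub hsq (by simp),
    div_lt_iff₀ (by positivity), setIntegral_const, smul_eq_mul] at ht
  have hle : (incrementLaw f).real (Iic (c t)) * integratedTail f t ^ 2 ≤ integratedTail f t ^ 2 :=
    mul_le_of_le_one_left (sq_nonneg _) measureReal_le_one
  have heq : ∫⁻ x in Iic (c t), ENNReal.ofReal (integratedTail f (t - x) ^ 2 * f x) =
      ENNReal.ofReal (∫ x in Iic (c t), integratedTail f (t - x) ^ 2 ∂(incrementLaw f)) := by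
    rw [ofReal_integral_eq_lintegral_ofReal hsq (ae_of_all _ fun x => sq_nonneg _),
      ← lintegral_indicator measurableSet_Iic, ← lintegral_indicator measurableSet_Iic,
      lintegral_incrementLaw hfm (Measurable.indicator (by fun_prop) measurableSet_Iic)]
    refine lintegral_congr fun x => ?_
    by_cases hx : x ∈ Iic (c t)
    · rw [indicator_of_mem hx, indicator_of_mem hx, ENNReal.ofReal_mul (sq_nonneg _)]
    · simp [hx]
  rw [heq]
  exact ENNReal.ofReal_le_ofReal (by linarith)

end IsNegDriftDensity

end

section

/-! ### The sampling density -/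

theorem lintegral_indicator_div_eq_one {f : ℝ → ℝ} (h : IsNegDriftDensity f) {s : Set ℝ}
    (hs : MeasurableSet s) (hpos : 0 < (incrementLaw f).real s) :
    ∫⁻ x, ENNReal.ofReal (s.indicator f x / (incrementLaw f).real s) = 1 := by
  have h1 : ∀ x, ENNReal.ofReal (s.indicator f x / (incrementLaw f).real s) =
      ENNReal.ofReal (((incrementLaw f).real s)⁻¹) *
        s.indicator (fun x => ENNReal.ofReal (f x)) x := by
    intro x
    rw [div_eq_inv_mul, ENNReal.ofReal_mul (by positivity)]
    by_cases hx : x ∈ s <;> simp [hx]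
  simp_rw [h1]
  have hf := h.measurable
  rw [lintegral_const_mul _ (Measurable.indicator (by fun_prop) hs), lintegral_indicator hs,
    h.setLIntegral_density hs, ← ENNReal.ofReal_mul (by positivity), inv_mul_cancel₀ hpos.ne',
    ENNReal.ofReal_one]

theorem lintegral_midComponent {f : ℝ → ℝ} (h : IsNegDriftDensity f) {T : Tuning} {j : ℕ} {t : ℝ}
    (hmid : j < T.k → 0 < (incrementLaw f).real (Ioc (T.c (j - 1) t) (T.c j t)))
    (hlast : ¬ j < T.k → 0 < (incrementLaw f).real (Ioc (t - T.c j t) (t - T.c (j - 1) t))) :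
    ∫⁻ x, ENNReal.ofReal (midComponent f T j t x) = 1 := by
  unfold midComponent
  by_cases hj : j < T.k
  · simp only [if_pos hj]
    exact lintegral_indicator_div_eq_one h measurableSet_Ioc (hmid hj)
  · simp only [if_neg hj]
    set a := T.c (j - 1) t
    set c := T.c j t
    -- Reflection exchanges the open and the closed endpoint; the law has no atoms.
    have hreal : (incrementLaw f).real (Ioc (t - c) (t - a)) =
        (incrementLaw f).real (Ico (t - c) (t - a)) :=
      measureReal_congr Ico_ae_eq_Ioc.symm
    have hpos := hlast hj
    rw [hreal] at hpos ⊢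
    have h1 : ∀ x, (Ioc a c).indicator (fun y => f (t - y)) x =
        (Ico (t - c) (t - a)).indicator f (t - x) := by
      intro x
      have : x ∈ Ioc a c ↔ t - x ∈ Ico (t - c) (t - a) := by
        simp only [mem_Ioc, mem_Ico]
        constructor <;> rintro ⟨h1, h2⟩ <;> constructor <;> linarith
      by_cases hx : x ∈ Ioc a c
      · rw [indicator_of_mem hx, indicator_of_mem (this.1 hx)]
      · rw [indicator_of_notMem hx, indicator_of_notMem (fun h' => hx (this.2 h'))]
    simp_rw [h1]
    rw [lintegral_sub_left_eq_self (fun x => ENNReal.ofReal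
      ((Ico (t - c) (t - a)).indicator f x / (incrementLaw f).real (Ico (t - c) (t - a)))) t]
    exact lintegral_indicator_div_eq_one h measurableSet_Ico hpos

variable {f : ℝ → ℝ} {T : Tuning}

theorem regComponent_nonneg (hf : ∀ x, 0 ≤ f x) (t x : ℝ) : 0 ≤ regComponent f T t x :=
  div_nonneg (indicator_nonneg (fun x _ => hf x) x) measureReal_nonneg

theorem bigComponent_nonneg (hf : ∀ x, 0 ≤ f x) (t x : ℝ) : 0 ≤ bigComponent f T t x :=
  div_nonneg (indicator_nonneg (fun x _ => hf x) x) measureReal_nonneg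

theorem midComponent_nonneg (hf : ∀ x, 0 ≤ f x) (j : ℕ) (t x : ℝ) :
    0 ≤ midComponent f T j t x := by
  unfold midComponent
  split_ifs
  · exact div_nonneg (indicator_nonneg (fun x _ => hf x) x) measureReal_nonneg
  · exact div_nonneg (indicator_nonneg (fun x _ => hf _) x) measureReal_nonneg

/-- At the distance `t` from the level every component of the mixture is a probability density
with a positive weight, and the mixture is positive where `f` is. -/
structure Tuning.NondegenerateAt (T : Tuning) (f : ℝ → ℝ) (t : ℝ) : Prop where
  reg_mass : 0 < (incrementLaw f).real (Iic (T.c 0 t))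
  mid_mass : ∀ j ∈ Finset.Icc 1 T.k, j < T.k →
    0 < (incrementLaw f).real (Ioc (T.c (j - 1) t) (T.c j t))
  last_mass : 1 ≤ T.k → 0 < (incrementLaw f).real (Ioc (t - T.c T.k t) (t - T.c (T.k - 1) t))
  pReg_pos : 0 < T.pReg t
  pBig_pos : 0 < T.pBig t
  pMid_pos : ∀ j ∈ Finset.Icc 1 T.k, 0 < T.pMid j t
  sum_eq_one : T.pReg t + T.pBig t + ∑ j ∈ Finset.Icc 1 T.k, T.pMid j t = 1
  mid_pos : ∀ j ∈ Finset.Icc 1 T.k, ∀ x ∈ Ioc (T.c (j - 1) t) (T.c j t), 0 < f x →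
    0 < midComponent f T j t x

/-- The cut-off points split the line into the supports of the components. -/
theorem Tuning.mem_or_mem_or_mem (T : Tuning) (t x : ℝ) :
    x ≤ T.c 0 t ∨ T.c T.k t < x ∨
      ∃ j ∈ Finset.Icc 1 T.k, x ∈ Ioc (T.c (j - 1) t) (T.c j t) := by
  by_contra hcon
  push Not at hcon
  obtain ⟨h0, hk, hmid⟩ := hcon
  have : ∀ j ≤ T.k, T.c j t < x := by
    intro j
    induction j with
    | zero => exact fun _ => h0
    | succ j ih =>
      intro hj
      by_contra hle
      exact hmid (j + 1) (Finset.mem_Icc.2 ⟨by omega, hj⟩) ⟨ih (by omega), not_lt.1 hle⟩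
  exact absurd (this T.k le_rfl) (not_lt.2 hk)

namespace Tuning.NondegenerateAt

variable {b s : ℝ} (h : IsNegDriftDensity f) (hT : T.NondegenerateAt f (b - s)) (hη : T.η < b - s)
include h hT hη

theorem mul_regComponent_le (x : ℝ) :
    T.pReg (b - s) * regComponent f T (b - s) x ≤ sampDensity f T b s x := by
  rw [sampDensity, if_pos hη]
  have h1 := bigComponent_nonneg (T := T) h.nonneg (b - s) x
  have h2 := hT.pBig_pos
  have h3 : 0 ≤ ∑ j ∈ Finset.Icc 1 T.k, T.pMid j (b - s) * midComponent f T j (b - s) x :=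
    Finset.sum_nonneg fun j hj =>
      mul_nonneg (hT.pMid_pos j hj).le (midComponent_nonneg h.nonneg j _ _)
  have : 0 ≤ T.pBig (b - s) * bigComponent f T (b - s) x := by positivity
  linarith

theorem mul_bigComponent_le (x : ℝ) :
    T.pBig (b - s) * bigComponent f T (b - s) x ≤ sampDensity f T b s x := by
  rw [sampDensity, if_pos hη]
  have h1 := regComponent_nonneg (T := T) h.nonneg (b - s) x
  have h2 := hT.pReg_pos
  have h3 : 0 ≤ ∑ j ∈ Finset.Icc 1 T.k, T.pMid j (b - s) * midComponent f T j (b - s) x :=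
    Finset.sum_nonneg fun j hj =>
      mul_nonneg (hT.pMid_pos j hj).le (midComponent_nonneg h.nonneg j _ _)
  have : 0 ≤ T.pReg (b - s) * regComponent f T (b - s) x := by positivity
  linarith

theorem mul_midComponent_le (x : ℝ) {j : ℕ} (hj : j ∈ Finset.Icc 1 T.k) :
    T.pMid j (b - s) * midComponent f T j (b - s) x ≤ sampDensity f T b s x := by
  rw [sampDensity, if_pos hη]
  have h1 : 0 ≤ T.pReg (b - s) * regComponent f T (b - s) x :=
    mul_nonneg hT.pReg_pos.le (regComponent_nonneg h.nonneg _ _)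
  have h2 : 0 ≤ T.pBig (b - s) * bigComponent f T (b - s) x :=
    mul_nonneg hT.pBig_pos.le (bigComponent_nonneg h.nonneg _ _)
  have h3 := Finset.single_le_sum
    (f := fun j => T.pMid j (b - s) * midComponent f T j (b - s) x)
    (fun j hj => mul_nonneg (hT.pMid_pos j hj).le (midComponent_nonneg h.nonneg j _ _)) hj
  linarith

theorem sampDensity_nonneg (x : ℝ) : 0 ≤ sampDensity f T b s x :=
  (mul_nonneg hT.pReg_pos.le (regComponent_nonneg h.nonneg _ _)).trans
    (hT.mul_regComponent_le h hη x)

theorem sampDensity_pos {x : ℝ} (hx : 0 < f x) : 0 < sampDensity f T b s x := by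
  rcases T.mem_or_mem_or_mem (b - s) x with h0 | hk | ⟨j, hj, hm⟩
  · refine lt_of_lt_of_le (mul_pos hT.pReg_pos ?_) (hT.mul_regComponent_le h hη x)
    rw [regComponent, indicator_of_mem (by exact h0)]
    exact div_pos hx hT.reg_mass
  · refine lt_of_lt_of_le (mul_pos hT.pBig_pos ?_) (hT.mul_bigComponent_le h hη x)
    rw [bigComponent, indicator_of_mem (by exact hk)]
    exact div_pos hx (h.tail_pos _)
  · exact lt_of_lt_of_le (mul_pos (hT.pMid_pos j hj) (hT.mid_pos j hj x hm hx))
      (hT.mul_midComponent_le h hη x hj)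

end Tuning.NondegenerateAt

theorem measurable_real_Ioc (h : IsNegDriftDensity f) {g₁ g₂ : ℝ → ℝ} (h₁ : Measurable g₁)
    (h₂ : Measurable g₂) : Measurable fun t => (incrementLaw f).real (Ioc (g₁ t) (g₂ t)) := by
  have heq : (fun t => (incrementLaw f).real (Ioc (g₁ t) (g₂ t))) =
      fun t => max (tailProb f (g₁ t) - tailProb f (g₂ t)) 0 := by
    funext t
    rcases le_total (g₁ t) (g₂ t) with hle | hle
    · rw [h.real_Ioc hle, max_eq_left (sub_nonneg.2 (h.tailProb_antitone hle))]
    · rw [Ioc_eq_empty (not_lt.2 hle), max_eq_right (sub_nonpos.2 (h.tailProb_antitone hle))]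
      simp
  have hm := h.continuous_tailProb.measurable
  rw [heq]
  fun_prop

theorem measurable_indicator_of_prod {s : ℝ → Set ℝ} {φ : ℝ × ℝ → ℝ}
    (hs : MeasurableSet {p : ℝ × ℝ | p.2 ∈ s p.1}) (hφ : Measurable φ) :
    Measurable fun p : ℝ × ℝ => (s p.1).indicator (fun x => φ (p.1, x)) p.2 := by
  have heq : (fun p : ℝ × ℝ => (s p.1).indicator (fun x => φ (p.1, x)) p.2) =
      {p : ℝ × ℝ | p.2 ∈ s p.1}.indicator φ := by
    funext p
    by_cases hp : p.2 ∈ s p.1 <;> simp [hp]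
  rw [heq]
  exact hφ.indicator hs

theorem measurable_sampDensity (h : IsNegDriftDensity f) (hc : ∀ j, Measurable (T.c j))
    (hr : Measurable T.pReg) (hb : Measurable T.pBig) (hm : ∀ j, Measurable (T.pMid j)) (b : ℝ) :
    Measurable (Function.uncurry (sampDensity f T b)) := by
  have hf := h.measurable
  have hF := h.continuous_tailProb.measurable
  have hind : ∀ {g₁ g₂ : ℝ → ℝ} {φ : ℝ × ℝ → ℝ}, Measurable g₁ → Measurable g₂ → Measurable φ →
      Measurable fun p : ℝ × ℝ => (Ioc (g₁ p.1) (g₂ p.1)).indicator (fun x => φ (p.1, x)) p.2 := by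
    intro g₁ g₂ φ h₁ h₂ hφ
    have h3 : MeasurableSet {p : ℝ × ℝ | g₁ p.1 < p.2} :=
      measurableSet_lt (by fun_prop) (by fun_prop)
    have h4 : MeasurableSet {p : ℝ × ℝ | p.2 ≤ g₂ p.1} :=
      measurableSet_le (by fun_prop) (by fun_prop)
    exact measurable_indicator_of_prod (s := fun t => Ioc (g₁ t) (g₂ t)) (h3.inter h4) hφ
  have hreg : Measurable fun p : ℝ × ℝ => regComponent f T p.1 p.2 := by
    unfold regComponent
    simp_rw [h.real_Iic]
    have hset : MeasurableSet {p : ℝ × ℝ | p.2 ≤ T.c 0 p.1} :=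
      measurableSet_le (by fun_prop) (by fun_prop)
    refine Measurable.div ?_ (by fun_prop)
    exact measurable_indicator_of_prod (s := fun t => Iic (T.c 0 t)) hset (hf.comp measurable_snd)
  have hbig : Measurable fun p : ℝ × ℝ => bigComponent f T p.1 p.2 := by
    unfold bigComponent
    have hset : MeasurableSet {p : ℝ × ℝ | T.c T.k p.1 < p.2} :=
      measurableSet_lt (by fun_prop) (by fun_prop)
    refine Measurable.div ?_ (hF.comp ((hc T.k).comp measurable_fst))
    exact measurable_indicator_of_prod (s := fun t => Ioi (T.c T.k t)) hset (hf.comp measurable_snd)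
  have hmid : ∀ j, Measurable fun p : ℝ × ℝ => midComponent f T j p.1 p.2 := by
    intro j
    unfold midComponent
    by_cases hj : j < T.k
    · simp only [if_pos hj]
      exact (hind (hc _) (hc _) (hf.comp measurable_snd)).div
        ((measurable_real_Ioc h (hc _) (hc _)).comp measurable_fst)
    · simp only [if_neg hj]
      exact (hind (φ := fun p => f (p.1 - p.2)) (hc _) (hc _) (by fun_prop)).div
        ((measurable_real_Ioc h (measurable_id.sub (hc _)) (measurable_id.sub (hc _))).comp
          measurable_fst)
  have hsub : Measurable fun p : ℝ × ℝ => (b - p.1, p.2) := by fun_prop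
  have hif : MeasurableSet {p : ℝ × ℝ | T.η < b - p.1} :=
    measurableSet_lt (by fun_prop) (by fun_prop)
  refine Measurable.ite (p := fun p : ℝ × ℝ => T.η < b - p.1) hif ?_ (by fun_prop)
  refine Measurable.add (Measurable.add ?_ ?_) (Finset.measurable_sum _ fun j _ => ?_)
  · exact Measurable.mul (by fun_prop) (hreg.comp hsub)
  · exact Measurable.mul (by fun_prop) (hbig.comp hsub)
  · exact Measurable.mul ((hm j).comp (by fun_prop)) ((hmid j).comp hsub)

theorem isTransitionDensity_sampDensity (h : IsNegDriftDensity f) (hc : ∀ j, Measurable (T.c j))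
    (hr : Measurable T.pReg) (hb : Measurable T.pBig) (hm : ∀ j, Measurable (T.pMid j))
    (hT : ∀ t, T.η < t → T.NondegenerateAt f t) (b : ℝ) :
    IsTransitionDensity (sampDensity f T b) := by
  have hmeas := measurable_sampDensity h hc hr hb hm b
  refine ⟨hmeas, fun s x => ?_, fun s => ?_⟩
  · by_cases hs : T.η < b - s
    · exact (hT _ hs).sampDensity_nonneg h hs x
    · rw [sampDensity, if_neg hs]
      exact h.nonneg x
  · by_cases hs : T.η < b - s
    · have hN := hT _ hs
      have hf := h.measurable
      have hreg : ∫⁻ x, ENNReal.ofReal (regComponent f T (b - s) x) = 1 :=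
        lintegral_indicator_div_eq_one h measurableSet_Iic hN.reg_mass
      have hbig : ∫⁻ x, ENNReal.ofReal (bigComponent f T (b - s) x) = 1 :=
        lintegral_indicator_div_eq_one h measurableSet_Ioi (h.tail_pos _)
      have hmid : ∀ j ∈ Finset.Icc 1 T.k,
          ∫⁻ x, ENNReal.ofReal (midComponent f T j (b - s) x) = 1 := fun j hj =>
        lintegral_midComponent h (hN.mid_mass j hj) fun hjk => by
          obtain rfl : j = T.k := le_antisymm (Finset.mem_Icc.1 hj).2 (not_lt.1 hjk)
          exact hN.last_mass (Finset.mem_Icc.1 hj).1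
      have hregm : Measurable (regComponent f T (b - s)) :=
        (hf.indicator measurableSet_Iic).div_const _
      have hbigm : Measurable (bigComponent f T (b - s)) :=
        (hf.indicator measurableSet_Ioi).div_const _
      have hmidm : ∀ j, Measurable (midComponent f T j (b - s)) := by
        intro j
        unfold midComponent
        split_ifs
        · exact (hf.indicator measurableSet_Ioc).div_const _
        · exact (Measurable.indicator (by fun_prop) measurableSet_Ioc).div_const _
      have hterm : ∀ x, ENNReal.ofReal (sampDensity f T b s x) =
          ENNReal.ofReal (T.pReg (b - s)) * ENNReal.ofReal (regComponent f T (b - s) x) +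
          ENNReal.ofReal (T.pBig (b - s)) * ENNReal.ofReal (bigComponent f T (b - s) x) +
          ∑ j ∈ Finset.Icc 1 T.k,
            ENNReal.ofReal (T.pMid j (b - s)) * ENNReal.ofReal (midComponent f T j (b - s) x) := by
        intro x
        have h1 := mul_nonneg hN.pReg_pos.le (regComponent_nonneg (T := T) h.nonneg (b - s) x)
        have h2 := mul_nonneg hN.pBig_pos.le (bigComponent_nonneg (T := T) h.nonneg (b - s) x)
        have h3 : ∀ j ∈ Finset.Icc 1 T.k,
            0 ≤ T.pMid j (b - s) * midComponent f T j (b - s) x := fun j hj =>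
          mul_nonneg (hN.pMid_pos j hj).le (midComponent_nonneg h.nonneg j _ _)
        rw [sampDensity, if_pos hs, ENNReal.ofReal_add (add_nonneg h1 h2) (Finset.sum_nonneg h3),
          ENNReal.ofReal_add h1 h2, ENNReal.ofReal_mul hN.pReg_pos.le,
          ENNReal.ofReal_mul hN.pBig_pos.le, ENNReal.ofReal_sum_of_nonneg h3]
        congr 1
        exact Finset.sum_congr rfl fun j hj => ENNReal.ofReal_mul (hN.pMid_pos j hj).le
      simp_rw [hterm]
      rw [lintegral_add_left (by fun_prop), lintegral_add_left (by fun_prop),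
        lintegral_const_mul _ (by fun_prop), lintegral_const_mul _ (by fun_prop),
        lintegral_finsetSum _ (fun j _ => by have := hmidm j; fun_prop), hreg, hbig, mul_one,
        mul_one, Finset.sum_congr rfl (fun j hj => by
          rw [lintegral_const_mul _ (by have := hmidm j; fun_prop), hmid j hj, mul_one]),
        ← ENNReal.ofReal_sum_of_nonneg fun j hj => (hN.pMid_pos j hj).le,
        ← ENNReal.ofReal_add hN.pReg_pos.le hN.pBig_pos.le, ← ENNReal.ofReal_add
          (add_nonneg hN.pReg_pos.le hN.pBig_pos.le)
          (Finset.sum_nonneg fun j hj => (hN.pMid_pos j hj).le), hN.sum_eq_one, ENNReal.ofReal_one]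
    · simp only [sampDensity, if_neg hs]
      exact h.lintegral_density

/-- The sampling density is positive wherever `f` is, so no mass of `f` is lost to a division by
zero. This is what makes the estimator unbiased. -/
theorem localRatio_mul_sampDensity (h : IsNegDriftDensity f)
    (hT : ∀ t, T.η < t → T.NondegenerateAt f t) (b s x : ℝ) :
    localRatio f (sampDensity f T b) s x * ENNReal.ofReal (sampDensity f T b s x) =
      ENNReal.ofReal (f x) := by
  rcases (h.nonneg x).eq_or_lt with hx | hx
  · simp [localRatio, ← hx]
  · have hq : 0 < sampDensity f T b s x := by
      by_cases hs : T.η < b - s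
      · exact (hT _ hs).sampDensity_pos h hs hx
      · rwa [sampDensity, if_neg hs]
    exact ENNReal.div_mul_cancel (by simpa using hq) ENNReal.ofReal_ne_top

end

section

/-! ### The Lyapunov function -/

/-- The Lyapunov function `min (1, G(t) / G(η))²`. -/
def lyapunov (f : ℝ → ℝ) (η t : ℝ) : ℝ := min 1 (integratedTail f t / integratedTail f η) ^ 2

theorem lyapunov_nonneg (f : ℝ → ℝ) (η t : ℝ) : 0 ≤ lyapunov f η t := sq_nonneg _

variable {f : ℝ → ℝ} {T : Tuning}

theorem Tuning.cut_le_cut {t : ℝ} (hcut : ∀ j < T.k, T.c j t < T.c (j + 1) t) {i j : ℕ}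
    (hij : i ≤ j) (hj : j ≤ T.k) : T.c i t ≤ T.c j t := by
  induction j, hij using Nat.le_induction with
  | base => exact le_rfl
  | succ j _ ih => exact (ih (by omega)).trans (hcut j (by omega)).le

namespace IsNegDriftDensity

variable (h : IsNegDriftDensity f)
include h

theorem measurable_lyapunov (η : ℝ) : Measurable (lyapunov f η) := by
  have := h.integratedTail_antitone.measurable
  unfold lyapunov
  fun_prop

theorem min_integratedTail_nonneg (η t : ℝ) :
    0 ≤ min 1 (integratedTail f t / integratedTail f η) :=
  le_min zero_le_one (div_nonneg (h.integratedTail_pos _).le (h.integratedTail_pos _).le)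

theorem lyapunov_le_one (η t : ℝ) : lyapunov f η t ≤ 1 :=
  pow_le_one₀ (h.min_integratedTail_nonneg η t) (min_le_left _ _)

theorem lyapunov_le (η t : ℝ) :
    lyapunov f η t ≤ integratedTail f t ^ 2 / integratedTail f η ^ 2 := by
  rw [← div_pow]
  exact pow_le_pow_left₀ (h.min_integratedTail_nonneg η t) (min_le_right _ _) 2

theorem lyapunov_of_le {η t : ℝ} (ht : t ≤ η) : lyapunov f η t = 1 := by
  rw [lyapunov, min_eq_left, one_pow]
  rw [one_le_div (h.integratedTail_pos η)]
  exact h.integratedTail_antitone ht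

theorem lyapunov_of_ge {η t : ℝ} (ht : η ≤ t) :
    lyapunov f η t = integratedTail f t ^ 2 / integratedTail f η ^ 2 := by
  rw [lyapunov, min_eq_right, div_pow]
  rw [div_le_one (h.integratedTail_pos η)]
  exact h.integratedTail_antitone ht

/-- On each support the mixture is at least weight times component. This gives `r ≤ 1/p_*` for
regular increments and, for big jumps, `r ≤ F(c_k)/p_**`, where `W ≤ 1` is enough. For the
interpolating components `he` bounds the integrand by a constant over `t`. -/
theorem lintegral_localRatio_mul_lyapunov_le {b s pm e R : ℝ}
    (hT : T.NondegenerateAt f (b - s)) (hη : T.η < b - s) (hη0 : 0 < T.η)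
    (hcut : ∀ j < T.k, T.c j (b - s) < T.c (j + 1) (b - s))
    (hc0 : 0 ≤ T.c 0 (b - s)) (hck : 1 ≤ T.k → T.c T.k (b - s) ≤ b - s)
    (hreg : ∫⁻ x in Iic (T.c 0 (b - s)),
      ENNReal.ofReal (integratedTail f (b - s - x) ^ 2 * f x) ≤ ENNReal.ofReal R)
    (he0 : 0 ≤ e) (hpm0 : 0 < pm) (hpm : ∀ j ∈ Finset.Icc 1 T.k, T.pMid j (b - s) = pm)
    (he : ∀ j ∈ Finset.Icc 1 T.k, ∀ x ∈ Ioc (T.c (j - 1) (b - s)) (T.c j (b - s)),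
      (b - s) * f x ^ 2 * integratedTail f (b - s - x) ^ 2 ≤
        e * tailProb f (b - s) ^ 2 * midComponent f T j (b - s) x) :
    ∫⁻ x, localRatio f (sampDensity f T b) s x * ENNReal.ofReal (lyapunov f T.η (b - s - x)) *
        ENNReal.ofReal (f x) ≤
      ENNReal.ofReal (1 / (T.pReg (b - s) * integratedTail f T.η ^ 2) * R) +
      ENNReal.ofReal (tailProb f (T.c T.k (b - s)) ^ 2 / T.pBig (b - s)) +
      ENNReal.ofReal (e * tailProb f (b - s) ^ 2 / (pm * integratedTail f T.η ^ 2)) := by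
  have hP := h.isProb
  have hf := h.measurable
  have hGm : Measurable (integratedTail f) := h.integratedTail_antitone.measurable
  set t := b - s with ht
  have ht0 : 0 < t := hη0.trans hη
  set g := integratedTail f T.η with hg
  have hg0 : 0 < g := h.integratedTail_pos _
  have hr0 := hT.pReg_pos
  have hb0 := hT.pBig_pos
  have hF0 := h.tail_pos t
  set A : ℝ → ℝ≥0∞ := (Iic (T.c 0 t)).indicator fun x =>
    ENNReal.ofReal (1 / (T.pReg t * g ^ 2)) *
      ENNReal.ofReal (integratedTail f (t - x) ^ 2 * f x) with hA
  set B : ℝ → ℝ≥0∞ := (Ioi (T.c T.k t)).indicator fun x =>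
    ENNReal.ofReal (tailProb f (T.c T.k t) / T.pBig t) * ENNReal.ofReal (f x) with hB
  -- All interpolating supports lie in `(0, t]`, whose length cancels the factor `t` put into `he`.
  set C : ℝ → ℝ≥0∞ := (Ioc 0 t).indicator fun _ =>
    ENNReal.ofReal (e * tailProb f t ^ 2 / (t * (pm * g ^ 2))) with hC
  have hpt : ∀ x, localRatio f (sampDensity f T b) s x *
      ENNReal.ofReal (lyapunov f T.η (t - x)) * ENNReal.ofReal (f x) ≤ A x + B x + C x := by
    intro x
    rcases (h.nonneg x).eq_or_lt with hx | hx
    · simp [localRatio, ← hx]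
    have hq := hT.sampDensity_pos h hη hx
    have hw0 := lyapunov_nonneg f T.η (t - x)
    have hw1 := h.lyapunov_le_one T.η (t - x)
    have hw := h.lyapunov_le T.η (t - x)
    rw [localRatio, ← ENNReal.ofReal_div_of_pos hq, ← ENNReal.ofReal_mul (by positivity),
      ← ENNReal.ofReal_mul (by positivity)]
    rcases T.mem_or_mem_or_mem t x with h0 | hk | ⟨j, hj, hm⟩
    · refine le_trans ?_ (le_self_add.trans le_self_add)
      rw [hA, indicator_of_mem (by exact h0), ← ENNReal.ofReal_mul (by positivity)]
      refine ENNReal.ofReal_le_ofReal ?_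
      have h1 := hT.mul_regComponent_le h hη x
      rw [← ht, regComponent, indicator_of_mem (by exact h0)] at h1
      have h2 : f x ≤ f x / (incrementLaw f).real (Iic (T.c 0 t)) :=
        (le_div_iff₀ hT.reg_mass).2 (mul_le_of_le_one_right hx.le measureReal_le_one)
      have h3 : f x / sampDensity f T b s x ≤ 1 / T.pReg t := by
        rw [div_le_div_iff₀ hq hr0]
        nlinarith
      calc f x / sampDensity f T b s x * lyapunov f T.η (t - x) * f x
          ≤ 1 / T.pReg t * (integratedTail f (t - x) ^ 2 / g ^ 2) * f x := by gcongr
        _ = _ := by field_simp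
    · refine le_trans ?_ (le_add_self.trans le_self_add)
      rw [hB, indicator_of_mem (by exact hk), ← ENNReal.ofReal_mul
        (div_nonneg (h.tail_pos _).le hb0.le)]
      refine ENNReal.ofReal_le_ofReal ?_
      have h1 := hT.mul_bigComponent_le h hη x
      rw [← ht, bigComponent, indicator_of_mem (by exact hk)] at h1
      have hFk : 0 < tailProb f (T.c T.k t) := h.tail_pos _
      change T.pBig t * (f x / tailProb f (T.c T.k t)) ≤ _ at h1
      have h3 : f x / sampDensity f T b s x ≤ tailProb f (T.c T.k t) / T.pBig t := by
        rw [div_le_div_iff₀ hq hb0]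
        rw [← mul_div_assoc, div_le_iff₀ hFk] at h1
        linarith
      calc f x / sampDensity f T b s x * lyapunov f T.η (t - x) * f x
          ≤ tailProb f (T.c T.k t) / T.pBig t * 1 * f x := by gcongr
        _ = _ := by ring
    · refine le_trans ?_ le_add_self
      obtain ⟨hj1, hjk⟩ := Finset.mem_Icc.1 hj
      have hxt : x ∈ Ioc 0 t := by
        refine ⟨?_, ?_⟩
        · exact (hc0.trans (Tuning.cut_le_cut hcut (Nat.zero_le _) (by omega))).trans_lt hm.1
        · exact hm.2.trans ((Tuning.cut_le_cut hcut hjk le_rfl).trans (hck (by omega)))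
      rw [hC, indicator_of_mem hxt]
      refine ENNReal.ofReal_le_ofReal ?_
      have hmid := hT.mid_pos j hj x hm hx
      have h1 := hT.mul_midComponent_le h hη x hj
      rw [← ht, hpm j hj] at h1
      calc f x / sampDensity f T b s x * lyapunov f T.η (t - x) * f x
          ≤ f x / (pm * midComponent f T j t x) * (integratedTail f (t - x) ^ 2 / g ^ 2) * f x := by
            gcongr
        _ = t * f x ^ 2 * integratedTail f (t - x) ^ 2 /
              (t * (pm * g ^ 2) * midComponent f T j t x) := by
            field_simp
        _ ≤ e * tailProb f t ^ 2 * midComponent f T j t x /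
              (t * (pm * g ^ 2) * midComponent f T j t x) := by
            exact div_le_div_of_nonneg_right (he j hj x hm) (by positivity)
        _ = _ := by field_simp
  refine (lintegral_mono hpt).trans ?_
  have hAm : Measurable A := Measurable.indicator (by fun_prop) measurableSet_Iic
  have hBm : Measurable B := Measurable.indicator (by fun_prop) measurableSet_Ioi
  rw [lintegral_add_left (f := fun x => A x + B x) (hAm.add hBm), lintegral_add_left hAm]
  refine add_le_add (add_le_add ?_ ?_) ?_
  · rw [hA, lintegral_indicator measurableSet_Iic, lintegral_const_mul _ (by fun_prop),
      ENNReal.ofReal_mul (by positivity)]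
    gcongr
  · rw [hB, lintegral_indicator measurableSet_Ioi, lintegral_const_mul _ (by fun_prop),
      h.setLIntegral_density measurableSet_Ioi, ← ENNReal.ofReal_mul
        (div_nonneg (h.tail_pos _).le hb0.le)]
    refine ENNReal.ofReal_le_ofReal (le_of_eq ?_)
    rw [← tailProb]
    ring
  · rw [hC, lintegral_indicator_const measurableSet_Ioc, Real.volume_Ioc,
      ← ENNReal.ofReal_mul (by positivity)]
    refine ENNReal.ofReal_le_ofReal (le_of_eq ?_)
    field_simp
    ring

end IsNegDriftDensity

end

section

/-! ### A criterion for strong efficiency -/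

/-- Conditions on the cut-off points that make the sampler with the selected weights strongly
efficient. -/
structure CutConditions (f : ℝ → ℝ) (k : ℕ) (c : ℕ → ℝ → ℝ) : Prop where
  long : LongTailed f
  measurable : ∀ j, Measurable (c j)
  tendsto : Tendsto (c 0) atTop atTop
  bound : ∃ C : ℝ, 0 ≤ C ∧ ∀ᶠ t in atTop, tailProb f (t - c 0 t) ≤ C * tailProb f t ∧
    integratedTail f (t - c 0 t) ≤ C * integratedTail f t ∧ tailProb f (c k t) ≤ C * tailProb f t
  cut_lt : ∀ᶠ t in atTop, ∀ j < k, c j t < c (j + 1) t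
  last_le : 1 ≤ k → ∀ᶠ t in atTop, c k t ≤ t
  mid_mass : ∀ᶠ t in atTop, ∀ j ∈ Finset.Icc 1 k, j < k →
    0 < (incrementLaw f).real (Ioc (c (j - 1) t) (c j t))
  last_mass : 1 ≤ k → ∀ᶠ t in atTop, 0 < (incrementLaw f).real (Ioc (t - c k t) (t - c (k - 1) t))
  mid_bound : ∃ e : ℝ → ℝ, Tendsto e atTop (𝓝 0) ∧ ∀ᶠ t in atTop,
    ∀ j ∈ Finset.Icc 1 k, ∀ x ∈ Ioc (c (j - 1) t) (c j t),
      t * f x ^ 2 * integratedTail f (t - x) ^ 2 ≤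
        e t * tailProb f t ^ 2 * midComponent f (withSelectedWeights f 0 k 0 c) j t x

variable {f : ℝ → ℝ}

theorem thetaOf_pos (h : IsNegDriftDensity f) {δ : ℝ} (hδ : δ ∈ Ioo (0 : ℝ) (1 / 4)) :
    0 < thetaOf f δ := by
  have h1 := h.mean_neg
  have h2 := hδ.1
  have h3 := hδ.2
  exact div_pos (mul_pos (by linarith) (by linarith)) (by positivity)

/-- The strict surplus of the negative drift `2μ` over the cost `2(1+δ)θ` of dividing by `p_*`; it
finances all other terms. -/
theorem thetaOf_gap (h : IsNegDriftDensity f) {δ : ℝ} (hδ : δ ∈ Ioo (0 : ℝ) (1 / 4)) :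
    0 < -(2 * (1 + δ) * thetaOf f δ) - 2 * meanOf f := by
  have h1 := h.mean_neg
  have h2 := hδ.1
  have h3 := hδ.2
  have h4 : (1 + δ) * thetaOf f δ = -meanOf f * ((1 - δ) / (1 + δ) ^ 4) := by
    rw [thetaOf]
    field_simp
  have h5 : (1 - δ) / (1 + δ) ^ 4 < 1 := by
    rw [div_lt_one (by positivity)]
    have : 1 < (1 + δ) ^ 4 := one_lt_pow₀ (by linarith) (by norm_num)
    linarith
  nlinarith

theorem bigWeight_pos (h : IsNegDriftDensity f) {δ : ℝ} (hδ : δ ∈ Ioo (0 : ℝ) (1 / 4)) (t : ℝ) :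
    0 < bigWeight f δ t := by
  have h1 := thetaOf_pos h hδ
  have h2 := h.tail_pos t
  have h3 := h.integratedTail_pos t
  have h4 := hδ.1
  exact lt_min (by positivity) (by positivity)

theorem bigWeight_le (δ t : ℝ) : bigWeight f δ t ≤ δ ^ 2 := min_le_right _ _

theorem measurable_bigWeight (h : IsNegDriftDensity f) (δ : ℝ) : Measurable (bigWeight f δ) := by
  have h1 := h.continuous_tailProb.measurable
  have h2 := h.integratedTail_antitone.measurable
  unfold bigWeight
  fun_prop

theorem nat_mul_div_succ_le {δ : ℝ} (hδ : 0 < δ) (k : ℕ) : k * (δ / (k + 1)) ≤ δ := by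
  rw [← mul_div_assoc, div_le_iff₀ (by positivity)]
  nlinarith

theorem selectedRegWeight_pos (h : IsNegDriftDensity f) {δ : ℝ} (hδ : δ ∈ Ioo (0 : ℝ) (1 / 4))
    (k : ℕ) (t : ℝ) : 0 < 1 - bigWeight f δ t - k * (δ / (k + 1) * bigWeight f δ t) := by
  have h1 := bigWeight_le (f := f) δ t
  have h2 := bigWeight_pos h hδ t
  have h3 := nat_mul_div_succ_le hδ.1 k
  have h4 := hδ.1
  have h5 := hδ.2
  have h6 : bigWeight f δ t ≤ 1 / 16 := by nlinarith
  have h7 : k * (δ / (k + 1)) * bigWeight f δ t ≤ δ * bigWeight f δ t := by gcongr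
  nlinarith

theorem admissible_withSelectedWeights (h : IsNegDriftDensity f) {δ : ℝ}
    (hδ : δ ∈ Ioo (0 : ℝ) (1 / 4)) {k : ℕ} {η : ℝ} {c : ℕ → ℝ → ℝ} (hη : 0 < η)
    (hcut : ∀ t, η < t → ∀ j < k, c j t < c (j + 1) t) :
    (withSelectedWeights f δ k η c).Admissible := by
  have hδ0 := hδ.1
  have hδ1 := hδ.2
  have hmid : ∀ t, 0 < δ / (k + 1) * bigWeight f δ t := fun t => by
    have := bigWeight_pos h hδ t
    positivity
  have hb1 : ∀ t, bigWeight f δ t < 1 := fun t =>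
    (bigWeight_le δ t).trans_lt (by nlinarith)
  refine ⟨hη, fun t _ => ⟨(selectedRegWeight_pos h hδ k t).le, ?_⟩,
    fun t _ => ⟨(bigWeight_pos h hδ t).le, hb1 t⟩, fun t _ j _ => ⟨(hmid t).le, ?_⟩, fun t _ => ?_,
    hcut⟩
  · have h1 := bigWeight_pos h hδ t
    have h2 : 0 ≤ k * (δ / (k + 1) * bigWeight f δ t) := mul_nonneg (by positivity) (hmid t).le
    change 1 - bigWeight f δ t - k * (δ / (k + 1) * bigWeight f δ t) < 1
    linarith
  · have h1 : δ / (k + 1) ≤ δ := div_le_self hδ0.le (by linarith [(Nat.cast_nonneg k : (0 : ℝ) ≤ k)])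
    change δ / (k + 1) * bigWeight f δ t < 1
    have h2 := bigWeight_pos h hδ t
    have h3 : 0 ≤ δ / ((k : ℝ) + 1) := by positivity
    nlinarith [hb1 t]
  · simp only [withSelectedWeights, Finset.sum_const, Nat.card_Icc, Nat.add_sub_cancel,
      nsmul_eq_mul]
    ring

theorem nondegenerateAt_withSelectedWeights (h : IsNegDriftDensity f) {δ : ℝ}
    (hδ : δ ∈ Ioo (0 : ℝ) (1 / 4)) {k : ℕ} {η e t : ℝ} {c : ℕ → ℝ → ℝ} (ht : 0 < t)
    (hreg : tailProb f (c 0 t) < 1)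
    (hmid : ∀ j ∈ Finset.Icc 1 k, j < k → 0 < (incrementLaw f).real (Ioc (c (j - 1) t) (c j t)))
    (hlast : 1 ≤ k → 0 < (incrementLaw f).real (Ioc (t - c k t) (t - c (k - 1) t)))
    (he : ∀ j ∈ Finset.Icc 1 k, ∀ x ∈ Ioc (c (j - 1) t) (c j t),
      t * f x ^ 2 * integratedTail f (t - x) ^ 2 ≤
        e * tailProb f t ^ 2 * midComponent f (withSelectedWeights f δ k η c) j t x) :
    (withSelectedWeights f δ k η c).NondegenerateAt f t := by
  have hδ0 := hδ.1
  have hb := bigWeight_pos h hδ t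
  refine ⟨?_, hmid, hlast, selectedRegWeight_pos h hδ k t, hb, fun j _ => ?_, ?_, ?_⟩
  · change 0 < (incrementLaw f).real (Iic (c 0 t))
    rw [h.real_Iic]
    linarith
  · change 0 < δ / (k + 1) * bigWeight f δ t
    positivity
  · simp only [withSelectedWeights, Finset.sum_const, Nat.card_Icc, Nat.add_sub_cancel,
      nsmul_eq_mul]
    ring
  -- Where `f x > 0` the left side of `he` is positive, so the component cannot vanish. For the
  -- reflected component, whose numerator is `f (t - x)`, this is not automatic.
  · intro j hj x hx hfx
    refine (midComponent_nonneg h.nonneg j t x).lt_of_ne fun h0 => ?_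
    have h1 := he j hj x hx
    rw [← h0, mul_zero] at h1
    have h2 := h.integratedTail_pos (t - x)
    have : 0 < t * f x ^ 2 * integratedTail f (t - x) ^ 2 := by positivity
    linarith

/-- In units of `G F / g²`: the regular term stays `γ/3` below `G²/g²`, because `p_* ≥ 1 - (1+δ) 2θ
F/G`, and the big-jump and interpolating terms cost at most `γ/6` each. The big-jump term is of
order `g²` in these units, hence small once `η` is large. -/
theorem lyapunov_budget {δ k θ γ m C e G F Fk g : ℝ} (hδ : 0 < δ) (hk : 0 ≤ k) (hθ : 0 < θ)
    (hγ : 0 < γ) (hG : 0 < G) (hF : 0 < F) (hFk : 0 ≤ Fk) (hg : 0 < g)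
    (hm : m + 2 * (1 + δ) * θ + γ / 3 ≤ 0) (hFC : Fk ≤ C * F)
    (hgC : C ^ 2 * g ^ 2 / (2 * θ) ≤ γ / 6) (hek : e * ((k + 1) / (2 * θ * δ)) ≤ γ / 6)
    (hkδ : k * (δ / (k + 1)) ≤ δ)
    (hr : 0 < 1 - 2 * θ * F / G - k * (δ / (k + 1) * (2 * θ * F / G))) :
    1 / ((1 - 2 * θ * F / G - k * (δ / (k + 1) * (2 * θ * F / G))) * g ^ 2) *
        (G ^ 2 + m * (G * F)) + Fk ^ 2 / (2 * θ * F / G) +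
        e * F ^ 2 / (δ / (k + 1) * (2 * θ * F / G) * g ^ 2) ≤ G ^ 2 / g ^ 2 := by
  set r := 1 - 2 * θ * F / G - k * (δ / (k + 1) * (2 * θ * F / G)) with hrdef
  have h1 : 1 / (r * g ^ 2) * (G ^ 2 + m * (G * F)) ≤ (G ^ 2 - γ / 3 * (G * F)) / g ^ 2 := by
    rw [one_div_mul_eq_div, div_le_div_iff₀ (by positivity) (by positivity)]
    have hr1 : r ≤ 1 := by
      have : 0 ≤ k * (δ / (k + 1) * (2 * θ * F / G)) := by positivity
      have : 0 ≤ 2 * θ * F / G := by positivity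
      linarith
    have hr2 : 1 - (1 + δ) * (2 * θ * F / G) ≤ r := by
      have : k * (δ / (k + 1)) * (2 * θ * F / G) ≤ δ * (2 * θ * F / G) := by gcongr
      linarith
    have hr3 : G ^ 2 - 2 * (1 + δ) * θ * (G * F) ≤ r * G ^ 2 := by
      have := mul_le_mul_of_nonneg_right hr2 (sq_nonneg G)
      have heq : (1 - (1 + δ) * (2 * θ * F / G)) * G ^ 2 =
          G ^ 2 - 2 * (1 + δ) * θ * (G * F) := by
        field_simp
      linarith
    have hGF : 0 < G * F := by positivity
    have h4 : G ^ 2 + m * (G * F) ≤ r * (G ^ 2 - γ / 3 * (G * F)) := by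
      have h5 : r * (γ / 3 * (G * F)) ≤ γ / 3 * (G * F) :=
        mul_le_of_le_one_left (by positivity) hr1
      nlinarith
    have := mul_le_mul_of_nonneg_right h4 (sq_nonneg g)
    linarith
  have h2 : Fk ^ 2 / (2 * θ * F / G) ≤ γ / 6 * (G * F) / g ^ 2 := by
    have h3 : Fk ^ 2 ≤ (C * F) ^ 2 := pow_le_pow_left₀ hFk hFC 2
    calc Fk ^ 2 / (2 * θ * F / G) ≤ (C * F) ^ 2 / (2 * θ * F / G) := by gcongr
      _ = C ^ 2 * g ^ 2 / (2 * θ) * (G * F) / g ^ 2 := by field_simp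
      _ ≤ γ / 6 * (G * F) / g ^ 2 := by gcongr
  have h3 : e * F ^ 2 / (δ / (k + 1) * (2 * θ * F / G) * g ^ 2) ≤ γ / 6 * (G * F) / g ^ 2 := by
    calc e * F ^ 2 / (δ / (k + 1) * (2 * θ * F / G) * g ^ 2)
        = e * ((k + 1) / (2 * θ * δ)) * (G * F) / g ^ 2 := by field_simp
      _ ≤ γ / 6 * (G * F) / g ^ 2 := by gcongr
  calc _ ≤ (G ^ 2 - γ / 3 * (G * F)) / g ^ 2 + γ / 6 * (G * F) / g ^ 2 +
        γ / 6 * (G * F) / g ^ 2 := add_le_add (add_le_add h1 h2) h3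
    _ = G ^ 2 / g ^ 2 := by ring

theorem exists_mul_le_min_integratedTail (h : IsNegDriftDensity f) (hL : LongTailed f) (η : ℝ)
    {M A : ℝ} (hA : 0 < A) :
    ∃ κ : ℝ, 0 < κ ∧ ∀ b, 0 < b → κ * min 1 (integratedTail f b / integratedTail f η) ≤
      min (1 / 4) (integratedTail f (b + M) / (2 * A)) := by
  have hlim := (h.tendsto_integratedTail_shift hL (-M)).eventually
    (lt_mem_nhds (show (1 / 2 : ℝ) < 1 by norm_num))
  obtain ⟨B, hB⟩ := eventually_atTop.1 hlim
  -- The value `1/2` serves `b ≥ B`, by long tails; the quotient serves `0 < b ≤ B`, by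
  -- monotonicity.
  set κ₁ := min (1 / 2) (integratedTail f (B + M) / integratedTail f 0) with hκ₁
  have hg := h.integratedTail_pos η
  have hκ₁0 : 0 < κ₁ :=
    lt_min (by norm_num) (div_pos (h.integratedTail_pos _) (h.integratedTail_pos _))
  have key : ∀ b, 0 < b → κ₁ * integratedTail f b ≤ integratedTail f (b + M) := by
    intro b hb
    have hb0 := h.integratedTail_pos b
    rcases le_total B b with hBb | hbB
    · have h1 := hB b hBb
      rw [sub_neg_eq_add, lt_div_iff₀ hb0] at h1
      have h2 : κ₁ ≤ 1 / 2 := min_le_left _ _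
      nlinarith
    · have h0 := h.integratedTail_pos 0
      have h1 : κ₁ ≤ integratedTail f (B + M) / integratedTail f 0 := min_le_right _ _
      have h2 : integratedTail f b ≤ integratedTail f 0 := h.integratedTail_antitone hb.le
      have h3 : integratedTail f (B + M) ≤ integratedTail f (b + M) :=
        h.integratedTail_antitone (by linarith)
      rw [le_div_iff₀ h0] at h1
      nlinarith
  refine ⟨min (1 / 4) (κ₁ * integratedTail f η / (2 * A)), lt_min (by norm_num) (by positivity),
    fun b hb => ?_⟩
  have hw := h.min_integratedTail_nonneg η b
  refine le_min ?_ ?_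
  · have h1 : min (1 / 4) (κ₁ * integratedTail f η / (2 * A)) ≤ 1 / 4 := min_le_left _ _
    have h2 : min 1 (integratedTail f b / integratedTail f η) ≤ 1 := min_le_left _ _
    nlinarith
  · calc _ ≤ κ₁ * integratedTail f η / (2 * A) * (integratedTail f b / integratedTail f η) :=
          mul_le_mul (min_le_right _ _) (min_le_right _ _) hw (by positivity)
      _ = κ₁ * integratedTail f b / (2 * A) := by field_simp
      _ ≤ _ := by
        have := key b hb
        gcongr

/-- With `w = min(1, G(b)/g)` the second moment is at most `w²`, while `u(b) ≥ κ w`; so `w` cancels.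
-/
theorem stronglyEfficient_of_lyapunov {Ω : Type*} [MeasurableSpace Ω] (P : Measure Ω)
    [IsProbabilityMeasure P] {X : ℕ → Ω → ℝ} (hX : ∀ n, Measurable (X n)) (hindep : iIndepFun X P)
    (h : IsNegDriftDensity f) (hlaw : ∀ n, Measure.map (X n) P = incrementLaw f)
    (hL : LongTailed f) {T : Tuning} (hadm : T.Admissible) (hc : ∀ j, Measurable (T.c j))
    (hr : Measurable T.pReg) (hb : Measurable T.pBig) (hm : ∀ j, Measurable (T.pMid j))
    (hT : ∀ t, T.η < t → T.NondegenerateAt f t)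
    (hlyap : ∀ b s, T.η < b - s →
      ∫⁻ x, localRatio f (sampDensity f T b) s x * ENNReal.ofReal (lyapunov f T.η (b - s - x)) *
        ENNReal.ofReal (f x) ≤ ENNReal.ofReal (lyapunov f T.η (b - s))) :
    StronglyEfficient P X f T := by
  have hq := isTransitionDensity_sampDensity h hc hr hb hm hT
  have hRW := measurable_randomWalk hX
  have hν := isWalk_map_randomWalk P hX hindep h.measurable hlaw
  have hratio := localRatio_mul_sampDensity h hT
  have hfirst : ∀ b, ∫⁻ S, estimator f (sampDensity f T b) b S ∂(walkLaw _ (hq b)) =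
      ruinProb P X b := fun b => by
    rw [(isWalk_walkLaw (hq b)).lintegral_estimator h.measurable (hq b).measurable hν (hratio b) b,
      Measure.map_apply hRW]
    · rfl
    · rw [setOf_crosses_eq_iUnion]
      exact MeasurableSet.iUnion (measurableSet_firstPassage b)
  have hsecond : ∀ b, ∫⁻ S, estimator f (sampDensity f T b) b S ^ 2 ∂(walkLaw _ (hq b)) =
      ∫⁻ S, estimator f (sampDensity f T b) b S ∂(P.map (randomWalk X)) := fun b =>
    (isWalk_walkLaw (hq b)).lintegral_estimator_sq h.measurable (hq b).measurable hν (hratio b) b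
  refine ⟨hadm, hq, fun b _ => ⟨hfirst b, ?_⟩, ?_⟩
  · rw [hsecond, lintegral_map (measurable_estimator h.measurable (hq b).measurable b) hRW]
  obtain ⟨M, A, hA, hu⟩ := exists_le_ruinProb P hX hindep h hlaw
  obtain ⟨κ, hκ, hκu⟩ := exists_mul_le_min_integratedTail h hL T.η hA
  -- The quotient is at most `1/κ²`; adding one makes the inequality strict.
  refine ⟨1 / κ ^ 2 + 1, by positivity, fun b hb0 => ?_⟩
  have hW : ∫⁻ S, estimator f (sampDensity f T b) b S ^ 2 ∂(walkLaw _ (hq b)) ≤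
      ENNReal.ofReal (lyapunov f T.η b) := by
    rw [hsecond]
    refine hν.lintegral_estimator_le h.measurable (hq b).measurable hb0
      (W := fun t => ENNReal.ofReal (lyapunov f T.η t)) ?_ ?_ ?_
    · exact ENNReal.measurable_ofReal.comp (h.measurable_lyapunov T.η)
    · intro t ht
      rw [h.lyapunov_of_le (ht.le.trans hadm.η_pos.le), ENNReal.ofReal_one]
    · intro s _
      by_cases hs : T.η < b - s
      · exact hlyap b s hs
      · rw [h.lyapunov_of_le (not_lt.1 hs), ENNReal.ofReal_one]
        refine le_trans ?_ h.lintegral_density.le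
        refine lintegral_mono fun x => ?_
        have h1 : localRatio f (sampDensity f T b) s x ≤ 1 := by
          rw [localRatio, sampDensity, if_neg hs]
          exact ENNReal.div_self_le_one
        have h2 : ENNReal.ofReal (lyapunov f T.η (b - s - x)) ≤ 1 :=
          ENNReal.ofReal_le_one.2 (h.lyapunov_le_one _ _)
        calc _ ≤ 1 * 1 * ENNReal.ofReal (f x) := by gcongr
          _ = _ := by simp
  set w := min 1 (integratedTail f b / integratedTail f T.η) with hw
  have hw0 : 0 < w := lt_min one_pos (div_pos (h.integratedTail_pos _) (h.integratedTail_pos _))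
  set U := (ruinProb P X b).toReal with hU
  have hκU : κ * w ≤ U := (hκu b hb0).trans (hu b hb0)
  have hU0 : 0 < U := lt_of_lt_of_le (by positivity) hκU
  have hUeq : ruinProb P X b = ENNReal.ofReal U := (ENNReal.ofReal_toReal (measure_ne_top _ _)).symm
  refine ⟨by rw [hUeq]; exact ENNReal.ofReal_pos.2 hU0, ?_⟩
  rw [hfirst, hUeq, ← ENNReal.ofReal_pow hU0.le]
  calc _ ≤ ENNReal.ofReal (lyapunov f T.η b) / ENNReal.ofReal (U ^ 2) := by gcongr
    _ = ENNReal.ofReal (w ^ 2 / U ^ 2) := by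
      rw [← ENNReal.ofReal_div_of_pos (by positivity)]
      rfl
    _ < _ := by
      rw [ENNReal.ofReal_lt_ofReal_iff (by positivity)]
      have : w ^ 2 / U ^ 2 ≤ 1 / κ ^ 2 := by
        rw [div_le_div_iff₀ (by positivity) (by positivity), one_mul, ← mul_pow, mul_comm w]
        exact pow_le_pow_left₀ (by positivity) hκU 2
      linarith

theorem CutConditions.exists_stronglyEfficient {Ω : Type*} [MeasurableSpace Ω] (P : Measure Ω)
    [IsProbabilityMeasure P] {X : ℕ → Ω → ℝ} (hX : ∀ n, Measurable (X n)) (hindep : iIndepFun X P)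
    (h : IsNegDriftDensity f) (hlaw : ∀ n, Measure.map (X n) P = incrementLaw f)
    {k : ℕ} {c : ℕ → ℝ → ℝ} (hc : CutConditions f k c) {δ : ℝ} (hδ : δ ∈ Ioo (0 : ℝ) (1 / 4)) :
    ∃ η₀ : ℝ, 0 < η₀ ∧ ∀ η, η₀ ≤ η → StronglyEfficient P X f (withSelectedWeights f δ k η c) := by
  have hδ0 := hδ.1
  set θ := thetaOf f δ with hθdef
  have hθ : 0 < θ := thetaOf_pos h hδ
  set γ := -(2 * (1 + δ) * θ) - 2 * meanOf f with hγdef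
  have hγ : 0 < γ := thetaOf_gap h hδ
  -- A third of the gap is spent on the convergence to `2μ`, so that `m + 2(1+δ)θ = -2γ/3`.
  set m := 2 * meanOf f + γ / 3 with hmdef
  obtain ⟨C, hC0, hC⟩ := hc.bound
  obtain ⟨e, he0, he⟩ := hc.mid_bound
  have hε := h.tendsto_tailProb_div_integratedTail hc.long
  -- The first condition makes `p_**` equal to the first entry of its minimum. The second keeps `G²
  -- + m G F` nonnegative, so that `ENNReal.ofReal` adds up. The third makes the interpolating error
  -- affordable.
  have hgood : ∀ᶠ t in atTop, 2 * θ * tailProb f t / integratedTail f t ≤ δ ^ 2 ∧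
      0 ≤ 1 + m * (tailProb f t / integratedTail f t) ∧
      |e t| * ((k + 1) / (2 * θ * δ)) ≤ γ / 6 ∧ tailProb f (c 0 t) < 1 ∧ 0 ≤ c 0 t ∧ 0 < t := by
    have h1 : Tendsto (fun t => 2 * θ * tailProb f t / integratedTail f t) atTop (𝓝 0) := by
      have := hε.const_mul (2 * θ)
      rw [mul_zero] at this
      exact this.congr fun t => by ring
    have h2 : Tendsto (fun t => 1 + m * (tailProb f t / integratedTail f t)) atTop (𝓝 1) := by
      have := (hε.const_mul m).const_add 1
      rwa [mul_zero, add_zero] at this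
    have h3 : Tendsto (fun t => |e t| * ((k + 1) / (2 * θ * δ))) atTop (𝓝 0) := by
      have := he0.abs.mul_const ((k + 1) / (2 * θ * δ))
      rwa [abs_zero, zero_mul] at this
    have h4 := h.tendsto_tailProb_atTop.comp hc.tendsto
    filter_upwards [h1.eventually (gt_mem_nhds (show (0 : ℝ) < δ ^ 2 by positivity)),
      h2.eventually (lt_mem_nhds one_pos),
      h3.eventually (gt_mem_nhds (show (0 : ℝ) < γ / 6 by positivity)),
      h4.eventually (gt_mem_nhds one_pos), hc.tendsto.eventually_ge_atTop 0,
      eventually_gt_atTop 0] with t a1 a2 a3 a4 a5 a6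
    exact ⟨a1.le, a2.le, a3.le, a4, a5, a6⟩
  have hreg := h.setLIntegral_regular_le hc.long hc.tendsto (hC.mono fun t ht => ht.1)
    (hC.mono fun t ht => ht.2.1) (m := m) (by linarith)
  have hη : ∀ᶠ η in atTop, C ^ 2 * integratedTail f η ^ 2 / (2 * θ) ≤ γ / 6 := by
    have := ((h.tendsto_integratedTail.pow 2).const_mul (C ^ 2)).div_const (2 * θ)
    simp only [ne_eq, OfNat.ofNat_ne_zero, not_false_eq_true, zero_pow, mul_zero, zero_div] at this
    filter_upwards [this.eventually (gt_mem_nhds (show (0 : ℝ) < γ / 6 by positivity))] with t ht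
    exact ht.le
  obtain ⟨η₁, hη₁⟩ := eventually_atTop.1 (hgood.and (hreg.and (hη.and (hC.and (hc.cut_lt.and
    ((eventually_imp_distrib_left.2 hc.last_le).and (hc.mid_mass.and
    ((eventually_imp_distrib_left.2 hc.last_mass).and he))))))))
  refine ⟨max η₁ 1, by positivity, fun η hηη => ?_⟩
  have hηpos : 0 < η := lt_of_lt_of_le (by positivity) hηη
  have hη1 : η₁ ≤ η := (le_max_left _ _).trans hηη
  obtain ⟨-, -, hCη, -⟩ := hη₁ η hη1
  have hbw := measurable_bigWeight h δ
  have hN : ∀ t, η < t → (withSelectedWeights f δ k η c).NondegenerateAt f t := by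
    intro t ht
    obtain ⟨⟨-, -, -, h4, -, h6⟩, -, -, -, -, -, h7, h8, h9⟩ := hη₁ t (hη1.trans ht.le)
    exact nondegenerateAt_withSelectedWeights h hδ h6 h4 h7 h8 (e := e t) h9
  refine stronglyEfficient_of_lyapunov P hX hindep h hlaw hc.long
    (admissible_withSelectedWeights h hδ hηpos fun t ht => ?_) hc.measurable ?_ hbw ?_ hN ?_
  · obtain ⟨-, -, -, -, h5, -⟩ := hη₁ t (hη1.trans ht.le)
    exact h5
  · exact (measurable_const.sub hbw).sub (measurable_const.mul (measurable_const.mul hbw))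
  · exact fun _ => measurable_const.mul hbw
  · intro b s hs
    have hs : η < b - s := hs
    obtain ⟨⟨h1, h2, h3, -, h5, h6⟩, hR, -, ⟨-, -, hFk⟩, hcut, hlast, -, -, h9⟩ :=
      hη₁ (b - s) (hη1.trans hs.le)
    have hF := h.tail_pos (b - s)
    have hG := h.integratedTail_pos (b - s)
    have hg := h.integratedTail_pos η
    have hbig : bigWeight f δ (b - s) =
        2 * θ * tailProb f (b - s) / integratedTail f (b - s) := min_eq_left h1
    have hpm : 0 < δ / (k + 1) * bigWeight f δ (b - s) := by
      have := bigWeight_pos h hδ (b - s)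
      positivity
    have hrp := selectedRegWeight_pos h hδ k (b - s)
    refine (h.lintegral_localRatio_mul_lyapunov_le (hN _ hs) hs hηpos hcut h5 hlast hR
      (e := |e (b - s)|) (abs_nonneg _) hpm (fun j _ => rfl) fun j hj x hx => ?_).trans ?_
    · refine (h9 j hj x hx).trans ?_
      have := midComponent_nonneg (T := withSelectedWeights f 0 k 0 c) h.nonneg j (b - s) x
      -- An interpolating component depends on `k` and the cut-offs only, so the dummy weights and
      -- `η` in `CutConditions` do not matter.
      change e (b - s) * tailProb f (b - s) ^ 2 *
        midComponent f (withSelectedWeights f 0 k 0 c) j (b - s) x ≤ |e (b - s)| *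
        tailProb f (b - s) ^ 2 * midComponent f (withSelectedWeights f 0 k 0 c) j (b - s) x
      gcongr
      exact le_abs_self _
    · change ENNReal.ofReal (1 / ((1 - bigWeight f δ (b - s) -
        k * (δ / (k + 1) * bigWeight f δ (b - s))) * integratedTail f η ^ 2) * _) +
        ENNReal.ofReal (tailProb f (c k (b - s)) ^ 2 / bigWeight f δ (b - s)) +
        ENNReal.ofReal (_ / (_ * integratedTail f η ^ 2)) ≤
        ENNReal.ofReal (lyapunov f η (b - s))
      have hpos : 0 ≤ integratedTail f (b - s) ^ 2 +
          m * (integratedTail f (b - s) * tailProb f (b - s)) := by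
        have heq : integratedTail f (b - s) ^ 2 +
            m * (integratedTail f (b - s) * tailProb f (b - s)) = integratedTail f (b - s) ^ 2 *
            (1 + m * (tailProb f (b - s) / integratedTail f (b - s))) := by
          field_simp
        rw [heq]
        positivity
      have hb0 := bigWeight_pos h hδ (b - s)
      rw [h.lyapunov_of_ge hs.le, ← ENNReal.ofReal_add (by positivity) (by positivity),
        ← ENNReal.ofReal_add (by positivity) (by positivity)]
      refine ENNReal.ofReal_le_ofReal ?_
      rw [hbig] at hrp ⊢
      exact lyapunov_budget hδ0 (Nat.cast_nonneg k) hθ hγ hG hF (h.tail_pos _).le hg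
        (by linarith) hFk hCη h3 (nat_mul_div_succ_le hδ0 k) hrp

end

section

/-! ### Regularly varying tails -/

theorem tailProb_antitone_of_isProb {f : ℝ → ℝ} (hP : IsProbabilityMeasure (incrementLaw f)) :
    Antitone (tailProb f) := fun _ _ hxy => measureReal_mono (Ioi_subset_Ioi hxy)

theorem tailProb_pos_of_eventually_ne_zero {f : ℝ → ℝ} (hP : IsProbabilityMeasure (incrementLaw f))
    (hne : ∀ᶠ x in atTop, tailProb f x ≠ 0) (x : ℝ) : 0 < tailProb f x := by
  obtain ⟨y, hy, hxy⟩ := (hne.and (eventually_ge_atTop x)).exists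
  exact (measureReal_nonneg.lt_of_ne hy.symm).trans_le (tailProb_antitone_of_isProb hP hxy)

theorem IsNegDriftDensity.eventually_pos_cumHazard_sub {f : ℝ → ℝ} (h : IsNegDriftDensity f)
    (a : ℝ) : ∀ᶠ t in atTop, 0 < cumHazard f t - a := by
  filter_upwards [h.tendsto_cumHazard_atTop.eventually_gt_atTop a] with t ht
  linarith

theorem IsNegDriftDensity.lt_cumHazardInv_sub_iff {f : ℝ → ℝ} (h : IsNegDriftDensity f)
    {x t a : ℝ} (ha : 0 < cumHazard f t - a) :
    x < cumHazardInv f (cumHazard f t - a) ↔ Real.exp a * tailProb f t < tailProb f x := by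
  rw [h.lt_cumHazardInv_iff ha, ← h.exp_neg_cumHazard t, ← h.exp_neg_cumHazard x, ← Real.exp_add,
    Real.exp_lt_exp]
  constructor <;> intro <;> linarith

/-- For `x < 0` the quotient is the reciprocal of the one for `-x`, taken at the point `t - x`. -/
theorem longTailed_of_nonneg {f : ℝ → ℝ} (hnonneg : ∀ x, 0 ≤ x →
    Tendsto (fun t => tailProb f (t - x) / tailProb f t) atTop (𝓝 1)) : LongTailed f := by
  intro x
  rcases le_total 0 x with hx | hx
  · exact hnonneg x hx
  · have h1 := ((hnonneg (-x) (by linarith)).inv₀ one_ne_zero).comp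
      (tendsto_atTop_add_const_right atTop (-x) tendsto_id)
    rw [inv_one] at h1
    refine h1.congr fun t => ?_
    simp [sub_eq_add_neg]

namespace AssumptionA

variable {f : ℝ → ℝ} {ι : ℝ} (hA : AssumptionA f ι)
include hA

theorem tailProb_pos (hP : IsProbabilityMeasure (incrementLaw f)) (x : ℝ) : 0 < tailProb f x := by
  obtain ⟨L, hL, hLf⟩ := hA.regular
  refine tailProb_pos_of_eventually_ne_zero hP ?_ x
  -- The ratio `L x / L x` is `0` when `L x = 0`, so the limit `1` excludes zeros of `L` far out.
  have h1 := hL 1 ⟨one_pos, le_rfl⟩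
  filter_upwards [h1.eventually (lt_mem_nhds one_pos), eventually_gt_atTop 0] with y hy hy0 h0
  rw [hLf y hy0, mul_eq_zero] at h0
  rcases h0 with h0 | h0
  · simp [h0] at hy
  · exact (Real.rpow_pos_of_pos hy0 _).ne' h0

theorem tendsto_tailProb_mul {ρ : ℝ} (hρ : ρ ∈ Ioc (0 : ℝ) 1) :
    Tendsto (fun t => tailProb f (t * ρ) / tailProb f t) atTop (𝓝 (ρ ^ (-ι))) := by
  obtain ⟨L, hL, hLf⟩ := hA.regular
  have h1 := (hL ρ hρ).mul_const (ρ ^ (-ι))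
  rw [one_mul] at h1
  refine h1.congr' ?_
  filter_upwards [eventually_gt_atTop 0] with t ht
  rw [hLf t ht, hLf (t * ρ) (mul_pos ht hρ.1), Real.mul_rpow ht.le hρ.1.le]
  have := (Real.rpow_pos_of_pos ht (-ι)).ne'
  field_simp

variable (h : IsNegDriftDensity f)
include h

theorem longTailed : LongTailed f := by
  have hι : 0 < ι := one_pos.trans hA.one_lt
  have hnonneg : ∀ x, 0 ≤ x → Tendsto (fun t => tailProb f (t - x) / tailProb f t) atTop (𝓝 1) := by
    intro x hx
    refine tendsto_order.2 ⟨fun a ha => Eventually.of_forall fun t => ?_, fun a ha => ?_⟩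
    · refine ha.trans_le ((one_le_div (h.tail_pos t)).2 (h.tailProb_antitone (by linarith)))
    -- Chosen so that `ρ ^ (-ι)` is the square root of `a`, which is below `a`; eventually `t - x ≥
    -- t ρ`.
    · set ρ := Real.exp (-(Real.log a / (2 * ι))) with hρdef
      have hlog : 0 < Real.log a := Real.log_pos ha
      have hρ1 : ρ < 1 := Real.exp_lt_one_iff.2 (neg_lt_zero.2 (by positivity))
      have hρ0 : 0 < ρ := Real.exp_pos _
      have hρι : ρ ^ (-ι) < a := by
        rw [hρdef, ← Real.exp_mul]
        have : -(Real.log a / (2 * ι)) * -ι = Real.log a / 2 := by field_simp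
        rw [this]
        calc Real.exp (Real.log a / 2) < Real.exp (Real.log a) := Real.exp_lt_exp.2 (by linarith)
          _ = a := Real.exp_log (by linarith)
      filter_upwards [(hA.tendsto_tailProb_mul ⟨hρ0, hρ1.le⟩).eventually (gt_mem_nhds hρι),
        eventually_ge_atTop (x / (1 - ρ))] with t ht htx
      refine lt_of_le_of_lt ?_ ht
      have := h.tail_pos t
      rw [div_le_iff₀ (by linarith)] at htx
      gcongr
      exact h.tailProb_antitone (by linarith)
  exact longTailed_of_nonneg hnonneg

theorem exists_mul_lt_cutA (a : ℝ) (ha : 0 < a) :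
    ∃ ρ ∈ Ioo (0 : ℝ) 1, ∀ᶠ t in atTop, t * ρ < cutA f a t := by
  have hι : 0 < ι := one_pos.trans hA.one_lt
  -- Here `ρ ^ (-ι) = exp (a + 1)` exceeds `exp a`, the ratio of the tails at the cut-off and at
  -- `t`; so `t ρ` is below the cut-off.
  set ρ := Real.exp (-((a + 1) / ι)) with hρ
  have hρ1 : ρ < 1 := Real.exp_lt_one_iff.2 (neg_lt_zero.2 (by positivity))
  have hρι : Real.exp a < ρ ^ (-ι) := by
    rw [hρ, ← Real.exp_mul]
    have : -((a + 1) / ι) * -ι = a + 1 := by field_simp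
    rw [this]
    exact Real.exp_lt_exp.2 (by linarith)
  refine ⟨ρ, ⟨Real.exp_pos _, hρ1⟩, ?_⟩
  filter_upwards [(hA.tendsto_tailProb_mul ⟨Real.exp_pos _, hρ1.le⟩).eventually (lt_mem_nhds hρι),
    h.eventually_pos_cumHazard_sub a] with t ht hta
  rw [cutA, h.lt_cumHazardInv_sub_iff hta]
  rwa [lt_div_iff₀ (h.tail_pos t)] at ht

theorem exists_cutA_le_mul (a : ℝ) (ha : 0 < a) :
    ∃ ρ ∈ Ioo (0 : ℝ) 1, ∀ᶠ t in atTop, cutA f a t ≤ t * ρ := by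
  have hι : 0 < ι := one_pos.trans hA.one_lt
  -- Now `ρ ^ (-ι) = exp (a / 2)` is less than `exp a`, so `t ρ` is beyond the cut-off.
  set ρ := Real.exp (-(a / (2 * ι))) with hρ
  have hρ1 : ρ < 1 := Real.exp_lt_one_iff.2 (neg_lt_zero.2 (by positivity))
  have hρι : ρ ^ (-ι) < Real.exp a := by
    rw [hρ, ← Real.exp_mul]
    have : -(a / (2 * ι)) * -ι = a / 2 := by field_simp
    rw [this]
    exact Real.exp_lt_exp.2 (by linarith)
  refine ⟨ρ, ⟨Real.exp_pos _, hρ1⟩, ?_⟩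
  filter_upwards [(hA.tendsto_tailProb_mul ⟨Real.exp_pos _, hρ1.le⟩).eventually (gt_mem_nhds hρι),
    h.eventually_pos_cumHazard_sub a] with t ht hta
  rw [← not_lt, cutA, h.lt_cumHazardInv_sub_iff hta, not_lt]
  rw [div_lt_iff₀ (h.tail_pos t)] at ht
  exact ht.le

theorem eventually_integratedTail_mul_le {ρ C : ℝ} (hρ : ρ ∈ Ioc (0 : ℝ) 1) (hC : ρ ^ (-ι) < C) :
    ∀ᶠ t in atTop, integratedTail f (t * ρ) ≤ C * integratedTail f t := by
  obtain ⟨t₀, ht₀⟩ := eventually_atTop.1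
    ((hA.tendsto_tailProb_mul hρ).eventually (gt_mem_nhds hC))
  have hρ0 := hρ.1
  have hC0 : 0 < C := (Real.rpow_pos_of_pos hρ0 _).trans hC
  filter_upwards [eventually_ge_atTop t₀] with t ht
  have h1 := integral_comp_mul_right_Ioi (tailProb f) t hρ0
  have h2 : integratedTail f (t * ρ) = ρ * ∫ x in Ioi t, tailProb f (x * ρ) := by
    rw [h1, integratedTail, smul_eq_mul, mul_inv_cancel_left₀ hρ0.ne']
  have h3 : ∫ x in Ioi t, tailProb f (x * ρ) ≤ ∫ x in Ioi t, C * tailProb f x := by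
    refine integral_mono_of_nonneg (ae_of_all _ fun x => (h.tail_pos _).le)
      ((h.integrableOn_tailProb t).const_mul C) ?_
    refine (ae_restrict_iff' measurableSet_Ioi).2 (ae_of_all _ fun x hx => ?_)
    have hx : t < x := hx
    have := ht₀ x (ht.trans hx.le)
    rw [div_lt_iff₀ (h.tail_pos x)] at this
    exact this.le
  rw [integral_const_mul, ← integratedTail] at h3
  have h4 := h.integratedTail_pos t
  have h5 : 0 ≤ ∫ x in Ioi t, tailProb f (x * ρ) :=
    integral_nonneg fun x => (h.tail_pos _).le
  rw [h2]
  calc ρ * ∫ x in Ioi t, tailProb f (x * ρ) ≤ 1 * ∫ x in Ioi t, tailProb f (x * ρ) :=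
        mul_le_mul_of_nonneg_right hρ.2 h5
    _ ≤ _ := by rwa [one_mul]

/-- The cut-off lies between two fixed proportions of `t`, so `t - c_0` is at least a fixed
proportion as well and regular variation compares `F` and `G` there with their values at `t`. With
`k = 0` the conditions on interpolating components are vacuous. -/
theorem cutConditions {a : ℝ} (ha : 0 < a) : CutConditions f 0 (fun _ t => cutA f a t) := by
  obtain ⟨ρ₁, hρ₁, hlow⟩ := hA.exists_mul_lt_cutA h a ha
  obtain ⟨ρ₂, hρ₂, hupp⟩ := hA.exists_cutA_le_mul h a ha
  have hr : 1 - ρ₂ ∈ Ioc (0 : ℝ) 1 := ⟨by linarith [hρ₂.2], by linarith [hρ₂.1]⟩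
  have hm : Measurable (cutA f a) :=
    h.measurable_cumHazardInv.comp (h.continuous_cumHazard.measurable.sub measurable_const)
  set C := max ((1 - ρ₂) ^ (-ι) + 1) (Real.exp a) with hC
  have hC1 : (1 - ρ₂) ^ (-ι) < C := lt_of_lt_of_le (by linarith) (le_max_left _ _)
  refine ⟨hA.longTailed h, fun _ => hm, ?_, ⟨C, ?_, ?_⟩, by simp, by simp, by simp, by simp,
    ⟨0, tendsto_const_nhds, by simp⟩⟩
  · exact tendsto_atTop_mono' _ (hlow.mono fun t ht => ht.le) (tendsto_id.atTop_mul_const hρ₁.1)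
  · exact (Real.exp_pos a).le.trans (le_max_right _ _)
  · filter_upwards [hupp, h.eventually_pos_cumHazard_sub a,
      (hA.tendsto_tailProb_mul hr).eventually (gt_mem_nhds hC1),
      hA.eventually_integratedTail_mul_le h hr hC1] with t ht hta hF hG
    have hle : t * (1 - ρ₂) ≤ t - cutA f a t := by linarith
    rw [div_lt_iff₀ (h.tail_pos t)] at hF
    refine ⟨(h.tailProb_antitone hle).trans hF.le, (h.integratedTail_antitone hle).trans hG, ?_⟩
    rw [cutA, h.tailProb_cumHazardInv_sub hta]
    have := h.tail_pos t
    gcongr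
    exact le_max_right _ _

/-- The point `t - c_0` is at most a proportion `1 - ρ < 1` of `t`, where the tail is eventually
strictly larger. The difference of the hazards serves as `a_*(t)`. -/
theorem eventually_cumHazard_sub_cutA_lt {a : ℝ} (ha : 0 < a) :
    ∀ᶠ t in atTop, cumHazard f (t - cutA f a t) < cumHazard f t := by
  have hι : 0 < ι := one_pos.trans hA.one_lt
  obtain ⟨ρ, hρ, hlow⟩ := hA.exists_mul_lt_cutA h a ha
  have hr : 1 - ρ ∈ Ioc (0 : ℝ) 1 := ⟨by linarith [hρ.2], by linarith [hρ.1]⟩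
  have hgt : 1 < (1 - ρ) ^ (-ι) :=
    Real.one_lt_rpow_of_pos_of_lt_one_of_neg hr.1 (by linarith [hρ.1]) (by linarith)
  filter_upwards [hlow, (hA.tendsto_tailProb_mul hr).eventually (lt_mem_nhds hgt)] with t ht hF
  rw [one_lt_div (h.tail_pos t)] at hF
  have h1 : tailProb f (t * (1 - ρ)) ≤ tailProb f (t - cutA f a t) :=
    h.tailProb_antitone (by linarith)
  exact neg_lt_neg (Real.log_lt_log (h.tail_pos t) (hF.trans_le h1))

end AssumptionA

end

section

/-! ### The cumulative hazard as an absolutely continuous function -/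

theorem AbsolutelyContinuousOnInterval.log {g : ℝ → ℝ} {s t m : ℝ}
    (hg : AbsolutelyContinuousOnInterval g s t) (hm : 0 < m) (hgm : ∀ x ∈ uIcc s t, m ≤ g x) :
    AbsolutelyContinuousOnInterval (fun x => Real.log (g x)) s t := by
  have hlip : ∀ u v, m ≤ u → m ≤ v → Real.log u - Real.log v ≤ m⁻¹ * |u - v| := by
    intro u v hu hv
    have hu0 := hm.trans_le hu
    have hv0 := hm.trans_le hv
    rw [← Real.log_div hu0.ne' hv0.ne']
    calc Real.log (u / v) ≤ u / v - 1 := Real.log_le_sub_one_of_pos (by positivity)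
      _ = (u - v) / v := by field_simp
      _ ≤ |u - v| / m := by gcongr; exact le_abs_self _
      _ = m⁻¹ * |u - v| := by ring
  rw [absolutelyContinuousOnInterval_iff] at hg ⊢
  intro ε hε
  obtain ⟨δ, hδ, hE⟩ := hg (m * ε) (by positivity)
  refine ⟨δ, hδ, fun E hEd hlt => ?_⟩
  have hsum := hE E hEd hlt
  calc ∑ i ∈ Finset.range E.1, dist (Real.log (g (E.2 i).1)) (Real.log (g (E.2 i).2))
      ≤ ∑ i ∈ Finset.range E.1, m⁻¹ * dist (g (E.2 i).1) (g (E.2 i).2) := by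
        refine Finset.sum_le_sum fun i hi => ?_
        obtain ⟨h1, h2⟩ := hEd.1 i hi
        rw [Real.dist_eq, Real.dist_eq, abs_le]
        constructor
        · have := hlip _ _ (hgm _ h2) (hgm _ h1)
          rw [abs_sub_comm] at this
          linarith
        · exact hlip _ _ (hgm _ h1) (hgm _ h2)
    _ = m⁻¹ * ∑ i ∈ Finset.range E.1, dist (g (E.2 i).1) (g (E.2 i).2) := by
        rw [Finset.mul_sum]
    _ < m⁻¹ * (m * ε) := by gcongr
    _ = ε := by field_simp

/-- The density is merely integrable, so `Λ' = λ` holds only almost everywhere; absolute continuity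
still lets differential inequalities be integrated. -/
theorem AbsolutelyContinuousOnInterval.le_of_hasDerivAt_nonneg {g g' : ℝ → ℝ} {s t : ℝ}
    (hg : AbsolutelyContinuousOnInterval g s t) (hst : s ≤ t)
    (hderiv : ∀ᵐ x, x ∈ Icc s t → HasDerivAt g (g' x) x) (hnonneg : ∀ x ∈ Icc s t, 0 ≤ g' x) :
    g s ≤ g t := by
  have h1 := hg.integral_deriv_eq_sub
  have h2 : 0 ≤ ∫ x in s..t, deriv g x := by
    rw [intervalIntegral.integral_of_le hst]
    refine setIntegral_nonneg_of_ae_restrict ?_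
    refine (ae_restrict_iff' measurableSet_Ioc).2 ?_
    filter_upwards [hderiv] with x hx hxm
    have hxm' := Ioc_subset_Icc_self hxm
    rw [Pi.zero_apply, (hx hxm').deriv]
    exact hnonneg x hxm'
  linarith

theorem absolutelyContinuousOnInterval_log {s t : ℝ} (hs : 0 < s) (hst : s ≤ t) :
    AbsolutelyContinuousOnInterval Real.log s t := by
  refine AbsolutelyContinuousOnInterval.log (g := fun x => x) ?_ hs fun x hx => ?_
  · exact contDiffOn_id.absolutelyContinuousOnInterval
  · rw [uIcc_of_le hst] at hx
    exact hx.1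

namespace IsNegDriftDensity

variable {f : ℝ → ℝ} (h : IsNegDriftDensity f)
include h

theorem absolutelyContinuousOnInterval_tailProb (s t : ℝ) :
    AbsolutelyContinuousOnInterval (tailProb f) s t := by
  have h1 := (h.integrable_density.intervalIntegrable (a := s) (b := t)
    ).absolutelyContinuousOnInterval_intervalIntegral (c := s) left_mem_uIcc
  have h2 : tailProb f = fun x => tailProb f s - ∫ u in s..x, f u := by
    funext x
    rw [h.tailProb_eq x, h.tailProb_eq s, ← intervalIntegral.integral_add_adjacent_intervals
      (a := 0) (b := s) (c := x) h.integrable_density.intervalIntegrable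
      h.integrable_density.intervalIntegrable]
    ring
  rw [h2]
  refine AbsolutelyContinuousOnInterval.fun_sub ?_ h1
  exact contDiffOn_const.absolutelyContinuousOnInterval

theorem ae_hasDerivAt_cumHazard : ∀ᵐ x, HasDerivAt (cumHazard f) (hazardRate f x) x := by
  filter_upwards [LocallyIntegrable.ae_hasDerivAt_integral h.integrable_density.locallyIntegrable] with x hx
  have h2 : tailProb f = fun x => tailProb f 0 - ∫ u in (0 : ℝ)..x, f u := funext h.tailProb_eq
  have h1 : HasDerivAt (tailProb f) (-f x) x := by
    rw [h2]
    exact (hx 0).const_sub _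
  have h3 := (h1.log (h.tail_pos x).ne').neg
  rwa [neg_div, neg_neg] at h3

theorem absolutelyContinuousOnInterval_cumHazard {s t : ℝ} (hst : s ≤ t) :
    AbsolutelyContinuousOnInterval (cumHazard f) s t := by
  refine ((h.absolutelyContinuousOnInterval_tailProb s t).log (h.tail_pos t)
    fun x hx => ?_).fun_neg
  rw [uIcc_of_le hst] at hx
  exact h.tailProb_antitone hx.2

/-- The function `Λ - M log` is nondecreasing, as its derivative `λ - M/x` is nonnegative. With B1
this makes the tail lighter than every power. -/
theorem mul_log_le_cumHazard_sub {s t M : ℝ} (hs : 0 < s) (hst : s ≤ t)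
    (hM : ∀ x ∈ Icc s t, M ≤ x * hazardRate f x) :
    M * Real.log (t / s) ≤ cumHazard f t - cumHazard f s := by
  have hac : AbsolutelyContinuousOnInterval (fun x => cumHazard f x - M * Real.log x) s t :=
    (h.absolutelyContinuousOnInterval_cumHazard hst).fun_sub
      ((absolutelyContinuousOnInterval_log hs hst).const_mul M)
  have key := hac.le_of_hasDerivAt_nonneg hst (g' := fun x => hazardRate f x - M * x⁻¹) ?_ ?_
  · rw [Real.log_div (hs.trans_le hst).ne' hs.ne']
    linarith
  · filter_upwards [h.ae_hasDerivAt_cumHazard] with x hx hxm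
    exact hx.sub ((Real.hasDerivAt_log (hs.trans_le hxm.1).ne').const_mul M)
  · intro x hx
    have hx0 := hs.trans_le hx.1
    have := hM x hx
    rw [sub_nonneg, ← div_eq_mul_inv, div_le_iff₀ hx0]
    linarith

/-- The function `β log x - log Λ(x)` is nondecreasing: B2 says exactly that its derivative is
nonnegative. -/
theorem rpow_mul_cumHazard_le {s t β : ℝ} (hs : 0 < s) (hst : s ≤ t) (hΛ : 0 < cumHazard f s)
    (hβ : ∀ x ∈ Icc s t, hazardRate f x / cumHazard f x ≤ β / x) :
    (s / t) ^ β * cumHazard f t ≤ cumHazard f s := by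
  have hΛx : ∀ x ∈ Icc s t, 0 < cumHazard f x := fun x hx => hΛ.trans_le (h.cumHazard_mono hx.1)
  have ht := hs.trans_le hst
  have hac : AbsolutelyContinuousOnInterval
      (fun x => β * Real.log x - Real.log (cumHazard f x)) s t := by
    refine ((absolutelyContinuousOnInterval_log hs hst).const_mul β).fun_sub ?_
    refine (h.absolutelyContinuousOnInterval_cumHazard hst).log hΛ fun x hx => ?_
    rw [uIcc_of_le hst] at hx
    exact h.cumHazard_mono hx.1
  have key := hac.le_of_hasDerivAt_nonneg hst
    (g' := fun x => β * x⁻¹ - hazardRate f x / cumHazard f x) ?_ ?_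
  · have h1 : Real.log ((s / t) ^ β * cumHazard f t) ≤ Real.log (cumHazard f s) := by
      rw [Real.log_mul (Real.rpow_pos_of_pos (by positivity) _).ne'
        (hΛx t ⟨hst, le_rfl⟩).ne', Real.log_rpow (by positivity), Real.log_div hs.ne' ht.ne']
      linarith
    exact (Real.log_le_log_iff (mul_pos (Real.rpow_pos_of_pos (by positivity) _)
      (hΛx t ⟨hst, le_rfl⟩)) hΛ).1 h1
  · filter_upwards [h.ae_hasDerivAt_cumHazard] with x hx hxm
    exact ((Real.hasDerivAt_log (hs.trans_le hxm.1).ne').const_mul β).sub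
      (hx.log (hΛx x hxm).ne')
  · intro x hx
    have := hβ x hx
    rw [div_eq_mul_inv β] at this
    linarith

end IsNegDriftDensity

end

section

/-! ### Semiexponential tails -/

/-- Estimates, valid from `s₀` on, for a tail that satisfies B1 and B2. -/
structure HazardEstimates (f : ℝ → ℝ) (β s₀ C : ℝ) : Prop where
  one_le : 1 ≤ s₀
  C_pos : 0 < C
  scaling : ∀ s t, s₀ ≤ s → s ≤ t → (s / t) ^ β * cumHazard f t ≤ cumHazard f s
  growth : ∀ t, s₀ ≤ t → cumHazard f t ≤ C * t ^ β
  density_le : ∀ x, s₀ ≤ x → f x ≤ x * tailProb f x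
  le_density : ∀ x, s₀ ≤ x → tailProb f x ≤ x * f x
  integratedTail_le : ∀ x, s₀ ≤ x → integratedTail f x ≤ x * tailProb f x
  strictAnti : ∀ x y, s₀ ≤ x → x < y → tailProb f y < tailProb f x

namespace AssumptionB

variable {f : ℝ → ℝ} {b₀ β₀ : ℝ} (hB : AssumptionB f b₀ β₀)
include hB

theorem tailProb_pos (hP : IsProbabilityMeasure (incrementLaw f)) (x : ℝ) : 0 < tailProb f x := by
  refine tailProb_pos_of_eventually_ne_zero hP ?_ x
  -- Where the tail vanishes, the hazard rate takes the value `0` of a division by zero, against B1.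
  filter_upwards [hB.B1.eventually_gt_atTop 0] with y hy h0
  simp [hazardRate, h0] at hy

variable (h : IsNegDriftDensity f)
include h

theorem exists_mul_log_le (M : ℝ) : ∃ x₁ : ℝ, 0 < x₁ ∧ ∀ s t, x₁ ≤ s → s ≤ t →
    M * Real.log (t / s) ≤ cumHazard f t - cumHazard f s := by
  obtain ⟨x₁, hx₁⟩ := eventually_atTop.1 (hB.B1.eventually_ge_atTop M)
  refine ⟨max x₁ 1, by positivity, fun s t hs hst => ?_⟩
  refine h.mul_log_le_cumHazard_sub ?_ hst fun x hx => hx₁ x ?_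
  · exact one_pos.trans_le ((le_max_right _ _).trans hs)
  · exact ((le_max_left _ _).trans hs).trans hx.1

theorem exists_tailProb_le_rpow (M : ℝ) : ∃ x₁ : ℝ, 0 < x₁ ∧ ∀ s t, x₁ ≤ s → s ≤ t →
    tailProb f t ≤ tailProb f s * (t / s) ^ (-M) := by
  obtain ⟨x₁, hx₁, hle⟩ := hB.exists_mul_log_le h M
  refine ⟨x₁, hx₁, fun s t hs hst => ?_⟩
  have hs0 := hx₁.trans_le hs
  have ht0 := hs0.trans_le hst
  rw [← h.exp_neg_cumHazard, ← h.exp_neg_cumHazard, Real.rpow_def_of_pos (by positivity),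
    ← Real.exp_add]
  have := hle s t hs hst
  exact Real.exp_le_exp.2 (by linarith)

theorem tendsto_rpow_mul_tailProb (M : ℝ) :
    Tendsto (fun t => t ^ M * tailProb f t) atTop (𝓝 0) := by
  obtain ⟨x₁, hx₁, hle⟩ := hB.exists_tailProb_le_rpow h (M + 1)
  have hlim : Tendsto (fun t : ℝ => x₁ ^ (M + 1) * t⁻¹) atTop (𝓝 0) := by
    simpa using tendsto_inv_atTop_zero.const_mul (x₁ ^ (M + 1))
  refine tendsto_of_tendsto_of_tendsto_of_le_of_le' tendsto_const_nhds hlim ?_ ?_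
  · filter_upwards [eventually_gt_atTop 0] with t ht
    exact mul_nonneg (Real.rpow_pos_of_pos ht _).le (h.tail_pos t).le
  · filter_upwards [eventually_ge_atTop x₁] with t ht
    have ht0 := hx₁.trans_le ht
    have h1 := hle x₁ t le_rfl ht
    have h2 := h.tailProb_le_one x₁
    have h3 : tailProb f t ≤ (t / x₁) ^ (-(M + 1)) :=
      h1.trans (mul_le_of_le_one_left (Real.rpow_pos_of_pos (by positivity) _).le h2)
    have hp := Real.rpow_pos_of_pos ht0 M
    calc t ^ M * tailProb f t ≤ t ^ M * (t / x₁) ^ (-(M + 1)) := by gcongr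
      _ = x₁ ^ (M + 1) * t⁻¹ := by
        rw [Real.rpow_neg (by positivity), Real.div_rpow ht0.le hx₁.le, Real.rpow_add_one ht0.ne']
        field_simp

theorem exists_integratedTail_le :
    ∃ x₁ : ℝ, ∀ x, x₁ ≤ x → integratedTail f x ≤ x * tailProb f x := by
  obtain ⟨x₁, hx₁, hle⟩ := hB.exists_tailProb_le_rpow h 2
  refine ⟨x₁, fun x hx => ?_⟩
  have hx0 := hx₁.trans_le hx
  have hint := (integrableOn_Ioi_rpow_of_lt (show (-2 : ℝ) < -1 by norm_num) hx0).const_mul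
    (tailProb f x * x ^ 2)
  calc integratedTail f x ≤ ∫ u in Ioi x, tailProb f x * x ^ 2 * u ^ (-2 : ℝ) := by
        refine setIntegral_mono_on (h.integrableOn_tailProb x) hint measurableSet_Ioi
          fun u hu => ?_
        have hu : x < u := hu
        have hu0 := hx0.trans hu
        refine (hle x u hx hu.le).trans (le_of_eq ?_)
        rw [Real.div_rpow hu0.le hx0.le, Real.rpow_neg hx0.le, div_inv_eq_mul, Real.rpow_two]
        ring
    _ = x * tailProb f x := by
        rw [integral_const_mul, integral_Ioi_rpow_of_lt (by norm_num) hx0]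
        norm_num
        rw [Real.rpow_neg_one]
        field_simp

theorem tendsto_cumHazard_sub_mul {r : ℝ} (hr : r ∈ Ioo (0 : ℝ) 1) :
    Tendsto (fun t => cumHazard f t - cumHazard f (r * t)) atTop atTop := by
  have hlog : 0 < Real.log r⁻¹ := Real.log_pos ((one_lt_inv₀ hr.1).2 hr.2)
  refine tendsto_atTop.2 fun K => ?_
  obtain ⟨x₁, hx₁, hle⟩ := hB.exists_mul_log_le h (K / Real.log r⁻¹)
  filter_upwards [eventually_ge_atTop (x₁ / r), eventually_gt_atTop 0] with t ht ht0
  rw [div_le_iff₀ hr.1] at ht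
  have h1 := hle (r * t) t (by linarith) (by nlinarith [hr.2])
  have h2 : t / (r * t) = r⁻¹ := by
    have := hr.1.ne'
    field_simp
  rwa [h2, div_mul_cancel₀ _ hlog.ne'] at h1

/-- Scaling from one fixed point gives `Λ ≤ C t^β₀`; inserted into B2 this gives `x λ ≤ x²`, the
crude bound on the density. B1 with constant `1` gives the converse bound and strict decrease of the
tail. Polynomial losses are affordable throughout. -/
theorem exists_hazardEstimates (s₁ : ℝ) :
    ∃ s₀ C : ℝ, s₁ ≤ s₀ ∧ HazardEstimates f β₀ s₀ C := by
  have hβ0 := hB.β₀_mem.1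
  have hβ1 := hB.β₀_mem.2
  obtain ⟨x₁, hx₁⟩ := eventually_atTop.1 (h.tendsto_cumHazard_atTop.eventually_gt_atTop 0)
  set s₂ := max (max x₁ 1) b₀ with hs₂
  have hs₂1 : 1 ≤ s₂ := (le_max_right _ _).trans (le_max_left _ _)
  have hs₂b : b₀ ≤ s₂ := le_max_right _ _
  have hs₂0 : 0 < s₂ := by linarith
  have hpos : ∀ s, s₂ ≤ s → 0 < cumHazard f s := fun s hs =>
    hx₁ s (((le_max_left _ _).trans (le_max_left _ _)).trans hs)
  have hscal : ∀ s t, s₂ ≤ s → s ≤ t → (s / t) ^ β₀ * cumHazard f t ≤ cumHazard f s :=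
    fun s t hs hst => h.rpow_mul_cumHazard_le (hs₂0.trans_le hs) hst (hpos s hs)
      fun x hx => hB.B2 x ((hs₂b.trans hs).trans hx.1)
  set C := cumHazard f s₂ / s₂ ^ β₀ with hC
  have hspow : 0 < s₂ ^ β₀ := Real.rpow_pos_of_pos hs₂0 _
  have hgrow : ∀ t, s₂ ≤ t → cumHazard f t ≤ C * t ^ β₀ := by
    intro t ht
    have ht0 := hs₂0.trans_le ht
    have htpow : 0 < t ^ β₀ := Real.rpow_pos_of_pos ht0 _
    have h1 := hscal s₂ t le_rfl ht
    rw [Real.div_rpow hs₂0.le ht0.le, div_mul_eq_mul_div, div_le_iff₀ htpow] at h1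
    rw [hC, div_mul_eq_mul_div, le_div_iff₀ hspow]
    linarith
  have hC0 : 0 < C := div_pos (hpos s₂ le_rfl) hspow
  obtain ⟨x₂, hx₂⟩ := eventually_atTop.1 (hB.B1.eventually_ge_atTop 1)
  obtain ⟨x₃, hx₃⟩ := hB.exists_integratedTail_le h
  obtain ⟨x₄, hx₄, hx₄'⟩ := hB.exists_mul_log_le h 1
  set s₀ := max s₁ (max s₂ (max C (max x₂ (max x₃ x₄)))) with hs₀
  have k1 : s₁ ≤ s₀ := le_max_left _ _
  have k2 : s₂ ≤ s₀ := by simp [hs₀]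
  have k3 : C ≤ s₀ := by simp [hs₀]
  have k4 : x₂ ≤ s₀ := by simp [hs₀]
  have k5 : x₃ ≤ s₀ := by simp [hs₀]
  have k6 : x₄ ≤ s₀ := by simp [hs₀]
  refine ⟨s₀, C, k1, hs₂1.trans k2, hC0, fun s t hs => hscal s t (k2.trans hs),
    fun t ht => hgrow t (k2.trans ht), fun x hx => ?_, fun x hx => ?_,
    fun x hx => hx₃ x (k5.trans hx), fun x y hx hxy => ?_⟩
  · have hx2 := k2.trans hx
    have hx0 : 0 < x := hs₂0.trans_le hx2
    have hΛ := hpos x hx2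
    have h1 := hB.B2 x (hs₂b.trans hx2)
    rw [div_le_div_iff₀ hΛ hx0, hazardRate, div_mul_eq_mul_div, div_le_iff₀ (h.tail_pos x)] at h1
    have h2 : cumHazard f x ≤ x * x := by
      have h3 : x ^ β₀ ≤ x := by
        calc x ^ β₀ ≤ x ^ (1 : ℝ) := Real.rpow_le_rpow_of_exponent_le (hs₂1.trans hx2) hβ1.le
          _ = x := Real.rpow_one x
      exact (hgrow x hx2).trans (mul_le_mul (k3.trans hx) h3 (Real.rpow_nonneg hx0.le _) hx0.le)
    have h4 : β₀ * cumHazard f x * tailProb f x ≤ 1 * (x * x) * tailProb f x := by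
      have := h.tail_pos x
      gcongr
    refine le_of_mul_le_mul_right ?_ hx0
    linarith
  · have h1 := hx₂ x (k4.trans hx)
    rw [hazardRate, ← mul_div_assoc, le_div_iff₀ (h.tail_pos x)] at h1
    linarith
  · have hx0 : 0 < x := hs₂0.trans_le (k2.trans hx)
    have h1 := hx₄' x y (k6.trans hx) hxy.le
    have h2 : 0 < Real.log (y / x) := Real.log_pos ((one_lt_div hx0).2 hxy)
    rw [← h.exp_neg_cumHazard, ← h.exp_neg_cumHazard]
    exact Real.exp_lt_exp.2 (by linarith)

end AssumptionB

namespace HazardEstimates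

variable {f : ℝ → ℝ} {β s₀ C : ℝ} (hE : HazardEstimates f β s₀ C) (h : IsNegDriftDensity f)
  (hβ : β ∈ Ioo (0 : ℝ) 1)
include hE h hβ

/-- Since `u ≤ u^β` on `[0, 1]`, scaling gives `Λ(t - d) ≥ (1 - d/t) Λ(t)`, and `Λ(t) ≤ C t^β`. As
`β < 1`, bounded shifts change `Λ` by `o(1)`, which is the long-tail property. -/
theorem cumHazard_sub_le {t d : ℝ} (hd : 0 ≤ d) (htd : s₀ ≤ t - d) :
    cumHazard f t - cumHazard f (t - d) ≤ C * t ^ (β - 1) * d := by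
  have hs0 : 0 < s₀ := one_pos.trans_le hE.one_le
  have ht0 : 0 < t := by linarith
  have h1 := hE.scaling (t - d) t htd (by linarith)
  have hu0 : 0 ≤ (t - d) / t := div_nonneg (by linarith) ht0.le
  have hu1 : (t - d) / t ≤ 1 := (div_le_one ht0).2 (by linarith)
  have h2 : (t - d) / t ≤ ((t - d) / t) ^ β := by
    rcases hu0.eq_or_lt with h0 | h0
    · rw [← h0, Real.zero_rpow hβ.1.ne']
    · calc (t - d) / t = ((t - d) / t) ^ (1 : ℝ) := (Real.rpow_one _).symm
        _ ≤ _ := Real.rpow_le_rpow_of_exponent_ge h0 hu1 hβ.2.le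
  have hΛ := h.cumHazard_nonneg t
  have h3 : (t - d) / t * cumHazard f t ≤ cumHazard f (t - d) :=
    (mul_le_mul_of_nonneg_right h2 hΛ).trans h1
  have h4 : (t - d) / t = 1 - d / t := by field_simp
  rw [h4] at h3
  have h5 : d / t * cumHazard f t ≤ d / t * (C * t ^ β) :=
    mul_le_mul_of_nonneg_left (hE.growth t (by linarith)) (by positivity)
  have h6 : d / t * (C * t ^ β) = C * t ^ (β - 1) * d := by
    rw [Real.rpow_sub_one ht0.ne']
    field_simp
  linarith

theorem longTailed : LongTailed f := by
  refine longTailed_of_nonneg fun x hx => ?_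
  have hlim : Tendsto (fun t : ℝ => Real.exp (C * t ^ (β - 1) * x)) atTop (𝓝 1) := by
    have h1 := ((tendsto_rpow_neg_atTop (show 0 < 1 - β by linarith [hβ.2])).const_mul C).mul_const x
    rw [mul_zero, zero_mul, neg_sub] at h1
    have h2 := (Real.continuous_exp.tendsto 0).comp h1
    rw [Real.exp_zero] at h2
    exact h2
  refine tendsto_of_tendsto_of_tendsto_of_le_of_le' tendsto_const_nhds hlim ?_ ?_
  · exact Eventually.of_forall fun t =>
      (one_le_div (h.tail_pos t)).2 (h.tailProb_antitone (by linarith))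
  · filter_upwards [eventually_ge_atTop (s₀ + x)] with t ht
    rw [← h.exp_neg_cumHazard, ← h.exp_neg_cumHazard, ← Real.exp_sub]
    have := hE.cumHazard_sub_le h hβ hx (show s₀ ≤ t - x by linarith)
    exact Real.exp_le_exp.2 (by linarith)

end HazardEstimates

end

section

/-! ### The shift by a constant amount of cumulative hazard -/

/-- The distance `d` with `Λ(t - d) = Λ(t) - a`. -/
def hazardShift (f : ℝ → ℝ) (a t : ℝ) : ℝ := t - cumHazardInv f (cumHazard f t - a)

theorem sub_hazardShift (f : ℝ → ℝ) (a t : ℝ) :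
    t - hazardShift f a t = cumHazardInv f (cumHazard f t - a) := by
  simp [hazardShift]

theorem IsNegDriftDensity.measurable_hazardShift {f : ℝ → ℝ} (h : IsNegDriftDensity f) (a : ℝ) :
    Measurable (hazardShift f a) :=
  measurable_id.sub
    (h.measurable_cumHazardInv.comp (h.continuous_cumHazard.measurable.sub measurable_const))

theorem IsNegDriftDensity.cumHazard_sub_hazardShift {f : ℝ → ℝ} (h : IsNegDriftDensity f) (a : ℝ) :
    ∀ᶠ t in atTop, cumHazard f (t - hazardShift f a t) = cumHazard f t - a := by
  filter_upwards [h.eventually_pos_cumHazard_sub a] with t ht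
  rw [sub_hazardShift, h.cumHazard_cumHazardInv ht]

theorem IsNegDriftDensity.tailProb_sub_hazardShift {f : ℝ → ℝ} (h : IsNegDriftDensity f) (a : ℝ) :
    ∀ᶠ t in atTop, tailProb f (t - hazardShift f a t) = Real.exp a * tailProb f t := by
  filter_upwards [h.eventually_pos_cumHazard_sub a] with t ht
  rw [sub_hazardShift, h.tailProb_cumHazardInv_sub ht]

namespace AssumptionB

variable {f : ℝ → ℝ} {b₀ β₀ a : ℝ} (hB : AssumptionB f b₀ β₀) (h : IsNegDriftDensity f)
include hB h

theorem hazardShift_lt (a : ℝ) {r : ℝ} (hr : r ∈ Ioo (0 : ℝ) 1) :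
    ∀ᶠ t in atTop, hazardShift f a t < r * t := by
  have hr' : 1 - r ∈ Ioo (0 : ℝ) 1 := ⟨by linarith [hr.2], by linarith [hr.1]⟩
  filter_upwards [(hB.tendsto_cumHazard_sub_mul h hr').eventually_gt_atTop a,
    h.eventually_pos_cumHazard_sub a] with t ht hta
  have := (h.lt_cumHazardInv_iff (x := (1 - r) * t) hta).2 (by linarith)
  rw [hazardShift]
  linarith

omit hB in
theorem hazardShift_pos (ha : 0 < a) : ∀ᶠ t in atTop, 0 < hazardShift f a t := by
  filter_upwards [h.cumHazard_sub_hazardShift a] with t ht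
  by_contra hle
  have := h.cumHazard_mono (show t ≤ t - hazardShift f a t by linarith)
  linarith

/-- By definition the hazard drops by `a` over the shift `d`, while the drop is at most `C t^(β₀ -
1) d`. -/
theorem exists_mul_rpow_le_hazardShift (ha : 0 < a) :
    ∃ K : ℝ, 0 < K ∧ ∀ᶠ t in atTop, K * t ^ (1 - β₀) ≤ hazardShift f a t := by
  obtain ⟨s₀, C, -, hE⟩ := hB.exists_hazardEstimates h 0
  have hC := hE.C_pos
  refine ⟨a / C, by positivity, ?_⟩
  filter_upwards [h.cumHazard_sub_hazardShift a, hazardShift_pos h ha,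
    hB.hazardShift_lt h a (r := 1 / 2) ⟨by norm_num, by norm_num⟩, eventually_ge_atTop (2 * s₀),
    eventually_gt_atTop 0] with t h1 h2 h3 h4 ht0
  have h5 := hE.cumHazard_sub_le (t := t) (d := hazardShift f a t) h hB.β₀_mem h2.le (by linarith)
  rw [h1, sub_sub_cancel] at h5
  have hp := Real.rpow_pos_of_pos ht0 (1 - β₀)
  have h6 : t ^ (β₀ - 1) = (t ^ (1 - β₀))⁻¹ := by
    rw [← Real.rpow_neg ht0.le, neg_sub]
  rw [h6] at h5
  rw [div_mul_eq_mul_div, div_le_iff₀ hC]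
  calc a * t ^ (1 - β₀) ≤ C * (t ^ (1 - β₀))⁻¹ * hazardShift f a t * t ^ (1 - β₀) := by gcongr
    _ = _ := by field_simp

theorem tendsto_hazardShift (ha : 0 < a) : Tendsto (hazardShift f a) atTop atTop := by
  obtain ⟨K, hK, hle⟩ := hB.exists_mul_rpow_le_hazardShift h ha
  exact tendsto_atTop_mono' _ hle
    ((tendsto_rpow_atTop (by linarith [hB.β₀_mem.2])).const_mul_atTop hK)

/-- The shift is at least a power of `t`, so a power of `t` is at most a power of the shift, and the
tail beats every power. This absorbs the polynomial losses in the outer interpolating components. -/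
theorem tendsto_pow_mul_tailProb_hazardShift (ha : 0 < a) (N : ℕ) :
    Tendsto (fun t => t ^ N * tailProb f (hazardShift f a t)) atTop (𝓝 0) := by
  obtain ⟨K, hK, hle⟩ := hB.exists_mul_rpow_le_hazardShift h ha
  have hβ : 0 < 1 - β₀ := by linarith [hB.β₀_mem.2]
  set M : ℝ := N / (1 - β₀) with hM
  have hM0 : 0 ≤ M := by positivity
  have hKM := Real.rpow_pos_of_pos hK M
  have hlim := ((hB.tendsto_rpow_mul_tailProb h M).comp (hB.tendsto_hazardShift h ha)).const_mul
    (K ^ M)⁻¹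
  rw [mul_zero] at hlim
  refine tendsto_of_tendsto_of_tendsto_of_le_of_le' tendsto_const_nhds hlim ?_ ?_
  · filter_upwards [eventually_ge_atTop 0] with t ht
    exact mul_nonneg (by positivity) (h.tail_pos _).le
  · filter_upwards [hle, eventually_gt_atTop 0] with t ht ht0
    have h1 : K ^ M * t ^ N ≤ hazardShift f a t ^ M := by
      calc K ^ M * t ^ N = (K * t ^ (1 - β₀)) ^ M := by
            rw [Real.mul_rpow hK.le (Real.rpow_nonneg ht0.le _), ← Real.rpow_mul ht0.le, hM,
              mul_div_cancel₀ _ hβ.ne', Real.rpow_natCast]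
        _ ≤ _ := Real.rpow_le_rpow (mul_nonneg hK.le (Real.rpow_nonneg ht0.le _)) ht hM0
    have := h.tail_pos (hazardShift f a t)
    simp only [Function.comp_apply]
    calc t ^ N * tailProb f (hazardShift f a t)
        = (K ^ M)⁻¹ * (K ^ M * t ^ N * tailProb f (hazardShift f a t)) := by field_simp
      _ ≤ _ := by gcongr

/-- By concavity the hazard grows over `[t, t + d]` by at most its growth `a` over `[t - d, t]`, so
`F(t) ≤ e^a F(t + d)`. Hence `G(t - d) - G(t) ≤ d e^a F(t) ≤ e^(2a) d F(t + d) ≤ e^(2a) G(t)`. -/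
theorem eventually_integratedTail_sub_hazardShift_le (ha : 0 < a) :
    ∀ᶠ t in atTop, integratedTail f (t - hazardShift f a t) ≤
      (1 + Real.exp a ^ 2) * integratedTail f t := by
  filter_upwards [h.cumHazard_sub_hazardShift a, h.tailProb_sub_hazardShift a,
    hazardShift_pos h ha, hB.hazardShift_lt h a (r := 1 / 2) ⟨by norm_num, by norm_num⟩,
    eventually_ge_atTop (2 * b₀)] with t h1 h2 h3 h4 ht
  set d := hazardShift f a t
  have hb := hB.b₀_pos
  have hconc := hB.B3.2 (show t - d ∈ Ici b₀ by simp; linarith)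
    (show t + d ∈ Ici b₀ by simp; linarith) (show (0 : ℝ) ≤ 1 / 2 by norm_num)
    (show (0 : ℝ) ≤ 1 / 2 by norm_num) (by norm_num)
  have hmid : (1 / 2 : ℝ) • (t - d) + (1 / 2 : ℝ) • (t + d) = t := by
    simp only [smul_eq_mul]; ring
  rw [hmid, h1, smul_eq_mul, smul_eq_mul] at hconc
  have h5 : tailProb f t ≤ Real.exp a * tailProb f (t + d) := by
    rw [← h.exp_neg_cumHazard, ← h.exp_neg_cumHazard, ← Real.exp_add]
    exact Real.exp_le_exp.2 (by linarith)
  have h6 := h.mul_tailProb_le_integratedTail_sub (x := t) (y := t + d) (by linarith)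
  have h7 := h.integratedTail_sub_le_mul_tailProb (x := t - d) (y := t) (by linarith)
  have h8 := h.integratedTail_pos (t + d)
  have hea := Real.exp_pos a
  rw [h2] at h7
  have h9 : (t - (t - d)) * (Real.exp a * tailProb f t) ≤
      d * (Real.exp a * (Real.exp a * tailProb f (t + d))) := by
    rw [sub_sub_cancel]
    gcongr
  have h10 : d * tailProb f (t + d) ≤ integratedTail f t := by
    rw [add_sub_cancel_left] at h6
    linarith
  have h11 : Real.exp a ^ 2 * (d * tailProb f (t + d)) ≤ Real.exp a ^ 2 * integratedTail f t := by
    gcongr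
  linarith

end AssumptionB

/-! ### The cut-off points under Assumption B -/

theorem cutB_zero (f : ℝ → ℝ) (aReg aBig : ℝ) (k : ℕ) (a : ℕ → ℝ) :
    cutB f aReg aBig k a 0 = hazardShift f aReg := by
  funext t
  simp [cutB, hazardShift]

theorem cutB_mid (f : ℝ → ℝ) (aReg aBig : ℝ) {k : ℕ} (a : ℕ → ℝ) {j : ℕ} (hj : 1 ≤ j) (hjk : j < k) :
    cutB f aReg aBig k a j = fun t => a j * t := by
  funext t
  rw [cutB, if_neg (by omega), if_pos hjk]

theorem cutB_last (f : ℝ → ℝ) (aReg aBig : ℝ) {k : ℕ} (a : ℕ → ℝ) (hk : 1 ≤ k) :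
    cutB f aReg aBig k a k = fun t => t - hazardShift f aBig t := by
  funext t
  rw [sub_hazardShift, cutB, if_neg (by omega), if_neg (lt_irrefl k)]

namespace IsGrid

variable {β σ : ℝ} {k : ℕ} {a : ℕ → ℝ} (hg : IsGrid β σ k a)
include hg

theorem pos {j : ℕ} (hj : 1 ≤ j) (hjk : j < k) : 0 < a j := by
  induction j, hj using Nat.le_induction with
  | base => exact hg.first_pos
  | succ j hj ih => exact (ih (by omega)).trans (hg.increasing j hj (by omega))

theorem le_last_of_lt {j : ℕ} (hj : 1 ≤ j) (hjk : j < k) : a j ≤ a (k - 1) := by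
  have key : ∀ m, j ≤ m → m < k → a j ≤ a m := by
    intro m hm
    induction m, hm using Nat.le_induction with
    | base => exact fun _ => le_rfl
    | succ m hm ih =>
      exact fun hmk => (ih (by omega)).trans (hg.increasing m (by omega) (by omega)).le
  exact key (k - 1) (by omega) (by omega)

theorem mem_Ioo {j : ℕ} (hj : 1 ≤ j) (hjk : j < k) : a j ∈ Ioo (0 : ℝ) 1 :=
  ⟨hg.pos hj hjk, (hg.le_last_of_lt hj hjk).trans_lt hg.last_lt⟩

end IsGrid

namespace AssumptionB

variable {f : ℝ → ℝ} {b₀ β₀ aReg aBig σ : ℝ} {k : ℕ} {a : ℕ → ℝ} (hB : AssumptionB f b₀ β₀)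
  (h : IsNegDriftDensity f) (hg : IsGrid β₀ σ k a) (hr : 0 < aReg) (hb : 0 < aBig)
include hB h hg

theorem eventually_cutB_lt (aReg aBig : ℝ) :
    ∀ᶠ t in atTop, ∀ j < k, cutB f aReg aBig k a j t < cutB f aReg aBig k a (j + 1) t := by
  have hk := hg.two_le
  have h1 := hg.mem_Ioo le_rfl (by omega)
  have hl := hg.mem_Ioo (j := k - 1) (by omega) (by omega)
  filter_upwards [hB.hazardShift_lt h aReg h1, hB.hazardShift_lt h aBig
    (r := 1 - a (k - 1)) ⟨by linarith [hl.2], by linarith [hl.1]⟩, eventually_gt_atTop 0]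
    with t ht1 ht2 ht0 j hj
  rcases Nat.eq_zero_or_pos j with rfl | hj0
  · rw [cutB_zero, cutB_mid _ _ _ _ le_rfl (by omega)]
    exact ht1
  · rw [cutB_mid _ _ _ _ hj0 hj]
    rcases Nat.lt_or_ge (j + 1) k with hjk | hjk
    · rw [cutB_mid _ _ _ _ (by omega) hjk]
      exact mul_lt_mul_of_pos_right (hg.increasing j hj0 (by omega)) ht0
    · obtain rfl : k = j + 1 := by omega
      rw [cutB_last _ _ _ _ (by omega)]
      rw [Nat.add_sub_cancel] at ht2
      simp only
      linarith

include hr hb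

theorem cutConditions_mass : ∀ᶠ t in atTop,
    (∀ j ∈ Finset.Icc 1 k, j < k →
      0 < (incrementLaw f).real (Ioc (cutB f aReg aBig k a (j - 1) t) (cutB f aReg aBig k a j t))) ∧
    0 < (incrementLaw f).real
      (Ioc (t - cutB f aReg aBig k a k t) (t - cutB f aReg aBig k a (k - 1) t)) := by
  have hk := hg.two_le
  obtain ⟨s₀, C, -, hE⟩ := hB.exists_hazardEstimates h 0
  filter_upwards [hB.eventually_cutB_lt h hg aReg aBig,
    (hB.tendsto_hazardShift h hr).eventually_ge_atTop s₀,
    (hB.tendsto_hazardShift h hb).eventually_ge_atTop s₀] with t ht hr0 hb0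
  set T : Tuning := withSelectedWeights f 0 k 0 (cutB f aReg aBig k a) with hT
  constructor
  · intro j hj hjk
    obtain ⟨hj1, -⟩ := Finset.mem_Icc.1 hj
    have hlt := ht (j - 1) (by omega)
    rw [Nat.sub_add_cancel hj1] at hlt
    rw [h.real_Ioc hlt.le, sub_pos]
    refine hE.strictAnti _ _ ?_ hlt
    refine hr0.trans ?_
    rw [← cutB_zero f aReg aBig k a]
    exact Tuning.cut_le_cut (T := T) ht (Nat.zero_le _) (show j - 1 ≤ k by omega)
  · have hlt := ht (k - 1) (by omega)
    rw [Nat.sub_add_cancel (by omega)] at hlt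
    rw [h.real_Ioc (by linarith), sub_pos]
    refine hE.strictAnti _ _ ?_ (by linarith)
    rw [cutB_last _ _ _ _ (by omega)]
    simpa using hb0

end AssumptionB

/-! ### The interpolating components -/

namespace HazardEstimates

variable {f : ℝ → ℝ} {β s₀ C : ℝ} (hE : HazardEstimates f β s₀ C) (h : IsNegDriftDensity f)
include hE h

theorem tailProb_le_exp {s t : ℝ} (hs : s₀ ≤ s) (hst : s ≤ t) :
    tailProb f s ≤ Real.exp (-((s / t) ^ β * cumHazard f t)) := by
  rw [← h.exp_neg_cumHazard]
  exact Real.exp_le_exp.2 (neg_le_neg (hE.scaling s t hs hst))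

/-- With `u = y/t`, scaling and the choice of `σ` give `2Λ(t-y) + Λ(y) ≥ (2(1-u)^β + u^β) Λ(t) ≥
2Λ(t)`. -/
theorem tailProb_sq_mul_le {σ y t : ℝ}
    (hσ : ∀ x ∈ Icc (0 : ℝ) σ, 2 - 2 * (1 - x) ^ β - x ^ β ≤ 0) (hy : s₀ ≤ y) (hty : s₀ ≤ t - y)
    (hyσ : y ≤ σ * t) : tailProb f (t - y) ^ 2 * tailProb f y ≤ tailProb f t ^ 2 := by
  have hs0 : 0 < s₀ := one_pos.trans_le hE.one_le
  have ht0 : 0 < t := by linarith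
  have h1 := hE.scaling (t - y) t hty (by linarith)
  have h2 := hE.scaling y t hy (by linarith)
  have h3 := hσ (y / t) ⟨div_nonneg (by linarith) ht0.le, (div_le_iff₀ ht0).2 hyσ⟩
  have h4 : (t - y) / t = 1 - y / t := by field_simp
  rw [h4] at h1
  have h5 := mul_le_mul_of_nonneg_right h3 (h.cumHazard_nonneg t)
  rw [← h.exp_neg_cumHazard, ← h.exp_neg_cumHazard, ← h.exp_neg_cumHazard, ← Real.exp_nat_mul,
    ← Real.exp_nat_mul, ← Real.exp_add]
  refine Real.exp_le_exp.2 ?_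
  push_cast
  linarith

theorem density_mul_integratedTail_sq_le {x t : ℝ} (hx : s₀ ≤ x) (htx : s₀ ≤ t - x) :
    f x * integratedTail f (t - x) ^ 2 ≤ t ^ 3 * (tailProb f x * tailProb f (t - x) ^ 2) := by
  have hs0 : 0 < s₀ := one_pos.trans_le hE.one_le
  have hFx := h.tail_pos x
  have hFt := h.tail_pos (t - x)
  have h1 : f x ≤ t * tailProb f x :=
    (hE.density_le x hx).trans (by gcongr; linarith)
  have h2 : integratedTail f (t - x) ≤ t * tailProb f (t - x) :=
    (hE.integratedTail_le _ htx).trans (by gcongr; linarith)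
  have h3 := h.integratedTail_pos (t - x)
  have ht0 : 0 ≤ t := by linarith
  calc f x * integratedTail f (t - x) ^ 2
      ≤ (t * tailProb f x) * (t * tailProb f (t - x)) ^ 2 := by gcongr
    _ = _ := by ring

end HazardEstimates

end

section

/-! ### The bound on the interpolating components under Assumption B -/

section

variable {f : ℝ → ℝ} {β s₀ C σ σ₂ t x : ℝ} (hE : HazardEstimates f β s₀ C)
  (h : IsNegDriftDensity f)
include h

theorem IsNegDriftDensity.real_Ioc_le_tailProb (x y : ℝ) :
    (incrementLaw f).real (Ioc x y) ≤ tailProb f x := by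
  have := h.isProb
  exact measureReal_mono Ioc_subset_Ioi_self

include hE

/-- Here `x ≤ σ t`, so one `f x` and the squared `G` are absorbed into `F(t)²`; the other `f x` is
the numerator of the component, and its normalizing mass `R ≤ F(c)` supplies the small factor. -/
theorem HazardEstimates.first_component_le {c R : ℝ}
    (hσ : ∀ x ∈ Icc (0 : ℝ) σ, 2 - 2 * (1 - x) ^ β - x ^ β ≤ 0) (hx : s₀ ≤ x) (htx : s₀ ≤ t - x)
    (hxσ : x ≤ σ * t) (hR : 0 < R) (hRc : R ≤ tailProb f c) (hf : 0 ≤ f x) :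
    t * f x ^ 2 * integratedTail f (t - x) ^ 2 ≤
      t ^ 4 * tailProb f c * tailProb f t ^ 2 * (f x / R) := by
  have h1 := hE.density_mul_integratedTail_sq_le h hx htx
  have h2 := hE.tailProb_sq_mul_le h hσ hx htx hxσ
  have ht0 : 0 ≤ t := by linarith [hE.one_le]
  rw [mul_div_assoc', le_div_iff₀ hR]
  calc t * f x ^ 2 * integratedTail f (t - x) ^ 2 * R
      = t * f x * (f x * integratedTail f (t - x) ^ 2) * R := by ring
    _ ≤ t * f x * (t ^ 3 * (tailProb f x * tailProb f (t - x) ^ 2)) * R := by gcongr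
    _ = t ^ 4 * f x * (tailProb f (t - x) ^ 2 * tailProb f x) * R := by ring
    _ ≤ t ^ 4 * f x * tailProb f t ^ 2 * tailProb f c := by gcongr
    _ = _ := by ring

theorem HazardEstimates.tailProb_mul_tailProb_le {p r : ℝ} (hp : s₀ ≤ p * t) (hr : s₀ ≤ r * t)
    (hp1 : p ≤ 1) (hr1 : r ≤ 1) (ht : 0 < t) (hgap : 1 + σ₂ ≤ p ^ β + r ^ β) :
    tailProb f (p * t) * tailProb f (r * t) ≤ tailProb f t * tailProb f t ^ σ₂ := by
  have h1 := hE.tailProb_le_exp h hp (mul_le_of_le_one_left ht.le hp1)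
  have h2 := hE.tailProb_le_exp h hr (mul_le_of_le_one_left ht.le hr1)
  rw [mul_div_cancel_right₀ _ ht.ne'] at h1 h2
  refine (mul_le_mul h1 h2 (h.tail_pos _).le (Real.exp_pos _).le).trans ?_
  rw [← h.exp_neg_cumHazard t, ← Real.exp_add, ← Real.exp_mul, ← Real.exp_add]
  refine Real.exp_le_exp.2 ?_
  have := mul_le_mul_of_nonneg_right hgap (h.cumHazard_nonneg t)
  linarith

/-- Each tail is evaluated at the worst endpoint of the cell. The normalizing mass supplies a second
factor `F(pt)`, so the square of `F(pt) F((1-q)t)` appears, and the grid gap makes it smaller than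
`F(t)²` by the factor `F(t)^(2σ₂)`. -/
theorem HazardEstimates.inner_component_le {p q R : ℝ} (hp : s₀ ≤ p * t) (hq : s₀ ≤ (1 - q) * t)
    (hp1 : p ≤ 1) (hq0 : 0 ≤ q) (ht : 0 < t) (hgap : 1 + σ₂ ≤ p ^ β + (1 - q) ^ β)
    (hxp : p * t ≤ x) (hxq : x ≤ q * t) (hR : 0 < R) (hRc : R ≤ tailProb f (p * t))
    (hf : 0 ≤ f x) :
    t * f x ^ 2 * integratedTail f (t - x) ^ 2 ≤
      t ^ 4 * (tailProb f t ^ σ₂) ^ 2 * tailProb f t ^ 2 * (f x / R) := by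
  have h1 := hE.density_mul_integratedTail_sq_le h (hp.trans hxp)
    (show s₀ ≤ t - x by linarith)
  have h2 := hE.tailProb_mul_tailProb_le h hp hq hp1 (by linarith) ht hgap
  have h3 := h.tailProb_antitone hxp
  have h4 := h.tailProb_antitone (show (1 - q) * t ≤ t - x by linarith)
  have h5 := h.tail_pos (p * t)
  have h6 := h.tail_pos ((1 - q) * t)
  have h7 := h.tail_pos (t - x)
  rw [mul_div_assoc', le_div_iff₀ hR]
  calc t * f x ^ 2 * integratedTail f (t - x) ^ 2 * R
      = t * f x * (f x * integratedTail f (t - x) ^ 2) * R := by ring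
    _ ≤ t * f x * (t ^ 3 * (tailProb f x * tailProb f (t - x) ^ 2)) * R := by gcongr
    _ ≤ t * f x * (t ^ 3 * (tailProb f (p * t) * tailProb f ((1 - q) * t) ^ 2)) *
          tailProb f (p * t) := by gcongr
    _ = t ^ 4 * f x * (tailProb f (p * t) * tailProb f ((1 - q) * t)) ^ 2 := by ring
    _ ≤ t ^ 4 * f x * (tailProb f t * tailProb f t ^ σ₂) ^ 2 := by gcongr
    _ = _ := by ring

/-- Near `t` the roles of `x` and `t - x` are exchanged: `F(x)² F(t-x) ≤ F(t)²`. The remaining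
factor `F(t-x)` is at most `t f(t-x)`, which the reflected density matches. -/
theorem HazardEstimates.last_component_le {c R : ℝ}
    (hσ : ∀ x ∈ Icc (0 : ℝ) σ, 2 - 2 * (1 - x) ^ β - x ^ β ≤ 0) (hx : s₀ ≤ x) (htx : s₀ ≤ t - x)
    (hxσ : t - x ≤ σ * t) (hR : 0 < R) (hRc : R ≤ tailProb f c) (hf : 0 ≤ f x)
    (hf' : 0 ≤ f (t - x)) :
    t * f x ^ 2 * integratedTail f (t - x) ^ 2 ≤
      t ^ 6 * tailProb f c * tailProb f t ^ 2 * (f (t - x) / R) := by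
  have hs0 := hE.one_le
  have ht0 : 0 ≤ t := by linarith
  have hF := h.tail_pos (t - x)
  have hFx := h.tail_pos x
  have hG := h.integratedTail_pos (t - x)
  have h1 : f x ≤ t * tailProb f x := (hE.density_le x hx).trans (by gcongr; linarith)
  have h2 : integratedTail f (t - x) ≤ t * tailProb f (t - x) :=
    (hE.integratedTail_le _ htx).trans (by gcongr; linarith)
  have h3 : tailProb f (t - x) ≤ t * f (t - x) :=
    (hE.le_density _ htx).trans (by gcongr; linarith)
  have hc0 := h.tail_pos c
  have h4 := hE.tailProb_sq_mul_le h hσ htx (show s₀ ≤ t - (t - x) by linarith) hxσ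
  rw [sub_sub_cancel] at h4
  rw [mul_div_assoc', le_div_iff₀ hR]
  calc t * f x ^ 2 * integratedTail f (t - x) ^ 2 * R
      ≤ t * (t * tailProb f x) ^ 2 * (t * tailProb f (t - x)) ^ 2 * R := by gcongr
    _ = t ^ 5 * (tailProb f x ^ 2 * tailProb f (t - x)) * R * tailProb f (t - x) := by ring
    _ ≤ t ^ 5 * tailProb f t ^ 2 * tailProb f c * (t * f (t - x)) := by gcongr
    _ = _ := by ring

end

namespace AssumptionB

variable {f : ℝ → ℝ} {b₀ β₀ aReg aBig σ : ℝ} {k : ℕ} {a : ℕ → ℝ} (hB : AssumptionB f b₀ β₀)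
  (h : IsNegDriftDensity f)
include hB h

theorem tendsto_pow_mul_tailProb_rpow {σ₂ : ℝ} (hσ₂ : 0 < σ₂) :
    Tendsto (fun t => t ^ 4 * (tailProb f t ^ σ₂) ^ 2) atTop (𝓝 0) := by
  -- The exponent `2/σ₂` becomes `4` after raising to the power `σ₂` and squaring.
  have hlim := ((hB.tendsto_rpow_mul_tailProb h (2 / σ₂)).rpow_const (p := σ₂)
    (Or.inr hσ₂.le)).pow 2
  rw [Real.zero_rpow hσ₂.ne', zero_pow two_ne_zero] at hlim
  refine hlim.congr' ?_
  filter_upwards [eventually_gt_atTop 0] with t ht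
  rw [Real.mul_rpow (Real.rpow_nonneg ht.le _) (h.tail_pos t).le, ← Real.rpow_mul ht.le,
    div_mul_cancel₀ _ hσ₂.ne', Real.rpow_two]
  ring

variable (hg : IsGrid β₀ σ k a) (hr : 0 < aReg) (hb : 0 < aBig)
include hg hr hb

theorem cutConditions_mid_bound : ∃ e : ℝ → ℝ, Tendsto e atTop (𝓝 0) ∧ ∀ᶠ t in atTop,
    ∀ j ∈ Finset.Icc 1 k, ∀ x ∈ Ioc (cutB f aReg aBig k a (j - 1) t) (cutB f aReg aBig k a j t),
      t * f x ^ 2 * integratedTail f (t - x) ^ 2 ≤ e t * tailProb f t ^ 2 *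
        midComponent f (withSelectedWeights f 0 k 0 (cutB f aReg aBig k a)) j t x := by
  have hk := hg.two_le
  obtain ⟨s₀, C, -, hE⟩ := hB.exists_hazardEstimates h 0
  obtain ⟨σ₂, hσ₂, hgap⟩ := hg.gap
  -- One summand for each kind of component: the first, the inner ones and the last.
  refine ⟨fun t => t ^ 4 * tailProb f (hazardShift f aReg t) + t ^ 4 * (tailProb f t ^ σ₂) ^ 2 +
    t ^ 6 * tailProb f (hazardShift f aBig t), ?_, ?_⟩
  · simpa using ((hB.tendsto_pow_mul_tailProb_hazardShift h hr 4).add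
      (hB.tendsto_pow_mul_tailProb_rpow h hσ₂)).add
      (hB.tendsto_pow_mul_tailProb_hazardShift h hb 6)
  filter_upwards [hB.eventually_cutB_lt h hg aReg aBig, hB.cutConditions_mass h hg hr hb,
    (hB.tendsto_hazardShift h hr).eventually_ge_atTop s₀,
    (hB.tendsto_hazardShift h hb).eventually_ge_atTop s₀, eventually_gt_atTop 0]
    with t hlt hmass hr0 hb0 ht0 j hj x hx
  obtain ⟨hj1, hjk⟩ := Finset.mem_Icc.1 hj
  set c := cutB f aReg aBig k a with hc
  set T : Tuning := withSelectedWeights f 0 k 0 c with hT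
  have hc0 : ∀ i ≤ k, s₀ ≤ c i t := fun i hi => by
    refine hr0.trans ?_
    rw [← cutB_zero f aReg aBig k a]
    exact Tuning.cut_le_cut (T := T) hlt (Nat.zero_le _) hi
  have hck : ∀ i ≤ k, s₀ ≤ t - c i t := fun i hi => by
    have h1 : c i t ≤ c k t := Tuning.cut_le_cut (T := T) hlt hi le_rfl
    rw [hc, cutB_last _ _ _ _ (by omega), ← hc] at h1
    linarith
  have hx0 : s₀ ≤ x := (hc0 (j - 1) (by omega)).trans hx.1.le
  have htx : s₀ ≤ t - x := (hck j hjk).trans (by linarith [hx.2])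
  have hP4 : 0 ≤ t ^ 4 * (tailProb f t ^ σ₂) ^ 2 := by positivity
  have hPr : 0 ≤ t ^ 4 * tailProb f (hazardShift f aReg t) :=
    mul_nonneg (by positivity) (h.tail_pos _).le
  have hPb : 0 ≤ t ^ 6 * tailProb f (hazardShift f aBig t) :=
    mul_nonneg (by positivity) (h.tail_pos _).le
  have hf := h.nonneg
  rcases hjk.lt_or_eq with hjk' | rfl
  · have hmid : midComponent f T j t x =
        f x / (incrementLaw f).real (Ioc (c (j - 1) t) (c j t)) := by
      simp only [midComponent, hT, withSelectedWeights, if_pos hjk', indicator_of_mem hx]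
    have hR := hmass.1 j hj hjk'
    have hRle := h.real_Ioc_le_tailProb (c (j - 1) t) (c j t)
    have hmid0 := div_nonneg (hf x) hR.le
    rw [hmid]
    rcases hj1.eq_or_lt with rfl | hj2
    · rw [hc, Nat.sub_self, cutB_zero, ← hc] at hRle
      have hxσ : x ≤ σ * t := by
        refine hx.2.trans ?_
        rw [hc, cutB_mid _ _ _ _ le_rfl hjk']
        exact mul_le_mul_of_nonneg_right hg.first_le ht0.le
      refine (hE.first_component_le h hg.σ_small hx0 htx hxσ hR hRle (hf x)).trans ?_
      gcongr
      linarith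
    · have hcj : c j t = a j * t := by rw [hc, cutB_mid _ _ _ _ hj1 hjk']
      have hcj' : c (j - 1) t = a (j - 1) * t := by
        rw [hc, cutB_mid _ _ _ _ (by omega) (by omega)]
      have hA := hg.mem_Ioo (j := j - 1) (by omega) (by omega)
      have hA' := hg.mem_Ioo hj1 hjk'
      have hg' := hgap (j - 1) (by omega) (by omega)
      rw [Nat.sub_add_cancel hj1] at hg'
      have hs1 := hc0 (j - 1) (by omega)
      have hs2 := hck j hjk
      have hx' := hx
      rw [hcj, hcj'] at hx'
      rw [hcj'] at hs1
      rw [hcj] at hs2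
      refine (hE.inner_component_le h hs1 (by linarith) hA.2.le hA'.1.le ht0 hg' hx'.1.le hx'.2
        hR (hRle.trans_eq (by rw [hcj'])) (hf x)).trans ?_
      gcongr
      linarith
  · have hmid : midComponent f T j t x =
        f (t - x) / (incrementLaw f).real (Ioc (t - c j t) (t - c (j - 1) t)) := by
      simp only [midComponent, hT, withSelectedWeights, if_neg (lt_irrefl j), indicator_of_mem hx]
    have hR := hmass.2
    have hRle := h.real_Ioc_le_tailProb (t - c j t) (t - c (j - 1) t)
    have hdiff : t - c j t = hazardShift f aBig t := by
      rw [hc, cutB_last _ _ _ _ hj1, sub_sub_cancel]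
    have hmid0 := div_nonneg (hf (t - x)) hR.le
    have hxσ : t - x ≤ σ * t := by
      have h1 := hx.1
      rw [hc, cutB_mid _ _ _ _ (by omega) (by omega)] at h1
      have h2 := mul_le_mul_of_nonneg_right hg.le_last ht0.le
      linarith
    rw [hmid]
    refine (hE.last_component_le h hg.σ_small hx0 htx hxσ hR (hRle.trans_eq (by rw [hdiff]))
      (hf x) (hf (t - x))).trans ?_
    gcongr
    linarith

theorem cutConditions : CutConditions f k (cutB f aReg aBig k a) where
  long := by
    obtain ⟨s₀, C, -, hE⟩ := hB.exists_hazardEstimates h 0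
    exact hE.longTailed h hB.β₀_mem
  measurable j := by
    rcases Nat.eq_zero_or_pos j with rfl | hj
    · rw [cutB_zero]
      exact h.measurable_hazardShift _
    rcases Nat.lt_or_ge j k with hjk | hjk
    · rw [cutB_mid _ _ _ _ hj hjk]
      exact measurable_const.mul measurable_id
    · have : cutB f aReg aBig k a j = fun t => t - hazardShift f aBig t := by
        funext t
        rw [sub_hazardShift, cutB, if_neg (by omega), if_neg (by omega)]
      rw [this]
      exact measurable_id.sub (h.measurable_hazardShift _)
  tendsto := by
    rw [cutB_zero]
    exact hB.tendsto_hazardShift h hr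
  bound := by
    have hr' := Real.exp_pos aReg
    have hb' := Real.exp_pos aBig
    refine ⟨Real.exp aReg + (1 + Real.exp aReg ^ 2) + Real.exp aBig, by positivity, ?_⟩
    filter_upwards [h.tailProb_sub_hazardShift aReg,
      hB.eventually_integratedTail_sub_hazardShift_le h hr, h.tailProb_sub_hazardShift aBig]
      with t h1 h2 h3
    have hF := h.tail_pos t
    have hG := h.integratedTail_pos t
    rw [cutB_zero, cutB_last _ _ _ _ (by linarith [hg.two_le])]
    refine ⟨h1.le.trans (mul_le_mul_of_nonneg_right ?_ hF.le),
      h2.trans (mul_le_mul_of_nonneg_right ?_ hG.le),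
      h3.le.trans (mul_le_mul_of_nonneg_right ?_ hF.le)⟩ <;> nlinarith
  cut_lt := hB.eventually_cutB_lt h hg _ _
  last_le hk := by
    filter_upwards [hazardShift_pos h hb] with t ht
    rw [cutB_last _ _ _ _ hk]
    simp only
    linarith
  mid_mass := (hB.cutConditions_mass h hg hr hb).mono fun _ => And.left
  last_mass _ := (hB.cutConditions_mass h hg hr hb).mono fun _ => And.right
  mid_bound := hB.cutConditions_mid_bound h hg hr hb

end AssumptionB

end

section

/-! ### Existence of grids -/

theorem one_lt_rpow_add_rpow {β x : ℝ} (hβ : β < 1) (hx : x ∈ Ioo (0 : ℝ) 1) :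
    1 < x ^ β + (1 - x) ^ β := by
  have h1 := Real.rpow_lt_rpow_of_exponent_gt hx.1 hx.2 hβ
  have h2 := Real.rpow_lt_rpow_of_exponent_gt (x := 1 - x) (by linarith [hx.2])
    (by linarith [hx.1]) hβ
  rw [Real.rpow_one] at h1 h2
  linarith

/-- Since `(1-x)^β ≥ 1 - x`, the left side is at most `2x - x^β`; the bound on `x` says `x^(1-β) ≤
1/2`, that is, `2x ≤ x^β`. -/
theorem two_sub_two_mul_rpow_sub_rpow_nonpos {β x : ℝ} (hβ : β ∈ Ioo (0 : ℝ) 1)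
    (hx : x ∈ Icc (0 : ℝ) ((1 / 2 : ℝ) ^ (1 / (1 - β)))) (hx1 : x ≤ 1) :
    2 - 2 * (1 - x) ^ β - x ^ β ≤ 0 := by
  have hβ' : 0 < 1 - β := by linarith [hβ.2]
  have h1 : 1 - x ≤ (1 - x) ^ β := by
    have := Real.rpow_le_rpow_of_exponent_ge_of_imp (x := 1 - x) (y := 1) (z := β) (by linarith)
      (by linarith [hx.1]) hβ.2.le (fun _ h0 => absurd h0 one_ne_zero)
    rwa [Real.rpow_one] at this
  rcases hx.1.eq_or_lt with rfl | hx0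
  · simp [Real.zero_rpow hβ.1.ne']
  have h2 : x ^ (1 - β) ≤ 1 / 2 := by
    calc x ^ (1 - β) ≤ ((1 / 2 : ℝ) ^ (1 / (1 - β))) ^ (1 - β) := by
          gcongr
          exact hx.2
      _ = 1 / 2 := by
          rw [← Real.rpow_mul (by norm_num), one_div_mul_cancel hβ'.ne', Real.rpow_one]
  have h3 : x = x ^ (1 - β) * x ^ β := by
    rw [← Real.rpow_add hx0, sub_add_cancel, Real.rpow_one]
  have h4 := Real.rpow_pos_of_pos hx0 β
  nlinarith

/-- By compactness `x^β + (1-x)^β - 1` has a positive minimum `m` on `[σ, 1-σ]`. Subadditivity of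
the power shows that replacing `1 - x` by `1 - x - d` costs at most `d^β`, which is below `m/2` on a
fine equidistant grid. -/
theorem exists_isGrid {β : ℝ} (hβ : β ∈ Ioo (0 : ℝ) 1) :
    ∃ (σ : ℝ) (k : ℕ) (a : ℕ → ℝ), IsGrid β σ k a := by
  have hβ' : 0 < 1 - β := by linarith [hβ.2]
  obtain ⟨σ, hσ0, hσ1, hσ2⟩ : ∃ σ : ℝ, 0 < σ ∧ σ ≤ (1 / 2 : ℝ) ^ (1 / (1 - β)) ∧ σ ≤ 1 / 4 :=
    ⟨min ((1 / 2 : ℝ) ^ (1 / (1 - β))) (1 / 4), by positivity, min_le_left _ _, min_le_right _ _⟩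
  have hcont : Continuous fun x : ℝ => x ^ β + (1 - x) ^ β :=
    (continuous_id.rpow_const fun _ => Or.inr hβ.1.le).add
      ((continuous_const.sub continuous_id).rpow_const fun _ => Or.inr hβ.1.le)
  obtain ⟨x₀, hx₀, hmin⟩ := isCompact_Icc.exists_isMinOn
    (nonempty_Icc.2 (by linarith : σ ≤ 1 - σ))
    hcont.continuousOn
  simp only [IsMinOn, IsMinFilter, eventually_principal] at hmin
  set m := x₀ ^ β + (1 - x₀) ^ β - 1 with hm
  have hm0 : 0 < m := by
    have := one_lt_rpow_add_rpow hβ.2 (x := x₀)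
      ⟨by linarith [hx₀.1], by linarith [hx₀.2]⟩
    linarith
  have hunif : ∃ ρ : ℝ, 0 < ρ ∧ ∀ h, 0 ≤ h → h < ρ → h ^ β < m / 2 := by
    have hc : ContinuousAt (fun h : ℝ => h ^ β) 0 :=
      Real.continuousAt_rpow_const _ _ (Or.inr hβ.1.le)
    have := hc.eventually_lt (g := fun _ => m / 2) continuousAt_const
      (by rw [Real.zero_rpow hβ.1.ne']; positivity)
    obtain ⟨ρ, hρ, hball⟩ := Metric.eventually_nhds_iff.1 this
    exact ⟨ρ, hρ, fun h h0 h1 => hball (by rwa [Real.dist_0_eq_abs, abs_of_nonneg h0])⟩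
  obtain ⟨ρ, hρ, hpow⟩ := hunif
  obtain ⟨N, hN⟩ := exists_nat_gt (1 / min ρ (σ / 2))
  have hmin0 : 0 < min ρ (σ / 2) := by positivity
  have hN0 : (0 : ℝ) < N := (by positivity : (0 : ℝ) < 1 / min ρ (σ / 2)).trans hN
  have hstep : (1 - 2 * σ) / N < min ρ (σ / 2) := by
    rw [div_lt_iff₀ hmin0] at hN
    rw [div_lt_iff₀ hN0]
    linarith
  set d := (1 - 2 * σ) / N with hd
  have hd0 : 0 < d := div_pos (by linarith) hN0
  have hNd : N * d = 1 - 2 * σ := by rw [hd]; field_simp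
  -- The `N + 1` points run from `a 1 = σ` to `a (k - 1) = 1 - σ` in steps of `d`, so `k = N + 2`.
  refine ⟨σ, N + 2, fun j => σ + ((j : ℝ) - 1) * d, hσ0, fun x hx => ?_, by omega, ?_, ?_, ?_, ?_,
    fun j _ _ => ?_, fun j _ _ => ?_, m / 2, by positivity, fun j hj hjk => ?_⟩
  · exact two_sub_two_mul_rpow_sub_rpow_nonpos hβ ⟨hx.1, hx.2.trans hσ1⟩ (by linarith [hx.2])
  · simpa using hσ0
  · simp
  · rw [show N + 2 - 1 = N + 1 by omega]
    push_cast
    linarith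
  · rw [show N + 2 - 1 = N + 1 by omega]
    push_cast
    linarith
  · push_cast
    linarith
  · push_cast
    linarith [min_le_right ρ (σ / 2)]
  · have hj1 : (1 : ℝ) ≤ j := by exact_mod_cast hj
    have hjN : (j : ℝ) ≤ N := by exact_mod_cast (by omega : j ≤ N)
    set x := σ + ((j : ℝ) - 1) * d with hx
    have hxl : σ ≤ x := by
      have : 0 ≤ ((j : ℝ) - 1) * d := mul_nonneg (by linarith) hd0.le
      linarith
    have hxd : x + d ≤ 1 - σ := by
      have : (j : ℝ) * d ≤ N * d := by gcongr
      linarith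
    have h1 := hmin x ⟨hxl, by linarith⟩
    have h2 := hpow d hd0.le (hstep.trans_le (min_le_left _ _))
    have h3 := Real.rpow_add_le_add_rpow (p := β) (a := 1 - x - d) (b := d) (by linarith) hd0.le
      hβ.1.le hβ.2.le
    rw [sub_add_cancel] at h3
    have h4 : 1 - (σ + (((j + 1 : ℕ) : ℝ) - 1) * d) = 1 - x - d := by
      push_cast
      linarith
    rw [h4]
    linarith

end

end

/-! ### The main theorem -/

theorem mainTheorem1 {Ω : Type*} [MeasurableSpace Ω] (P : Measure Ω) [IsProbabilityMeasure P]
    (X : ℕ → Ω → ℝ) (hX : ∀ n, Measurable (X n)) (hindep : iIndepFun X P)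
    (f : ℝ → ℝ) (hf : Measurable f) (hf_nonneg : ∀ x, 0 ≤ f x)
    (hlaw : ∀ n, Measure.map (X n) P = incrementLaw f)
    (hint : Integrable (fun x : ℝ => x) (incrementLaw f)) (hmean : meanOf f < 0) :
    (∀ ι : ℝ, AssumptionA f ι →
      ∀ δ ∈ Set.Ioo (0 : ℝ) (1 / 4), ∀ aBig : ℝ, 0 < aBig →
        ∃ η₀ : ℝ, 0 < η₀ ∧ ∀ η : ℝ, η₀ ≤ η →
          (∃ aReg : ℝ → ℝ, ∀ t, η < t →
            0 < aReg t ∧ cumHazard f (t - cutA f aBig t) = cumHazard f t - aReg t) ∧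
          StronglyEfficient P X f (selectA f δ aBig η)) ∧
    (∀ b₀ β₀ : ℝ, AssumptionB f b₀ β₀ →
      (∃ (σ : ℝ) (k : ℕ) (a : ℕ → ℝ), IsGrid β₀ σ k a) ∧
      ∀ (σ : ℝ) (k : ℕ) (a : ℕ → ℝ), IsGrid β₀ σ k a →
        ∀ δ ∈ Set.Ioo (0 : ℝ) (1 / 4), ∀ aReg : ℝ, 0 < aReg → ∀ aBig : ℝ, 0 < aBig →
          ∃ η₀ : ℝ, 0 < η₀ ∧ ∀ η : ℝ, η₀ ≤ η →
            StronglyEfficient P X f (selectB f δ aReg aBig k a η)) := by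
  have hprob : IsProbabilityMeasure (incrementLaw f) :=
    hlaw 0 ▸ Measure.isProbabilityMeasure_map (hX 0).aemeasurable
  -- Positivity of the tail is not assumed; it follows separately from either set of tail
  -- assumptions.
  have main : (∀ x, 0 < tailProb f x) → IsNegDriftDensity f := fun htail =>
    { measurable := hf
      nonneg := hf_nonneg
      isProb := hprob
      integrable := hint
      mean_neg := hmean
      tail_pos := htail }
  refine ⟨fun ι hA δ hδ aBig hBig => ?_, fun b₀ β₀ hB => ⟨exists_isGrid hB.β₀_mem,
    fun σ k a hg δ hδ aReg hReg aBig hBig => ?_⟩⟩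
  · have h := main (hA.tailProb_pos hprob)
    obtain ⟨η₁, hη₁, heff⟩ :=
      (hA.cutConditions h hBig).exists_stronglyEfficient P hX hindep h hlaw hδ
    obtain ⟨η₂, hη₂⟩ := eventually_atTop.1 (hA.eventually_cumHazard_sub_cutA_lt h hBig)
    refine ⟨max η₁ η₂, hη₁.trans_le (le_max_left _ _), fun η hη =>
      ⟨⟨fun t => cumHazard f t - cumHazard f (t - cutA f aBig t), fun t ht => ⟨?_, ?_⟩⟩,
        heff η ((le_max_left _ _).trans hη)⟩⟩
    · exact sub_pos.2 (hη₂ t ((le_max_right _ _).trans (hη.trans ht.le)))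
    · exact (sub_sub_cancel _ _).symm
  · have h := main (hB.tailProb_pos hprob)
    exact (hB.cutConditions h hg hReg hBig).exists_stronglyEfficient P hX hindep h hlaw hδ
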